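/- Throughout, $3<p<5$, $s_p=\frac32-\frac2{p-1}$, $R_1>R_W\ge 0$, $C_5$ is a constant, and $W\in C^2(\{x\in\mathbb R^3:|x|>R_W\})$ is a radial function with $|W(x)|\lesssim |x|^{-1}$ and $|\nabla W(x)|\lesssim|x|^{-2}$ for large $|x|$. Let $F:[0,\infty)\times\mathbb R\to\mathbb R$ be continuous with $$|F(r,a)|\le |a|^p,\qquad |F(r,a)-F(r,b)|\le C_5|a-b|\left(|a|^{p-1}+|b|^{p-1}\right),$$ and assume that $-\Delta W=F(|x|,W)$ for $|x|>R_W$. A function $u(x,t)$ is called a solution of $\partial_t^2u-\Delta u=F(|x|,u)$ on a time interval $I$ if $(u,\partial_tu)\in C(I;\dot H^{s_p}\times\dot H^{s_p-1}(\mathbb R^3))$, if $$\int_J\|u(\cdot,t)\|_{L^{2p/(2-s_p)}(\mathbb R^3)}^{2p/(1+s_p)}\,dt<\infty$$ for every bounded closed interval $J\subseteq I$, and if for all $t,t_0\in I$ $$u(\cdot,t)=\cos\!\big((t-t_0)\sqrt{-\Delta}\big)u(\cdot,t_0)+\frac{\sin((t-t_0)\sqrt{-\Delta})}{\sqrt{-\Delta}}\partial_tu(\cdot,t_0)+\int_{t_0}^t\frac{\sin((t-\tau)\sqrt{-\Delta})}{\sqrt{-\Delta}}F(|\cdot|,u(\cdot,\tau))\,d\tau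 .$$ If $(u(\cdot,t),\partial_tu(\cdot,t))$ and $(W,0)$ coincide for large $|x|$, the essential radius of support is $$R(t)=\min\{R\ge R_W:\ (u(x,t)-W(x),\partial_tu(x,t))=(0,0)\ \text{for } |x|>R\}.$$ **Theorem (behaviour of compact solution).** There is a constant $\tau>0$, depending only on $p,R_1,C_5$ and $W$ (including its domain $\{|x|>R_W\}$), such that the following holds for every $F$ as above. Let $I$ be a time interval containing a neighbourhood of $t_0$, and let $u$ be a radial solution of $\partial_t^2u-\Delta u=F(|x|,u)$ on $I$ such that (I) $(u,\partial_tu)\in C\big(I;\dot H^1\times L^2(\mathbb R^3\setminus B(0,R_W))\big)$; (II) the pair $(u(\cdot,t_0)-W,\partial_tu(\cdot,t_0))$ is compactly supported, with essential radius of support $R(t_0)>R_1$. Then the essential radius $R(t)$ is defined and the identity $$R(t)=R(t_0)+|t-t_0|$$ holds either for every $t\in[t_0,t_0+\tau]\cap I$ or for every $t\in[t_0-\tau,t_0]\cap I$. -/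

import Mathlib

open MeasureTheory Filter Topology
open scoped SchwartzMap FourierTransform

noncomputable section

namespace RadialWave

/-- Physical space `ℝ³`, with the Euclidean norm. -/
abbrev E3 : Type := EuclideanSpace ℝ (Fin 3)

/-- The exterior region `{x ∈ ℝ³ : |x| > R}`. -/
def exterior (R : ℝ) : Set E3 := {x | R < ‖x‖}

/-- The critical exponent `s_p = 3/2 - 2/(p-1)`. -/
def critExp (p : ℝ) : ℝ := 3 / 2 - 2 / (p - 1)

/-- The tempered distribution `T` is (integration against) the function `f`. -/
def IsFunction (T : 𝓢'(E3, ℂ)) (f : E3 → ℂ) : Prop :=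
  ∀ φ : 𝓢(E3, ℂ), Integrable (fun x => φ x * f x) ∧ T φ = ∫ x, φ x * f x

/-- The tempered distribution `T` agrees with the function `f` on the open set `Ω`. -/
def AgreesOn (T : 𝓢'(E3, ℂ)) (f : E3 → ℂ) (Ω : Set E3) : Prop :=
  ∀ φ : 𝓢(E3, ℂ), HasCompactSupport φ → tsupport φ ⊆ Ω → T φ = ∫ x, φ x * f x

/-- `T ∈ C(I; Ḣ^s(ℝ³))`: for `t ∈ I` the Fourier transform of `T t` is a function `g t` with
`|ξ|^s g t ∈ L²`, and `t ↦ |ξ|^s g t` is continuous from `I` to `L²`. -/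
def ContinuousInHdot (s : ℝ) (I : Set ℝ) (T : ℝ → 𝓢'(E3, ℂ)) : Prop :=
  ∃ g : ℝ → E3 → ℂ, ∀ t ∈ I,
    IsFunction (𝓕 (T t)) (g t) ∧
    MemLp (fun ξ => ((‖ξ‖ ^ s : ℝ) : ℂ) * g t ξ) 2 volume ∧
    Tendsto (fun t' => eLpNorm (fun ξ => ((‖ξ‖ ^ s : ℝ) : ℂ) * (g t' ξ - g t ξ)) 2 volume)
      (𝓝[I] t) (𝓝 0)

/-- The symbol of `cos (t √(-Δ))`. With the normalisation `e^{-2πi x·ξ}` of the Fourier transform,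
`√(-Δ)` has symbol `2π|ξ|`. -/
def cosSymbol (t : ℝ) (ξ : E3) : ℂ := (Real.cos (2 * Real.pi * t * ‖ξ‖) : ℝ)

/-- The symbol of `sin (t √(-Δ)) / √(-Δ)`, namely `sin (2πt|ξ|) / (2π|ξ|)`, equal to `t` at `0`. -/
def sinSymbol (t : ℝ) (ξ : E3) : ℂ := (t * Real.sinc (2 * Real.pi * t * ‖ξ‖) : ℝ)

/-- First component of the linear wave propagator:
`S_{L,0}(t)(T₀, T₁) = cos (t √(-Δ)) T₀ + (sin (t √(-Δ)) / √(-Δ)) T₁`. -/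
def linearWave (t : ℝ) (T₀ T₁ : 𝓢'(E3, ℂ)) : 𝓢'(E3, ℂ) :=
  TemperedDistribution.fourierMultiplierCLM ℂ (cosSymbol t) T₀ +
    TemperedDistribution.fourierMultiplierCLM ℂ (sinSymbol t) T₁

/-- The norm `‖u‖_{Y(J)} = ‖u‖_{L^{2p/(1+s_p)} L^{2p/(2-s_p)}(J × ℝ³)}` is finite. -/
def FiniteYNorm (p : ℝ) (J : Set ℝ) (u : ℝ → E3 → ℝ) : Prop :=
  ∫⁻ t in J, eLpNorm (u t) (ENNReal.ofReal (2 * p / (2 - critExp p))) volume ^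
    (2 * p / (1 + critExp p)) < ⊤

/-- `u`, with `U t` the distribution `u(·, t)` and `V t` the distribution `∂ₜu(·, t)`, is a solution
on the time interval `I` of `∂ₜ²u - Δu = F(|x|, u)`. The Duhamel integral is tested against Schwartz
functions, with the (symmetric) operator `sin ((t-τ)√(-Δ)) / √(-Δ)` put on the test function. -/
structure IsSolution (p : ℝ) (F : ℝ → ℝ → ℝ) (I : Set ℝ)
    (u : ℝ → E3 → ℝ) (U V : ℝ → 𝓢'(E3, ℂ)) : Prop where
  measurable : AEStronglyMeasurable (Function.uncurry u) ((volume.restrict I).prod volume)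
  isFunction : ∀ t ∈ I, IsFunction (U t) (fun x => (u t x : ℂ))
  timeDeriv : ∀ t ∈ I, ∀ φ : 𝓢(E3, ℂ), HasDerivWithinAt (fun τ => U τ φ) (V t φ) I t
  continuous_fst : ContinuousInHdot (critExp p) I U
  continuous_snd : ContinuousInHdot (critExp p - 1) I V
  finite_Y : ∀ a b : ℝ, Set.Icc a b ⊆ I → FiniteYNorm p (Set.Icc a b) u
  duhamel : ∀ t ∈ I, ∀ t₀ ∈ I, ∀ φ : 𝓢(E3, ℂ),
    U t φ = linearWave (t - t₀) (U t₀) (V t₀) φ +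
      ∫ τ in t₀..t, ∫ x : E3,
        SchwartzMap.fourierMultiplierCLM ℂ (sinSymbol (t - τ)) φ x * (F ‖x‖ (u τ x) : ℂ)

/-- A function on `ℝ³` (defined almost everywhere) is radial. -/
def IsRadial (f : E3 → ℝ) : Prop := ∃ h : ℝ → ℝ, f =ᵐ[volume] fun x => h ‖x‖

/-- `G` is the weak gradient of `f` on the open set `Ω`. -/
def IsWeakGradientOn (f : E3 → ℝ) (G : E3 → E3) (Ω : Set E3) : Prop :=
  ∀ φ : E3 → ℝ, ContDiff ℝ (⊤ : ℕ∞) φ → HasCompactSupport φ → tsupport φ ⊆ Ω → ∀ e : E3,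
    ∫ x, f x * fderiv ℝ φ x e = -∫ x, inner ℝ (G x) e * φ x

/-- `(u, ∂ₜu) ∈ C(I; Ḣ¹ × L²(Ω))`, where `V t` is the distribution `∂ₜu(·, t)`: on `Ω` the weak
gradient of `u(·, t)` and `∂ₜu(·, t)` are square integrable functions that depend continuously on
`t ∈ I` in `L²(Ω)`. -/
def ContinuousInEnergy (Ω : Set E3) (I : Set ℝ) (u : ℝ → E3 → ℝ) (V : ℝ → 𝓢'(E3, ℂ)) : Prop :=
  ∃ (G : ℝ → E3 → E3) (v : ℝ → E3 → ℝ), ∀ t ∈ I,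
    IsWeakGradientOn (u t) (G t) Ω ∧ AgreesOn (V t) (fun x => (v t x : ℂ)) Ω ∧
    MemLp (G t) 2 (volume.restrict Ω) ∧ MemLp (v t) 2 (volume.restrict Ω) ∧
    Tendsto (fun t' => eLpNorm (fun x => G t' x - G t x) 2 (volume.restrict Ω))
      (𝓝[I] t) (𝓝 0) ∧
    Tendsto (fun t' => eLpNorm (fun x => v t' x - v t x) 2 (volume.restrict Ω))
      (𝓝[I] t) (𝓝 0)

/-- `R = min {R ≥ R_W : (f - W, T) = (0, 0) for |x| > R}`, the essential radius of support of the
pair `(f - W, T)`; in particular the set is nonempty, i.e. the pair is compactly supported. -/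
def IsEssentialRadius (RW : ℝ) (W f : E3 → ℝ) (T : 𝓢'(E3, ℂ)) (R : ℝ) : Prop :=
  IsLeast {R : ℝ | RW ≤ R ∧ (∀ᵐ x ∂(volume : Measure E3), x ∈ exterior R → f x = W x) ∧
    Distribution.IsVanishingOn T (exterior R)} R

/-- The standing assumptions on the nonlinearity `F : [0, ∞) × ℝ → ℝ`. -/
structure IsNonlinearity (p C₅ : ℝ) (F : ℝ → ℝ → ℝ) : Prop where
  continuousOn : ContinuousOn (Function.uncurry F) (Set.Ici 0 ×ˢ Set.univ)
  growth : ∀ r, 0 ≤ r → ∀ a, |F r a| ≤ |a| ^ p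
  lipschitz : ∀ r, 0 ≤ r → ∀ a b,
    |F r a - F r b| ≤ C₅ * |a - b| * (|a| ^ (p - 1) + |b| ^ (p - 1))

/-- `W` is a radial `C²` function on `{|x| > R_W}` with `|W| ≲ 1/|x|` and `|∇W| ≲ 1/|x|²` for
large `|x|`. -/
structure IsRadialProfile (RW : ℝ) (W : E3 → ℝ) : Prop where
  contDiffOn : ContDiffOn ℝ 2 W (exterior RW)
  radial : ∀ x ∈ exterior RW, ∀ y ∈ exterior RW, ‖x‖ = ‖y‖ → W x = W y
  decay : ∃ C M : ℝ, ∀ x ∈ exterior RW, M < ‖x‖ →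
    |W x| ≤ C / ‖x‖ ∧ ‖fderiv ℝ W x‖ ≤ C / ‖x‖ ^ 2

/-- `-ΔW = F(|x|, W)` on `{|x| > R_W}`. -/
def SolvesElliptic (RW : ℝ) (F : ℝ → ℝ → ℝ) (W : E3 → ℝ) : Prop :=
  ∀ x ∈ exterior RW, -(Laplacian.laplacian W) x = F ‖x‖ (W x)

end RadialWave

end

/-! Put y = r (u - W), as a function of t and r = |x| > R_W. In three dimensions it solves ∂ₜ²y -
∂ᵣ²y = h with h = r (F(r, u) - F(r, W)). On compact sets of (t, r) both u and W are bounded, so the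
Lipschitz hypothesis on F gives |h| ≤ C |y|, and this linear bound is all that is kept of the
nonlinearity. For ε = ±1 the quantity ∂ₜy - ε ∂ᵣy has derivative h along the lines r = ρ + ε (s -
t).

Finite speed of propagation (`IsHalfLineWave.eq_zero_of_vanishing`) makes y vanish for r > R(t₀) +
|t - t₀|, so the support never grows faster than at unit speed. What remains is that it cannot lag
behind both at some later time t₁ and at some earlier time t₂. This is
`IsHalfLineWave.exists_vanishing_of_two_times`. Suppose it does lag at both times. Choose ρ < R(t₀)
close to R(t₀), let T bound the time span and let M bound |y| on r > ρ + |s - t₀|, t₂ ≤ s ≤ t₁. From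
a point (t₀, x) with x > ρ, follow the line with ε = 1 forward to t₁ and the line with ε = -1 back
to t₂: both run outward and end where y and ∂ₜy are zero. Hence both characteristic quantities are
at most C T M at time t₀, and at most 2 C T M at any time s, so |∂ᵣy| ≤ 2 C T M. Since y is zero
beyond R(t₀) + |s - t₀| and only a strip of width R(t₀) - ρ is left, |y| ≤ 2 C T (R(t₀) - ρ) M ≤ M /
2. Iteration gives y = 0 for r > ρ + |s - t₀|, which contradicts the minimality of R(t₀). The length
of the time interval affects only the choice of ρ.

The rest of the proof derives the one-dimensional equation from the definition of a solution. Taylor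
identities for the symbols of the propagators and Fubini turn Duhamel's formula into ∂ₜ²u = Δu +
F(|x|, u), integrated in time (`IsSolution.eq_add_integral`, `IsSolution.timeDeriv_sub`). Testing
with θ(|x|)/|x|, whose Laplacian is θ''(|x|)/|x|, gives the weak equation on the half-line
(`isHalfLineWave_sub`). The energy hypothesis bounds the radial derivative in L², so u has a
representative that is locally 1/2-Hölder in r and jointly continuous
(`exists_radial_representative`). Because ∂ₜy is only square integrable, the characteristics are
followed for mollifications in r (`charac`), with bounds that do not depend on the scale κ. -/

noncomputable section

namespace RadialWave

/-! ### Temperate growth of the symbols of the wave propagators. -/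

section Symbols

variable {E : Type*} [NormedAddCommGroup E] [InnerProductSpace ℝ E]

/-- A sequence of bounded functions, each of whose gradients is a multiple of `x` times the next
function, consists of functions of temperate growth. -/
theorem hasTemperateGrowth_of_fderiv_eq {f : ℕ → E → ℝ} {c : ℕ → ℝ}
    (hb : ∀ k x, |f k x| ≤ 1)
    (hd : ∀ k x, HasFDerivAt (f k) ((c k * f (k + 1) x) • innerSL ℝ x) x) (k : ℕ) :
    (f k).HasTemperateGrowth := by
  have hfd : ∀ k, fderiv ℝ (f k) = fun x => (c k * f (k + 1) x) • innerSL ℝ x :=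
    fun k => funext fun x => (hd k x).fderiv
  have hdiff : ∀ k, Differentiable ℝ (f k) := fun k x => (hd k x).differentiableAt
  have hI : (fun x : E => innerSL ℝ x).HasTemperateGrowth :=
    (innerSL ℝ : E →L[ℝ] E →L[ℝ] ℝ).hasTemperateGrowth
  have hcd : ∀ (n : ℕ) k, ContDiff ℝ n (f k) := by
    intro n
    induction n with
    | zero => exact fun k => contDiff_zero.2 (hdiff k).continuous
    | succ n ih =>
      intro k
      push_cast
      refine contDiff_succ_iff_fderiv.2 ⟨hdiff k, by simp, ?_⟩
      rw [hfd k]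
      exact (contDiff_const.mul (ih (k + 1))).smul (hI.1.of_le (by exact_mod_cast le_top))
  -- The induction on the order treats all k at once, because one derivative of `f k` brings in `f
  -- (k + 1)`; it is strong because the Leibniz rule for f · x involves every lower order.
  have hbd : ∀ n k, ∃ (m : ℕ) (C : ℝ), ∀ x, ‖iteratedFDeriv ℝ n (f k) x‖ ≤ C * (1 + ‖x‖) ^ m := by
    intro n
    induction n using Nat.strong_induction_on with
    | _ n ih =>
      intro k
      rcases n with _ | n
      · exact ⟨0, 1, fun x => by simpa using hb k x⟩
      · choose! m C hC using fun i (hi : i ≤ n) => ih i (Nat.lt_succ_of_le hi) (k + 1)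
        obtain ⟨l, D, hD0, hD⟩ := hI.norm_iteratedFDeriv_le_uniform n
        refine ⟨(∑ i ∈ Finset.range (n + 1), m i) + l,
          |c k| * ∑ i ∈ Finset.range (n + 1), (n.choose i : ℝ) * |C i| * D, fun x => ?_⟩
        have h1 : (1 : ℝ) ≤ 1 + ‖x‖ := by linarith [norm_nonneg x]
        have heq : fderiv ℝ (f k) = c k • fun x => f (k + 1) x • innerSL ℝ x := by
          rw [hfd k]; ext x; simp [mul_assoc]
        rw [← norm_iteratedFDeriv_fderiv, heq, iteratedFDeriv_const_smul_apply, norm_smul,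
          Real.norm_eq_abs, mul_assoc]
        · gcongr
          refine (norm_iteratedFDeriv_smul_le (hcd n (k + 1))
            (hI.1.of_le (by exact_mod_cast le_top)) x le_rfl).trans ?_
          rw [Finset.sum_mul]
          refine Finset.sum_le_sum fun i hi => ?_
          have hin : i ≤ n := Nat.lt_succ_iff.1 (Finset.mem_range.1 hi)
          have e1 : ‖iteratedFDeriv ℝ i (f (k + 1)) x‖ ≤
              |C i| * (1 + ‖x‖) ^ (∑ i ∈ Finset.range (n + 1), m i) := by
            refine (hC i hin x).trans ?_
            refine mul_le_mul (le_abs_self _) (pow_le_pow_right₀ h1 ?_) (by positivity)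
              (abs_nonneg _)
            exact Finset.single_le_sum (fun _ _ => Nat.zero_le _) hi
          have e2 := hD (n - i) (Nat.sub_le _ _) x
          calc _ ≤ (n.choose i : ℝ) * (|C i| * (1 + ‖x‖) ^ (∑ i ∈ Finset.range (n + 1), m i)) *
                (D * (1 + ‖x‖) ^ l) := by gcongr
            _ = _ := by rw [pow_add]; ring
        · exact ((hcd n (k + 1)).smul (hI.1.of_le (by exact_mod_cast le_top))).contDiffAt
  refine ⟨contDiff_infty.2 fun n => hcd n k, fun n => hbd n k⟩

/-- The cosine is even, so the singularity of the norm at the origin does no harm: there cos (b|y|)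
- 1 = O(|y|²). Elsewhere this is the chain rule, with `sinc` absorbing the division by |x|. -/
theorem hasFDerivAt_cos_mul_norm (b : ℝ) (x : E) :
    HasFDerivAt (fun y : E => Real.cos (b * ‖y‖))
      ((-(b ^ 2 * Real.sinc (b * ‖x‖))) • innerSL ℝ x) x := by
  rcases eq_or_ne x 0 with rfl | hx
  · simp only [map_zero, smul_zero]
    rw [← hasFDerivAt_sub_const_iff (1 : ℝ)]
    refine Asymptotics.IsBigO.hasFDerivAt (n := 2) ?_ (by norm_num)
    refine Asymptotics.IsBigO.of_bound (b ^ 2 / 2) (Eventually.of_forall fun y => ?_)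
    have h1 := Real.one_sub_sq_div_two_le_cos (x := b * ‖y‖)
    have h2 := Real.cos_le_one (b * ‖y‖)
    rw [sub_zero, norm_pow, norm_norm, Real.norm_eq_abs, abs_le]
    constructor <;> nlinarith [mul_nonneg (sq_nonneg b) (sq_nonneg ‖y‖)]
  · have hn : ‖x‖ ≠ 0 := norm_ne_zero_iff.2 hx
    have h1 : HasFDerivAt (fun y : E => ‖y‖) ((1 / ‖x‖) • innerSL ℝ x) x := by
      have h := ((hasStrictFDerivAt_norm_sq x).hasFDerivAt).sqrt (by positivity)
      simp only [Real.sqrt_sq (norm_nonneg _)] at h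
      convert h using 1
      ext y
      simp
      field_simp
    convert (h1.const_mul b).cos using 1
    ext y
    rcases eq_or_ne b 0 with rfl | hb
    · simp
    · simp [Real.sinc_of_ne_zero (mul_ne_zero hb hn)]
      field_simp

/-- The expression s sinc (ω s) replaces sin (ω s) / ω so that the frequency ω = 0 needs no
exception later. -/
theorem hasDerivAt_mul_sinc (ω s : ℝ) :
    HasDerivAt (fun s => s * Real.sinc (ω * s)) (Real.cos (ω * s)) s := by
  rcases eq_or_ne ω 0 with rfl | hω
  · simpa using hasDerivAt_id' s
  · have h : (fun s => s * Real.sinc (ω * s)) = fun s => Real.sin (ω * s) / ω := by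
      funext s
      rcases eq_or_ne s 0 with rfl | hs
      · simp
      · rw [Real.sinc_of_ne_zero (mul_ne_zero hω hs)]; field_simp
    rw [h]
    refine (((hasDerivAt_id' s).const_mul ω).sin.div_const ω).congr_deriv ?_
    field_simp

/-- The function `∫₀¹ (1 - u²)ᵏ cos (a u |x|) du`; for `k = 0` it is `sinc (a |x|)`. -/
def cosMoment (a : ℝ) (k : ℕ) (x : E) : ℝ :=
  ∫ u in (0 : ℝ)..1, (1 - u ^ 2) ^ k * Real.cos (a * u * ‖x‖)

set_option linter.unusedSectionVars false in
theorem abs_cosMoment_le (a : ℝ) (k : ℕ) (x : E) : |cosMoment a k x| ≤ 1 := by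
  have := intervalIntegral.norm_integral_le_of_norm_le_const (a := 0) (b := 1) (C := 1)
    (f := fun u : ℝ => (1 - u ^ 2) ^ k * Real.cos (a * u * ‖x‖)) (fun u hu => by
      rw [Set.uIoc_of_le zero_le_one] at hu
      rw [norm_mul, norm_pow, Real.norm_eq_abs, Real.norm_eq_abs]
      have h : |1 - u ^ 2| ≤ 1 := by rw [abs_le]; constructor <;> nlinarith [hu.1, hu.2]
      exact mul_le_one₀ (pow_le_one₀ (abs_nonneg _) h) (abs_nonneg _) (Real.abs_cos_le_one _))
  simpa [cosMoment] using this

/-- Integration by parts with the primitive u sinc (aρu) of cos (aρu). The boundary terms vanish, at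
1 because of (1 - u²)^(k+1) and at 0 because of u. This makes the gradient of each moment a multiple
of x times the next moment. -/
theorem integral_mul_sinc_eq (a ρ : ℝ) (k : ℕ) :
    ∫ u in (0 : ℝ)..1, (1 - u ^ 2) ^ k * ((a * u) ^ 2 * Real.sinc (a * u * ρ)) =
      a ^ 2 / (2 * (k + 1)) * ∫ u in (0 : ℝ)..1, (1 - u ^ 2) ^ (k + 1) * Real.cos (a * u * ρ) := by
  have hU : ∀ u ∈ Set.uIcc (0 : ℝ) 1, HasDerivAt (fun u : ℝ => (1 - u ^ 2) ^ (k + 1))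
      (-(2 * (k + 1)) * ((1 - u ^ 2) ^ k * u)) u := fun u _ => by
    refine (((hasDerivAt_const u (1 : ℝ)).sub (hasDerivAt_pow 2 u)).pow (k + 1)).congr_deriv ?_
    simp; ring
  have hV : ∀ u ∈ Set.uIcc (0 : ℝ) 1, HasDerivAt (fun u : ℝ => a ^ 2 * (u * Real.sinc (a * ρ * u)))
      (a ^ 2 * Real.cos (a * ρ * u)) u := fun u _ => (hasDerivAt_mul_sinc (a * ρ) u).const_mul _
  have h := intervalIntegral.integral_mul_deriv_eq_deriv_mul hU hV
    (Continuous.intervalIntegrable (by fun_prop) _ _)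
    (Continuous.intervalIntegrable (by fun_prop) _ _)
  have hL : ∫ u in (0 : ℝ)..1, (1 - u ^ 2) ^ (k + 1) * (a ^ 2 * Real.cos (a * ρ * u)) =
      a ^ 2 * ∫ u in (0 : ℝ)..1, (1 - u ^ 2) ^ (k + 1) * Real.cos (a * u * ρ) := by
    rw [← intervalIntegral.integral_const_mul]
    congr 1; funext u; rw [show a * ρ * u = a * u * ρ by ring]; ring
  have hR : ∫ u in (0 : ℝ)..1, -(2 * ((k : ℝ) + 1)) * ((1 - u ^ 2) ^ k * u) *
      (a ^ 2 * (u * Real.sinc (a * ρ * u))) = -(2 * ((k : ℝ) + 1)) *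
      ∫ u in (0 : ℝ)..1, (1 - u ^ 2) ^ k * ((a * u) ^ 2 * Real.sinc (a * u * ρ)) := by
    rw [← intervalIntegral.integral_const_mul]
    congr 1; funext u; rw [show a * ρ * u = a * u * ρ by ring]; ring
  rw [hL, hR] at h
  have hk : (2 * ((k : ℝ) + 1)) ≠ 0 := by positivity
  simp at h
  rw [div_mul_eq_mul_div, h, mul_div_cancel_left₀ _ hk]

theorem hasFDerivAt_cosMoment (a : ℝ) (k : ℕ) (x : E) :
    HasFDerivAt (cosMoment a k)
      ((-(a ^ 2 / (2 * (k + 1))) * cosMoment a (k + 1) x) • innerSL ℝ x) x := by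
  have hc : Continuous fun p : ℝ × E => Real.sinc (a * p.1 * ‖p.2‖) :=
    Real.continuous_sinc.comp (by fun_prop)
  have hd : HasFDerivAt (cosMoment a k) (∫ u in (0 : ℝ)..1, ((1 - u ^ 2) ^ k) •
      ((-((a * u) ^ 2 * Real.sinc (a * u * ‖x‖))) • innerSL ℝ x)) x := by
    refine intervalIntegral.hasFDerivAt_integral_of_dominated_of_fderiv_le
      (F := fun (x : E) (u : ℝ) => (1 - u ^ 2) ^ k * Real.cos (a * u * ‖x‖))
      (F' := fun x u => ((1 - u ^ 2) ^ k) •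
        ((-((a * u) ^ 2 * Real.sinc (a * u * ‖x‖))) • innerSL ℝ x))
      (s := Metric.ball x 1) (bound := fun _ => a ^ 2 * (‖x‖ + 1))
      (Metric.ball_mem_nhds x one_pos) ?_ ?_ ?_ ?_ ?_ ?_
    · exact Eventually.of_forall fun y => Continuous.aestronglyMeasurable (by fun_prop)
    · exact Continuous.intervalIntegrable (by fun_prop) _ _
    · have h2 : Continuous fun u : ℝ => Real.sinc (a * u * ‖x‖) :=
        hc.comp (Continuous.prodMk_left x)
      exact Continuous.aestronglyMeasurable (by fun_prop)
    · refine Eventually.of_forall fun u hu y hy => ?_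
      rw [Set.uIoc_of_le zero_le_one] at hu
      rw [norm_smul, norm_smul, innerSL_apply_norm, norm_pow, norm_neg, norm_mul, norm_pow,
        Real.norm_eq_abs, Real.norm_eq_abs, Real.norm_eq_abs, sq_abs]
      have h1 : |1 - u ^ 2| ^ k ≤ 1 := pow_le_one₀ (abs_nonneg _)
        (by rw [abs_le]; constructor <;> nlinarith [hu.1, hu.2])
      have h2 : (a * u) ^ 2 * |Real.sinc (a * u * ‖y‖)| ≤ a ^ 2 := by
        have h3 : (a * u) ^ 2 ≤ a ^ 2 := by
          rw [mul_pow]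
          exact mul_le_of_le_one_right (sq_nonneg _) (pow_le_one₀ hu.1.le hu.2)
        exact (mul_le_of_le_one_right (sq_nonneg _) (Real.abs_sinc_le_one _)).trans h3
      have h4 : ‖y‖ ≤ ‖x‖ + 1 := by
        have := norm_le_norm_add_norm_sub' y x
        have h5 : ‖y - x‖ < 1 := by simpa [dist_eq_norm] using hy
        linarith
      calc _ ≤ 1 * (a ^ 2 * (‖x‖ + 1)) := by gcongr
        _ = _ := one_mul _
    · exact intervalIntegrable_const
    · refine Eventually.of_forall fun u _ y _ => ?_
      exact (hasFDerivAt_cos_mul_norm (a * u) y).const_mul _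
  convert hd using 1
  simp_rw [smul_smul]
  rw [intervalIntegral.integral_smul_const]
  congr 1
  rw [cosMoment, neg_mul, ← integral_mul_sinc_eq, ← intervalIntegral.integral_neg]
  congr 1; funext u; ring

set_option linter.unusedSectionVars false in
theorem cosMoment_zero (a : ℝ) (x : E) : cosMoment a 0 x = Real.sinc (a * ‖x‖) := by
  have h := intervalIntegral.integral_eq_sub_of_hasDerivAt (a := 0) (b := 1)
    (fun u _ => hasDerivAt_mul_sinc (a * ‖x‖) u)
    (Continuous.intervalIntegrable (by fun_prop) _ _)
  simp only [mul_one, one_mul, zero_mul, sub_zero] at h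
  rw [← h, cosMoment]
  congr 1; funext u; rw [pow_zero, one_mul]; congr 1; ring

theorem hasTemperateGrowth_sinc_norm (a : ℝ) :
    (fun x : E => Real.sinc (a * ‖x‖)).HasTemperateGrowth := by
  have := hasTemperateGrowth_of_fderiv_eq (f := cosMoment (E := E) a)
    (abs_cosMoment_le a) (hasFDerivAt_cosMoment a) 0
  simpa [funext (cosMoment_zero (E := E) a)] using this

theorem hasTemperateGrowth_cos_norm (a : ℝ) :
    (fun x : E => Real.cos (a * ‖x‖)).HasTemperateGrowth := by
  have hs := hasTemperateGrowth_sinc_norm (E := E) a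
  refine .of_fderiv (k := 0) (C := 1) ?_
    (fun x => (hasFDerivAt_cos_mul_norm a x).differentiableAt)
    fun x => by simpa using Real.abs_cos_le_one _
  have : fderiv ℝ (fun x : E => Real.cos (a * ‖x‖)) =
      fun x => (-(a ^ 2 * Real.sinc (a * ‖x‖))) • innerSL ℝ x :=
    funext fun x => (hasFDerivAt_cos_mul_norm a x).fderiv
  rw [this]
  have hI := (innerSL ℝ : E →L[ℝ] E →L[ℝ] ℝ).hasTemperateGrowth
  have h2 : (fun x : E => -(a ^ 2 * Real.sinc (a * ‖x‖))).HasTemperateGrowth := by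
    exact ((Function.HasTemperateGrowth.const (a ^ 2)).mul hs).neg
  exact h2.smul hI

theorem hasTemperateGrowth_cosSymbol (t : ℝ) : (cosSymbol t).HasTemperateGrowth :=
  Function.HasTemperateGrowth.comp Function.Complex.hasTemperateGrowth_ofReal (hasTemperateGrowth_cos_norm (2 * Real.pi * t))

theorem hasTemperateGrowth_sinSymbol (t : ℝ) : (sinSymbol t).HasTemperateGrowth :=
  Function.HasTemperateGrowth.comp Function.Complex.hasTemperateGrowth_ofReal
    ((Function.HasTemperateGrowth.const t).mul (hasTemperateGrowth_sinc_norm (2 * Real.pi * t)))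

end Symbols

/-! ### Free waves: the wave equation integrated twice in time. -/

/-- Taylor's formula with integral remainder for cos (ωt). With ω² as a factor instead of a divisor
it also covers the zero frequency. The next lemma is its companion for sin (ωt) / ω. -/
theorem sq_mul_integral_cos (ω t : ℝ) :
    ω ^ 2 * ∫ s in (0 : ℝ)..t, (t - s) * Real.cos (ω * s) = 1 - Real.cos (ω * t) := by
  have h : ∀ s ∈ Set.uIcc 0 t, HasDerivAt
      (fun s => ω * ((t - s) * Real.sin (ω * s)) - Real.cos (ω * s))
      (ω ^ 2 * ((t - s) * Real.cos (ω * s))) s := fun s _ => by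
    have h1 := ((hasDerivAt_id' s).const_mul ω)
    refine ((((hasDerivAt_id' s).const_sub t).mul h1.sin).const_mul ω |>.sub h1.cos).congr_deriv ?_
    ring
  have := intervalIntegral.integral_eq_sub_of_hasDerivAt h
    (Continuous.intervalIntegrable (by fun_prop) _ _)
  rw [intervalIntegral.integral_const_mul] at this
  rw [this]; simp; ring

theorem sq_mul_integral_sinc (ω t : ℝ) :
    ω ^ 2 * ∫ s in (0 : ℝ)..t, (t - s) * (s * Real.sinc (ω * s)) = t - t * Real.sinc (ω * t) := by
  have hsin : ∀ s, ω * (s * Real.sinc (ω * s)) = Real.sin (ω * s) := fun s => by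
    rcases eq_or_ne (ω * s) 0 with h | h
    · rw [← mul_assoc, h]; simp
    · rw [Real.sinc_of_ne_zero h]
      have := left_ne_zero_of_mul h; have := right_ne_zero_of_mul h
      field_simp
  have h : ∀ s ∈ Set.uIcc 0 t, HasDerivAt
      (fun s => -((t - s) * Real.cos (ω * s)) - s * Real.sinc (ω * s))
      (ω ^ 2 * ((t - s) * (s * Real.sinc (ω * s)))) s := fun s _ => by
    have h1 := ((hasDerivAt_id' s).const_mul ω)
    refine ((((hasDerivAt_id' s).const_sub t).mul h1.cos).neg.sub
      (hasDerivAt_mul_sinc ω s)).congr_deriv ?_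
    rw [← hsin s]; ring
  have := intervalIntegral.integral_eq_sub_of_hasDerivAt h
    (Continuous.intervalIntegrable (by fun_prop) _ _)
  rw [intervalIntegral.integral_const_mul] at this
  rw [this]; simp; ring

theorem continuous_sinSymbol : Continuous fun q : ℝ × E3 => sinSymbol q.1 q.2 := by
  unfold sinSymbol
  exact Complex.continuous_ofReal.comp
    (continuous_fst.mul (Real.continuous_sinc.comp (by fun_prop)))

theorem continuous_cosSymbol : Continuous fun q : ℝ × E3 => cosSymbol q.1 q.2 := by
  unfold cosSymbol
  fun_prop

theorem norm_sinSymbol_le (t : ℝ) (ξ : E3) : ‖sinSymbol t ξ‖ ≤ |t| := by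
  rw [sinSymbol, Complex.norm_real, Real.norm_eq_abs, abs_mul]
  exact mul_le_of_le_one_right (abs_nonneg _) (Real.abs_sinc_le_one _)

theorem norm_cosSymbol_le (t : ℝ) (ξ : E3) : ‖cosSymbol t ξ‖ ≤ 1 := by
  rw [cosSymbol, Complex.norm_real, Real.norm_eq_abs]
  exact Real.abs_cos_le_one _

theorem sinSymbol_eq_integral (t : ℝ) (ξ : E3) :
    sinSymbol t ξ - t = ∫ s in (0 : ℝ)..t, ((t - s : ℝ) : ℂ) *
      (sinSymbol s ξ * ((-(2 * Real.pi * ‖ξ‖) ^ 2 : ℝ) : ℂ)) := by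
  have h := sq_mul_integral_sinc (2 * Real.pi * ‖ξ‖) t
  have h2 : ∀ s : ℝ, ((t - s : ℝ) : ℂ) * (sinSymbol s ξ * ((-(2 * Real.pi * ‖ξ‖) ^ 2 : ℝ) : ℂ)) =
      ((-((2 * Real.pi * ‖ξ‖) ^ 2 * ((t - s) * (s * Real.sinc (2 * Real.pi * ‖ξ‖ * s)))) : ℝ) : ℂ) :=
    fun s => by
      rw [sinSymbol, show 2 * Real.pi * s * ‖ξ‖ = 2 * Real.pi * ‖ξ‖ * s by ring]
      push_cast; ring
  simp_rw [h2]
  rw [intervalIntegral.integral_ofReal, intervalIntegral.integral_neg,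
    intervalIntegral.integral_const_mul, h, sinSymbol,
    show 2 * Real.pi * t * ‖ξ‖ = 2 * Real.pi * ‖ξ‖ * t by ring]
  push_cast; ring

theorem cosSymbol_eq_integral (t : ℝ) (ξ : E3) :
    cosSymbol t ξ - 1 = ∫ s in (0 : ℝ)..t, ((t - s : ℝ) : ℂ) *
      (cosSymbol s ξ * ((-(2 * Real.pi * ‖ξ‖) ^ 2 : ℝ) : ℂ)) := by
  have h := sq_mul_integral_cos (2 * Real.pi * ‖ξ‖) t
  have h2 : ∀ s : ℝ, ((t - s : ℝ) : ℂ) * (cosSymbol s ξ * ((-(2 * Real.pi * ‖ξ‖) ^ 2 : ℝ) : ℂ)) =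
      ((-((2 * Real.pi * ‖ξ‖) ^ 2 * ((t - s) * Real.cos (2 * Real.pi * ‖ξ‖ * s))) : ℝ) : ℂ) :=
    fun s => by
      rw [cosSymbol, show 2 * Real.pi * s * ‖ξ‖ = 2 * Real.pi * ‖ξ‖ * s by ring]
      push_cast; ring
  simp_rw [h2]
  rw [intervalIntegral.integral_ofReal, intervalIntegral.integral_neg,
    intervalIntegral.integral_const_mul, h, cosSymbol,
    show 2 * Real.pi * t * ‖ξ‖ = 2 * Real.pi * ‖ξ‖ * t by ring]
  push_cast; ring

theorem integrable_symbol_mul_prod {m : ℝ → E3 → ℂ} (hm : Continuous fun q : ℝ × E3 => m q.1 q.2)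
    {t B : ℝ} (hB : ∀ s ∈ Set.uIcc 0 t, ∀ ξ, ‖m s ξ‖ ≤ B) {f : E3 → ℂ} (hf : Integrable f) :
    Integrable (Function.uncurry fun s ξ => ((t - s : ℝ) : ℂ) * (m s ξ * f ξ))
      ((volume.restrict (Set.uIoc 0 t)).prod volume) := by
  have : IsFiniteMeasure (volume.restrict (Set.uIoc 0 t)) := ⟨by simp [Set.uIoc]⟩
  have h1 : Integrable (fun z : ℝ × E3 => (1 : ℂ) * f z.2)
      ((volume.restrict (Set.uIoc 0 t)).prod volume) :=
    Integrable.mul_prod (μ := volume.restrict (Set.uIoc 0 t)) (f := fun _ => (1 : ℂ))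
      (integrable_const _) hf
  have h2 := h1.bdd_mul (c := |t| * B) (f := fun z : ℝ × E3 => ((t - z.1 : ℝ) : ℂ) * m z.1 z.2)
    (Continuous.aestronglyMeasurable (by fun_prop)) ?_
  · refine h2.congr (Eventually.of_forall fun z => ?_)
    simp only [Function.uncurry]; ring
  · have hae : ∀ᵐ z ∂((volume.restrict (Set.uIoc 0 t)).prod (volume : Measure E3)),
        z.1 ∈ Set.uIoc 0 t :=
      Measure.quasiMeasurePreserving_fst.ae (ae_restrict_mem measurableSet_uIoc)
    filter_upwards [hae] with z hz
    have hz' := Set.uIoc_subset_uIcc hz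
    rw [norm_mul, Complex.norm_real, Real.norm_eq_abs]
    refine mul_le_mul ?_ (hB _ hz' _) (norm_nonneg _) (abs_nonneg _)
    simpa using Set.abs_sub_right_of_mem_uIcc hz'

theorem intervalIntegrable_symbol_mul {m : ℝ → E3 → ℂ}
    (hm : Continuous fun q : ℝ × E3 => m q.1 q.2)
    {t B : ℝ} (hB : ∀ s ∈ Set.uIcc 0 t, ∀ ξ, ‖m s ξ‖ ≤ B) {f : E3 → ℂ} (hf : Integrable f) :
    IntervalIntegrable (fun s => ((t - s : ℝ) : ℂ) * ∫ ξ, m s ξ * f ξ) volume 0 t := by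
  rw [intervalIntegrable_iff, IntegrableOn]
  simpa [Function.uncurry, integral_const_mul] using
    (integrable_symbol_mul_prod hm hB hf).integral_prod_left

/-- Integration of a symbol identity `m t ξ - m₀ = ∫₀ᵗ (t - s) (-(2π|ξ|)²) m s ξ ds` against an
integrable function. -/
theorem integral_symbol_mul {m : ℝ → E3 → ℂ} (hm : Continuous fun q : ℝ × E3 => m q.1 q.2)
    {t B : ℝ} {m₀ : ℂ} (hB : ∀ s ∈ Set.uIcc 0 t, ∀ ξ, ‖m s ξ‖ ≤ B)
    (hmt : ∀ ξ, m t ξ - m₀ = ∫ s in (0 : ℝ)..t, ((t - s : ℝ) : ℂ) *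
      (m s ξ * ((-(2 * Real.pi * ‖ξ‖) ^ 2 : ℝ) : ℂ)))
    {f : E3 → ℂ} (hf : Integrable f)
    (hf₁ : Integrable fun ξ => ((-(2 * Real.pi * ‖ξ‖) ^ 2 : ℝ) : ℂ) * f ξ) :
    ∫ ξ, m t ξ * f ξ = (m₀ * ∫ ξ, f ξ) + ∫ s in (0 : ℝ)..t, ((t - s : ℝ) : ℂ) *
      ∫ ξ, m s ξ * (((-(2 * Real.pi * ‖ξ‖) ^ 2 : ℝ) : ℂ) * f ξ) := by
  have hmt' : Continuous (m t) := hm.comp (Continuous.prodMk_right t)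
  have hint : Integrable (fun ξ => m t ξ * f ξ) :=
    hf.bdd_mul hmt'.aestronglyMeasurable (Eventually.of_forall fun ξ => hB t Set.right_mem_uIcc ξ)
  rw [← sub_eq_iff_eq_add', ← integral_const_mul, ← integral_sub hint (hf.const_mul _)]
  simp_rw [← integral_const_mul]
  rw [intervalIntegral_integral_swap (integrable_symbol_mul_prod hm hB hf₁)]
  refine integral_congr_ae (Eventually.of_forall fun ξ => ?_)
  simp only
  rw [← sub_mul, hmt, ← intervalIntegral.integral_mul_const]
  congr 1; funext s; ring

theorem fourier_laplacian_apply (φ : 𝓢(E3, ℂ)) (ξ : E3) :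
    𝓕 (Laplacian.laplacian φ) ξ = ((-(2 * Real.pi * ‖ξ‖) ^ 2 : ℝ) : ℂ) * 𝓕 φ ξ := by
  rw [SchwartzMap.laplacian_eq_fourierMultiplierCLM, SchwartzMap.fourierMultiplierCLM_apply,
    FourierTransform.fourier_smul, FourierTransform.fourier_fourierInv_eq, smul_apply]
  rw [SchwartzMap.smulLeftCLM_apply_apply (by simpa using Function.hasTemperateGrowth_norm_sq (H := E3))]
  simp
  ring

theorem fourierInv_laplacian_apply (φ : 𝓢(E3, ℂ)) (ξ : E3) :
    𝓕⁻ (Laplacian.laplacian φ) ξ = ((-(2 * Real.pi * ‖ξ‖) ^ 2 : ℝ) : ℂ) * 𝓕⁻ φ ξ := by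
  have h := fourier_laplacian_apply φ (-ξ)
  rw [norm_neg] at h
  exact h

theorem fourierMultiplier_apply_eq_integral {T : 𝓢'(E3, ℂ)} {g : E3 → ℂ}
    (hT : IsFunction (𝓕 T) g) {m : E3 → ℂ} (hm : m.HasTemperateGrowth) (φ : 𝓢(E3, ℂ)) :
    TemperedDistribution.fourierMultiplierCLM ℂ m T φ = ∫ ξ, m ξ * (𝓕⁻ φ ξ * g ξ) := by
  rw [TemperedDistribution.fourierMultiplierCLM_apply_apply, ← TemperedDistribution.fourier_apply,
    (hT _).2]
  simp_rw [SchwartzMap.smulLeftCLM_apply_apply hm, smul_eq_mul, mul_assoc]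

theorem linearWave_apply {T₀ T₁ : 𝓢'(E3, ℂ)} {g₀ g₁ : E3 → ℂ}
    (h₀ : IsFunction (𝓕 T₀) g₀) (h₁ : IsFunction (𝓕 T₁) g₁) (t : ℝ) (φ : 𝓢(E3, ℂ)) :
    linearWave t T₀ T₁ φ =
      (∫ ξ, cosSymbol t ξ * (𝓕⁻ φ ξ * g₀ ξ)) + ∫ ξ, sinSymbol t ξ * (𝓕⁻ φ ξ * g₁ ξ) := by
  rw [linearWave, ← fourierMultiplier_apply_eq_integral h₀ (hasTemperateGrowth_cosSymbol t),
    ← fourierMultiplier_apply_eq_integral h₁ (hasTemperateGrowth_sinSymbol t)]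
  rfl

theorem norm_sinSymbol_le_of_mem_uIcc {s t : ℝ} (hs : s ∈ Set.uIcc 0 t) (ξ : E3) :
    ‖sinSymbol s ξ‖ ≤ |t| :=
  (norm_sinSymbol_le s ξ).trans (by simpa using Set.abs_sub_left_of_mem_uIcc hs)

theorem intervalIntegrable_linearWave {T₀ T₁ : 𝓢'(E3, ℂ)} {g₀ g₁ : E3 → ℂ}
    (h₀ : IsFunction (𝓕 T₀) g₀) (h₁ : IsFunction (𝓕 T₁) g₁) (t : ℝ) (φ : 𝓢(E3, ℂ)) :
    IntervalIntegrable (fun s => ((t - s : ℝ) : ℂ) * linearWave s T₀ T₁ φ) volume 0 t := by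
  simp_rw [linearWave_apply h₀ h₁, mul_add]
  exact (intervalIntegrable_symbol_mul continuous_cosSymbol
      (fun s _ ξ => norm_cosSymbol_le s ξ) (h₀ _).1).add
    (intervalIntegrable_symbol_mul continuous_sinSymbol
      (fun s hs ξ => norm_sinSymbol_le_of_mem_uIcc hs ξ) (h₁ _).1)

/-- The free wave satisfies `∂ₜ² u = Δ u` in integrated form. -/
theorem linearWave_eq_integral {T₀ T₁ : 𝓢'(E3, ℂ)} {g₀ g₁ : E3 → ℂ}
    (h₀ : IsFunction (𝓕 T₀) g₀) (h₁ : IsFunction (𝓕 T₁) g₁) (t : ℝ) (φ : 𝓢(E3, ℂ)) :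
    linearWave t T₀ T₁ φ = T₀ φ + t * T₁ φ +
      ∫ s in (0 : ℝ)..t, ((t - s : ℝ) : ℂ) * linearWave s T₀ T₁ (Laplacian.laplacian φ) := by
  have hT : ∀ {T : 𝓢'(E3, ℂ)} {g : E3 → ℂ}, IsFunction (𝓕 T) g → T φ = ∫ ξ, 𝓕⁻ φ ξ * g ξ := by
    intro T g h
    rw [← (h _).2, TemperedDistribution.fourier_apply, FourierTransform.fourier_fourierInv_eq]
  have hL : ∀ {g : E3 → ℂ} ξ, 𝓕⁻ (Laplacian.laplacian φ) ξ * g ξ =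
      ((-(2 * Real.pi * ‖ξ‖) ^ 2 : ℝ) : ℂ) * (𝓕⁻ φ ξ * g ξ) := fun ξ => by
    rw [fourierInv_laplacian_apply, mul_assoc]
  have i₀ := (h₀ (𝓕⁻ (Laplacian.laplacian φ))).1
  have i₁ := (h₁ (𝓕⁻ (Laplacian.laplacian φ))).1
  simp_rw [hL] at i₀ i₁
  have hc : ∀ s ∈ Set.uIcc 0 t, ∀ ξ, ‖cosSymbol s ξ‖ ≤ 1 := fun s _ ξ => norm_cosSymbol_le s ξ
  have hs : ∀ s ∈ Set.uIcc 0 t, ∀ ξ, ‖sinSymbol s ξ‖ ≤ |t| :=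
    fun s hs ξ => norm_sinSymbol_le_of_mem_uIcc hs ξ
  simp_rw [linearWave_apply h₀ h₁, mul_add, hL]
  rw [intervalIntegral.integral_add (intervalIntegrable_symbol_mul continuous_cosSymbol hc i₀)
    (intervalIntegrable_symbol_mul continuous_sinSymbol hs i₁),
    integral_symbol_mul continuous_cosSymbol hc (cosSymbol_eq_integral t) (h₀ _).1 i₀,
    integral_symbol_mul continuous_sinSymbol hs (sinSymbol_eq_integral t) (h₁ _).1 i₁,
    hT h₀, hT h₁]
  ring

/-! ### The sine propagator on Schwartz functions. -/

/-- The operator `sin (t √(-Δ)) / √(-Δ)` on Schwartz functions. -/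
def sinPropagator (t : ℝ) (φ : 𝓢(E3, ℂ)) : 𝓢(E3, ℂ) :=
  SchwartzMap.fourierMultiplierCLM ℂ (sinSymbol t) φ

theorem fourier_sinPropagator (t : ℝ) (φ : 𝓢(E3, ℂ)) (ξ : E3) :
    𝓕 (sinPropagator t φ) ξ = sinSymbol t ξ * 𝓕 φ ξ := by
  rw [sinPropagator, SchwartzMap.fourierMultiplierCLM_apply,
    FourierTransform.fourier_fourierInv_eq,
    SchwartzMap.smulLeftCLM_apply_apply (hasTemperateGrowth_sinSymbol t), smul_eq_mul]

theorem sinPropagator_apply (t : ℝ) (φ : 𝓢(E3, ℂ)) (x : E3) :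
    sinPropagator t φ x = ∫ ξ, sinSymbol t ξ * (Real.fourierChar (inner ℝ ξ x) • 𝓕 φ ξ) := by
  have h : 𝓕⁻ (𝓕 (sinPropagator t φ) : 𝓢(E3, ℂ)) = sinPropagator t φ :=
    FourierTransform.fourierInv_fourier_eq _
  rw [← h, SchwartzMap.fourierInv_coe, Real.fourierInv_eq]
  refine integral_congr_ae (Eventually.of_forall fun ξ => ?_)
  simp only [fourier_sinPropagator]
  rw [Circle.smul_def, Circle.smul_def, smul_eq_mul, smul_eq_mul]
  ring

theorem continuous_sinPropagator (φ : 𝓢(E3, ℂ)) :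
    Continuous fun q : ℝ × E3 => sinPropagator q.1 φ q.2 := by
  simp_rw [sinPropagator_apply]
  refine continuous_iff_continuousAt.2 fun q₀ => ?_
  refine continuousAt_of_dominated (bound := fun ξ => (|q₀.1| + 1) * ‖𝓕 φ ξ‖) ?_ ?_
    ((𝓕 φ).integrable.norm.const_mul _) ?_
  · refine Eventually.of_forall fun q => Continuous.aestronglyMeasurable ?_
    exact (continuous_sinSymbol.comp (Continuous.prodMk_right q.1)).mul
      ((Real.continuous_fourierChar.comp (by fun_prop)).smul (𝓕 φ).continuous)
  · have : ∀ᶠ q : ℝ × E3 in 𝓝 q₀, |q.1| < |q₀.1| + 1 :=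
      (continuous_fst.abs.continuousAt (x := q₀)).eventually (gt_mem_nhds (lt_add_one _))
    filter_upwards [this] with q hq
    refine Eventually.of_forall fun ξ => ?_
    rw [norm_mul, Circle.norm_smul]
    gcongr
    exact (norm_sinSymbol_le _ _).trans hq.le
  · refine Eventually.of_forall fun ξ => Continuous.continuousAt ?_
    have h₁ : Continuous fun q : ℝ × E3 => sinSymbol q.1 ξ :=
      continuous_sinSymbol.comp (f := fun q : ℝ × E3 => (q.1, ξ)) (by fun_prop)
    have h₂ : Continuous fun q : ℝ × E3 => Real.fourierChar (inner ℝ ξ q.2) :=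
      Real.continuous_fourierChar.comp (f := fun q : ℝ × E3 => inner ℝ ξ q.2) (by fun_prop)
    exact h₁.mul (h₂.smul continuous_const)

theorem norm_sinPropagator_le (t : ℝ) (φ : 𝓢(E3, ℂ)) (x : E3) :
    ‖sinPropagator t φ x‖ ≤ |t| * ∫ ξ, ‖𝓕 φ ξ‖ := by
  rw [sinPropagator_apply, ← integral_const_mul]
  refine norm_integral_le_of_norm_le ((𝓕 φ).integrable.norm.const_mul _)
    (Eventually.of_forall fun ξ => ?_)
  rw [norm_mul, Circle.norm_smul]
  gcongr
  exact norm_sinSymbol_le _ _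

theorem integrable_norm_sq (φ : 𝓢(E3, ℂ)) : Integrable fun x => ‖φ x‖ ^ 2 :=
  (φ.memLp 2).integrable_norm_pow (by norm_num)

/-- Plancherel and |sin (tω)/ω| ≤ |t|. Together with the sup bound `norm_sinPropagator_le` it
controls every L^{q'} norm with q' ≥ 2, which is what the source requires. -/
theorem integral_norm_sq_sinPropagator_le (t : ℝ) (φ : 𝓢(E3, ℂ)) :
    ∫ x, ‖sinPropagator t φ x‖ ^ 2 ≤ t ^ 2 * ∫ x, ‖φ x‖ ^ 2 := by
  rw [← SchwartzMap.integral_norm_sq_fourier, ← SchwartzMap.integral_norm_sq_fourier φ,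
    ← integral_const_mul]
  refine integral_mono (integrable_norm_sq _) ((integrable_norm_sq _).const_mul _) fun ξ => ?_
  simp only [fourier_sinPropagator, norm_mul, mul_pow]
  gcongr ?_ * _
  rw [← sq_abs t]
  exact pow_le_pow_left₀ (norm_nonneg _) (norm_sinSymbol_le _ _) 2

/-- Fourier inversion applied to the Taylor identity of the symbol. It says pointwise that the
propagated function solves the wave equation with data (0, φ). -/
theorem sinPropagator_eq_integral (t : ℝ) (φ : 𝓢(E3, ℂ)) (x : E3) :
    sinPropagator t φ x - t * φ x = ∫ s in (0 : ℝ)..t, ((t - s : ℝ) : ℂ) *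
      sinPropagator s (Laplacian.laplacian φ) x := by
  have hL : ∀ ξ, Real.fourierChar (inner ℝ ξ x) • 𝓕 (Laplacian.laplacian φ) ξ =
      ((-(2 * Real.pi * ‖ξ‖) ^ 2 : ℝ) : ℂ) * (Real.fourierChar (inner ℝ ξ x) • 𝓕 φ ξ) := by
    intro ξ
    rw [fourier_laplacian_apply, Circle.smul_def, Circle.smul_def, smul_eq_mul, smul_eq_mul]
    ring
  have hi : ∀ ψ : 𝓢(E3, ℂ), Integrable fun ξ => Real.fourierChar (inner ℝ ξ x) • ψ ξ := fun ψ => by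
    refine ψ.integrable.norm.mono' (Continuous.aestronglyMeasurable ?_)
      (Eventually.of_forall fun ξ => (Circle.norm_smul _ _).le)
    exact (Real.continuous_fourierChar.comp (by fun_prop)).smul ψ.continuous
  have i₁ := hi (𝓕 (Laplacian.laplacian φ))
  simp_rw [hL] at i₁
  simp_rw [sinPropagator_apply, hL]
  rw [integral_symbol_mul continuous_sinSymbol (fun s hs ξ => norm_sinSymbol_le_of_mem_uIcc hs ξ)
    (sinSymbol_eq_integral t) (hi (𝓕 φ)) i₁]
  have : ∫ ξ, Real.fourierChar (inner ℝ ξ x) • 𝓕 φ ξ = φ x := by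
    have h : 𝓕⁻ (𝓕 φ : 𝓢(E3, ℂ)) = φ := FourierTransform.fourierInv_fourier_eq _
    conv_rhs => rw [← h, SchwartzMap.fourierInv_coe, Real.fourierInv_eq]
  rw [this]; ring

/-! ### Fubini on a triangle, and Duhamel integrals of a source in L¹ in time with values in L^q. -/

theorem integral_triangle_swap_of_le {A : ℝ → ℝ → ℂ} {a b : ℝ} (hab : a ≤ b)
    (hA : Integrable (Function.uncurry A)
      ((volume.restrict (Set.Ioc a b)).prod (volume.restrict (Set.Ioc a b)))) :
    ∫ s in a..b, ∫ τ in a..s, A τ s = ∫ τ in a..b, ∫ s in τ..b, A τ s := by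
  have hmeas : MeasurableSet {z : ℝ × ℝ | z.1 ≤ z.2} := measurableSet_le measurable_fst measurable_snd
  have hB := hA.indicator hmeas
  have hswap := integral_integral_swap (f := fun τ s => {z : ℝ × ℝ | z.1 ≤ z.2}.indicator
    (Function.uncurry A) (τ, s)) hB
  rw [intervalIntegral.integral_of_le hab, intervalIntegral.integral_of_le hab]
  have h1 : ∀ s ∈ Set.Ioc a b, ∫ τ in a..s, A τ s = ∫ τ in Set.Ioc a b,
      {z : ℝ × ℝ | z.1 ≤ z.2}.indicator (Function.uncurry A) (τ, s) := by
    intro s hs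
    rw [intervalIntegral.integral_of_le hs.1.le]
    have : ∀ τ, {z : ℝ × ℝ | z.1 ≤ z.2}.indicator (Function.uncurry A) (τ, s) =
        (Set.Iic s).indicator (fun τ => A τ s) τ := fun τ => by
      simp [Set.indicator, Function.uncurry]
    simp_rw [this]
    rw [setIntegral_indicator measurableSet_Iic]
    congr 2
    ext τ; simp only [Set.mem_Ioc, Set.mem_inter_iff, Set.mem_Iic]
    exact ⟨fun h => ⟨⟨h.1, h.2.trans hs.2⟩, h.2⟩, fun h => ⟨h.1.1, h.2⟩⟩
  have h2 : ∀ τ ∈ Set.Ioc a b, ∫ s in τ..b, A τ s = ∫ s in Set.Ioc a b,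
      {z : ℝ × ℝ | z.1 ≤ z.2}.indicator (Function.uncurry A) (τ, s) := by
    intro τ hτ
    rw [intervalIntegral.integral_of_le hτ.2, ← integral_Icc_eq_integral_Ioc]
    have : ∀ s, {z : ℝ × ℝ | z.1 ≤ z.2}.indicator (Function.uncurry A) (τ, s) =
        (Set.Ici τ).indicator (fun s => A τ s) s := fun s => by
      simp [Set.indicator, Function.uncurry]
    simp_rw [this]
    rw [setIntegral_indicator measurableSet_Ici]
    congr 2
    ext s; simp only [Set.mem_Ioc, Set.mem_inter_iff, Set.mem_Ici, Set.mem_Icc]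
    exact ⟨fun h => ⟨⟨hτ.1.trans_le h.1, h.2⟩, h.1⟩, fun h => ⟨h.2, h.1.2⟩⟩
  rw [setIntegral_congr_fun measurableSet_Ioc h1, setIntegral_congr_fun measurableSet_Ioc h2]
  exact hswap.symm

theorem integral_triangle_swap {A : ℝ → ℝ → ℂ} {a b : ℝ}
    (hA : Integrable (Function.uncurry A)
      ((volume.restrict (Set.uIoc a b)).prod (volume.restrict (Set.uIoc a b)))) :
    ∫ s in a..b, ∫ τ in a..s, A τ s = ∫ τ in a..b, ∫ s in τ..b, A τ s := by
  rcases le_total a b with hab | hab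
  · rw [Set.uIoc_of_le hab] at hA
    exact integral_triangle_swap_of_le hab hA
  · rw [Set.uIoc_of_ge hab] at hA
    have h := integral_triangle_swap_of_le (A := fun τ s => A s τ) hab hA.swap
    rw [intervalIntegral.integral_symm b a, intervalIntegral.integral_symm b a]
    simp_rw [intervalIntegral.integral_symm _ a, intervalIntegral.integral_symm b _,
      intervalIntegral.integral_neg]
    rw [h]

/-- Hölder's inequality together with |k|^{q'} ≤ M^{q'-2} |k|², so that a sup bound and an L² bound
are enough for the kernel. -/
theorem lintegral_mul_le_of_bounded {q q' : ℝ} (hq : q.HolderConjugate q') (hq' : 2 ≤ q')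
    {k : E3 → ℂ} {M A : ℝ} (hk : AEStronglyMeasurable k) (hM : ∀ x, ‖k x‖ ≤ M)
    (hint : Integrable fun x => ‖k x‖ ^ 2) (hA : ∫ x, ‖k x‖ ^ 2 ≤ A)
    {g : E3 → ℂ} (hg : AEStronglyMeasurable g) :
    ∫⁻ x, ‖k x * g x‖ₑ ≤ (ENNReal.ofReal M ^ (q' - 2) * ENNReal.ofReal A) ^ (1 / q') *
      (∫⁻ x, ‖g x‖ₑ ^ q) ^ (1 / q) := by
  have h := ENNReal.lintegral_mul_le_Lp_mul_Lq volume hq.symm hk.enorm hg.enorm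
  simp only [Pi.mul_apply, ← enorm_mul] at h
  refine h.trans ?_
  gcongr
  calc ∫⁻ x, ‖k x‖ₑ ^ q' ≤ ∫⁻ x, ENNReal.ofReal M ^ (q' - 2) * ENNReal.ofReal (‖k x‖ ^ 2) := by
        refine lintegral_mono fun x => ?_
        have h1 : ‖k x‖ₑ ^ q' = ‖k x‖ₑ ^ (q' - 2) * ENNReal.ofReal (‖k x‖ ^ 2) := by
          rw [ENNReal.ofReal_pow (norm_nonneg _), ofReal_norm, ← ENNReal.rpow_natCast,
            ← ENNReal.rpow_add_of_nonneg _ _ (by linarith) (by norm_num)]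
          norm_num
        rw [h1]
        gcongr
        · rw [← ofReal_norm]
          exact ENNReal.ofReal_le_ofReal (hM x)
    _ = ENNReal.ofReal M ^ (q' - 2) * ENNReal.ofReal (∫ x, ‖k x‖ ^ 2) := by
        rw [lintegral_const_mul', ofReal_integral_eq_lintegral_ofReal hint
          (Eventually.of_forall fun x => sq_nonneg _)]
        exact ENNReal.rpow_ne_top_of_nonneg (by linarith) ENNReal.ofReal_ne_top
    _ ≤ _ := by gcongr

section Duhamel

variable {q q' : ℝ} {f : ℝ → E3 → ℂ} {S : Set ℝ}

theorem ae_lintegral_rpow_lt_top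
    (hf : AEStronglyMeasurable (Function.uncurry f) ((volume.restrict S).prod volume))
    (hfin : ∫⁻ τ in S, (∫⁻ x, ‖f τ x‖ₑ ^ q) ^ (1 / q) ≠ ⊤) :
    ∀ᵐ τ ∂volume.restrict S, (∫⁻ x, ‖f τ x‖ₑ ^ q) ^ (1 / q) < ⊤ ∧ AEStronglyMeasurable (f τ) := by
  have hm : AEMeasurable (fun τ => (∫⁻ x, ‖f τ x‖ₑ ^ q) ^ (1 / q)) (volume.restrict S) :=
    ((hf.enorm.pow_const q).lintegral_prod_right').pow_const _
  filter_upwards [ae_lt_top' hm hfin, hf.prodMk_left] with τ h1 h2 using ⟨h1, h2⟩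

/-- Integrability of the product of a bounded, uniformly square integrable kernel with a function
in `L¹_t L^q_x`. -/
theorem integrable_kernel_mul (hq : q.HolderConjugate q') (hq' : 2 ≤ q')
    (hS : MeasurableSet S)
    (hf : AEStronglyMeasurable (Function.uncurry f) ((volume.restrict S).prod volume))
    (hfin : ∫⁻ τ in S, (∫⁻ x, ‖f τ x‖ₑ ^ q) ^ (1 / q) ≠ ⊤)
    {k : ℝ → E3 → ℂ} (hk : Continuous (Function.uncurry k)) {M A : ℝ}
    (hM : ∀ τ ∈ S, ∀ x, ‖k τ x‖ ≤ M) (hint : ∀ τ ∈ S, Integrable fun x => ‖k τ x‖ ^ 2)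
    (hA : ∀ τ ∈ S, ∫ x, ‖k τ x‖ ^ 2 ≤ A) :
    Integrable (Function.uncurry fun τ x => k τ x * f τ x) ((volume.restrict S).prod volume) := by
  have hmeas : AEStronglyMeasurable (Function.uncurry fun τ x => k τ x * f τ x)
      ((volume.restrict S).prod volume) := hk.aestronglyMeasurable.mul hf
  refine ⟨hmeas, ?_⟩
  rw [hasFiniteIntegral_iff_enorm, lintegral_prod _ hmeas.enorm]
  set C := (ENNReal.ofReal M ^ (q' - 2) * ENNReal.ofReal A) ^ (1 / q') with hC
  have hCtop : C ≠ ⊤ := by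
    have := hq.symm.pos
    refine ENNReal.rpow_ne_top_of_nonneg (by positivity) (ENNReal.mul_ne_top ?_ ENNReal.ofReal_ne_top)
    exact ENNReal.rpow_ne_top_of_nonneg (by linarith) ENNReal.ofReal_ne_top
  calc _ ≤ ∫⁻ τ in S, C * (∫⁻ x, ‖f τ x‖ₑ ^ q) ^ (1 / q) := by
        refine lintegral_mono_ae ?_
        filter_upwards [ae_lintegral_rpow_lt_top hf hfin, ae_restrict_mem hS] with τ h1 h2
        exact lintegral_mul_le_of_bounded hq hq'
          (hk.comp (Continuous.prodMk_right τ)).aestronglyMeasurable (hM τ h2) (hint τ h2)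
          (hA τ h2) h1.2
    _ = C * ∫⁻ τ in S, (∫⁻ x, ‖f τ x‖ₑ ^ q) ^ (1 / q) := lintegral_const_mul' _ _ hCtop
    _ < ⊤ := ENNReal.mul_lt_top hCtop.lt_top hfin.lt_top

theorem abs_sub_le_of_mem_uIcc {a b x y : ℝ} (hx : x ∈ Set.uIcc a b) (hy : y ∈ Set.uIcc a b) :
    |x - y| ≤ |b - a| := Set.abs_sub_le_of_uIcc_subset_uIcc (Set.uIcc_subset_uIcc hy hx)

/-- Absolute integrability in (τ, s), needed to exchange the two time integrals. The spatial
integral is at most a constant times the L^q norm of the source at time τ, uniformly in s. -/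
theorem integrable_duhamel_kernel (hq : q.HolderConjugate q') (hq' : 2 ≤ q') {t₀ t : ℝ}
    (hf : AEStronglyMeasurable (Function.uncurry f) ((volume.restrict (Set.uIoc t₀ t)).prod volume))
    (hfin : ∫⁻ τ in Set.uIoc t₀ t, (∫⁻ x, ‖f τ x‖ₑ ^ q) ^ (1 / q) ≠ ⊤) (φ : 𝓢(E3, ℂ)) :
    Integrable (Function.uncurry fun τ s => ((t - s : ℝ) : ℂ) *
        ∫ x, sinPropagator (s - τ) φ x * f τ x)
      ((volume.restrict (Set.uIoc t₀ t)).prod (volume.restrict (Set.uIoc t₀ t))) := by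
  set ν := volume.restrict (Set.uIoc t₀ t) with hν
  have : IsFiniteMeasure ν := ⟨by simp [hν, Set.uIoc]⟩
  have hK : AEStronglyMeasurable (fun z : (ℝ × ℝ) × E3 =>
      sinPropagator (z.1.2 - z.1.1) φ z.2 * f z.1.1 z.2) ((ν.prod ν).prod volume) := by
    refine AEStronglyMeasurable.mul (Continuous.aestronglyMeasurable ?_) ?_
    · exact (continuous_sinPropagator φ).comp
        (f := fun z : (ℝ × ℝ) × E3 => (z.1.2 - z.1.1, z.2)) (by fun_prop)
    · exact hf.comp_quasiMeasurePreserving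
        (QuasiMeasurePreserving.prodMap Measure.quasiMeasurePreserving_fst
          (Measure.QuasiMeasurePreserving.id _))
  refine ⟨AEStronglyMeasurable.mul (Continuous.aestronglyMeasurable (by fun_prop))
    hK.integral_prod_right', ?_⟩
  set T := |t - t₀|
  set C := (ENNReal.ofReal (T * ∫ ξ, ‖𝓕 φ ξ‖) ^ (q' - 2) *
    ENNReal.ofReal (T ^ 2 * ∫ x, ‖φ x‖ ^ 2)) ^ (1 / q') with hC
  have hCtop : C ≠ ⊤ := by
    have := hq.symm.pos
    refine ENNReal.rpow_ne_top_of_nonneg (by positivity) (ENNReal.mul_ne_top ?_ ENNReal.ofReal_ne_top)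
    exact ENNReal.rpow_ne_top_of_nonneg (by linarith) ENNReal.ofReal_ne_top
  have hN : AEMeasurable (fun τ => (∫⁻ x, ‖f τ x‖ₑ ^ q) ^ (1 / q)) ν :=
    ((hf.enorm.pow_const q).lintegral_prod_right').pow_const _
  rw [hasFiniteIntegral_iff_enorm]
  calc _ ≤ ∫⁻ z : ℝ × ℝ, ENNReal.ofReal T * (C * (∫⁻ x, ‖f z.1 x‖ₑ ^ q) ^ (1 / q)) ∂(ν.prod ν) := by
        refine lintegral_mono_ae ?_
        filter_upwards [Measure.quasiMeasurePreserving_fst.ae (ae_lintegral_rpow_lt_top hf hfin),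
          Measure.quasiMeasurePreserving_fst.ae (ae_restrict_mem measurableSet_uIoc),
          Measure.quasiMeasurePreserving_snd.ae (ae_restrict_mem measurableSet_uIoc)] with z h1 h2 h3
        have h2' := Set.uIoc_subset_uIcc h2
        have h3' := Set.uIoc_subset_uIcc h3
        have hst : |z.2 - z.1| ≤ T := abs_sub_le_of_mem_uIcc h3' h2'
        rw [Function.uncurry, enorm_mul]
        gcongr
        · rw [← ofReal_norm, Complex.norm_real, Real.norm_eq_abs]
          exact ENNReal.ofReal_le_ofReal (abs_sub_le_of_mem_uIcc Set.right_mem_uIcc h3')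
        · refine (enorm_integral_le_lintegral_enorm _).trans ?_
          refine lintegral_mul_le_of_bounded hq hq' (SchwartzMap.continuous _).aestronglyMeasurable
            (fun x => (norm_sinPropagator_le _ _ _).trans ?_) (integrable_norm_sq _)
            ((integral_norm_sq_sinPropagator_le _ _).trans ?_) h1.2
          · exact mul_le_mul_of_nonneg_right hst (integral_nonneg fun _ => norm_nonneg _)
          · refine mul_le_mul_of_nonneg_right ?_ (integral_nonneg fun _ => sq_nonneg _)
            rw [← sq_abs (z.2 - z.1)]
            exact pow_le_pow_left₀ (abs_nonneg _) hst 2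
    _ = ∫⁻ τ, ∫⁻ _, ENNReal.ofReal T * (C * (∫⁻ x, ‖f τ x‖ₑ ^ q) ^ (1 / q)) ∂ν ∂ν := by
        refine lintegral_prod _ ?_
        exact ((hN.comp_quasiMeasurePreserving Measure.quasiMeasurePreserving_fst).const_mul _).const_mul _
    _ = (∫⁻ τ, (∫⁻ x, ‖f τ x‖ₑ ^ q) ^ (1 / q) ∂ν) * (ENNReal.ofReal T * C * ν Set.univ) := by
        rw [← lintegral_mul_const'']
        · simp_rw [lintegral_const]
          refine lintegral_congr fun τ => ?_
          ring
        · exact hN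
    _ < ⊤ := by
        refine ENNReal.mul_lt_top hfin.lt_top (ENNReal.mul_lt_top ?_ (measure_lt_top _ _))
        exact ENNReal.mul_lt_top ENNReal.ofReal_lt_top hCtop.lt_top

theorem integrable_sinPropagator_mul (hq : q.HolderConjugate q') (hq' : 2 ≤ q') {t₀ t a : ℝ}
    (hf : AEStronglyMeasurable (Function.uncurry f) ((volume.restrict (Set.uIoc t₀ t)).prod volume))
    (hfin : ∫⁻ τ in Set.uIoc t₀ t, (∫⁻ x, ‖f τ x‖ₑ ^ q) ^ (1 / q) ≠ ⊤) (φ : 𝓢(E3, ℂ))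
    {c : ℝ → ℝ} (hc : Continuous c) {T : ℝ} (hT : ∀ τ ∈ Set.uIoc t₀ t, |c τ| ≤ T)
    {b : ℝ → ℝ} (hb : Continuous b) (hba : ∀ τ ∈ Set.uIoc t₀ t, |b τ| ≤ a) :
    Integrable (Function.uncurry fun τ x => ((b τ : ℂ) * sinPropagator (c τ) φ x) * f τ x)
      ((volume.restrict (Set.uIoc t₀ t)).prod volume) := by
  rcases (Set.uIoc t₀ t).eq_empty_or_nonempty with h0 | ⟨τ₁, hτ₁⟩
  · rw [h0]; simp
  have ha : 0 ≤ a := (abs_nonneg _).trans (hba τ₁ hτ₁)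
  refine integrable_kernel_mul (M := a * (T * ∫ ξ, ‖𝓕 φ ξ‖)) (A := a ^ 2 * (T ^ 2 * ∫ x, ‖φ x‖ ^ 2))
    hq hq' measurableSet_uIoc hf hfin ?_ ?_ ?_ ?_
  · have : Continuous fun z : ℝ × E3 => sinPropagator (c z.1) φ z.2 :=
      (continuous_sinPropagator φ).comp (f := fun z : ℝ × E3 => (c z.1, z.2)) (by fun_prop)
    exact (Complex.continuous_ofReal.comp (hb.comp continuous_fst)).mul this
  · intro τ hτ x
    rw [norm_mul, Complex.norm_real, Real.norm_eq_abs]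
    refine mul_le_mul (hba τ hτ) ((norm_sinPropagator_le _ _ _).trans ?_) (norm_nonneg _) ha
    exact mul_le_mul_of_nonneg_right (hT τ hτ) (integral_nonneg fun _ => norm_nonneg _)
  · intro τ hτ
    simp_rw [norm_mul, mul_pow]
    exact (integrable_norm_sq _).const_mul _
  · intro τ hτ
    simp_rw [norm_mul, mul_pow, integral_const_mul, Complex.norm_real, Real.norm_eq_abs]
    refine mul_le_mul (pow_le_pow_left₀ (abs_nonneg _) (hba τ hτ) 2)
      ((integral_norm_sq_sinPropagator_le _ _).trans ?_) (integral_nonneg fun _ => sq_nonneg _)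
      (sq_nonneg _)
    refine mul_le_mul_of_nonneg_right ?_ (integral_nonneg fun _ => sq_nonneg _)
    rw [← sq_abs (c τ)]
    exact pow_le_pow_left₀ (abs_nonneg _) (hT τ hτ) 2

/-- The Duhamel integrals of a source in `L¹_t L^q_x` satisfy the wave equation in integrated
form. -/
theorem integral_duhamel_eq (hq : q.HolderConjugate q') (hq' : 2 ≤ q') {t₀ t : ℝ}
    (hf : AEStronglyMeasurable (Function.uncurry f) ((volume.restrict (Set.uIoc t₀ t)).prod volume))
    (hfin : ∫⁻ τ in Set.uIoc t₀ t, (∫⁻ x, ‖f τ x‖ₑ ^ q) ^ (1 / q) ≠ ⊤) (φ : 𝓢(E3, ℂ)) :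
    ∫ s in t₀..t, ((t - s : ℝ) : ℂ) *
        ∫ τ in t₀..s, ∫ x, sinPropagator (s - τ) (Laplacian.laplacian φ) x * f τ x =
      ∫ τ in t₀..t, ∫ x, (sinPropagator (t - τ) φ x - ((t - τ : ℝ) : ℂ) * φ x) * f τ x := by
  simp_rw [← intervalIntegral.integral_const_mul]
  -- With τ outside, the inner integral over s is the Taylor identity `sinPropagator_eq_integral` at
  -- the elapsed time t - τ.
  rw [integral_triangle_swap (integrable_duhamel_kernel hq hq' hf hfin _)]
  refine intervalIntegral.integral_congr_ae ?_
  rw [← ae_restrict_iff' measurableSet_uIoc]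
  filter_upwards [ae_lintegral_rpow_lt_top hf hfin] with τ hτ
  simp_rw [← integral_const_mul, ← mul_assoc]
  rw [intervalIntegral_integral_swap]
  · refine integral_congr_ae (Eventually.of_forall fun x => ?_)
    simp only
    rw [intervalIntegral.integral_mul_const, sinPropagator_eq_integral]
    congr 1
    have := intervalIntegral.integral_comp_sub_right (a := τ) (b := t) (fun s =>
      (((t - τ) - s : ℝ) : ℂ) * sinPropagator s (Laplacian.laplacian φ) x) τ
    rw [sub_self] at this
    rw [← this]
    congr 1; funext s; rw [sub_sub_sub_cancel_right]
  · refine integrable_sinPropagator_mul (T := |t - τ|) (a := |t - τ|) hq hq' (f := fun _ x => f τ x)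
      ?_ ?_ _ (by fun_prop) ?_ (by fun_prop) ?_
    · exact hτ.2.comp_snd
    · rw [lintegral_const]
      exact ENNReal.mul_ne_top hτ.1.ne (by simp [Set.uIoc])
    · intro s hs
      exact abs_sub_le_of_mem_uIcc (Set.uIoc_subset_uIcc hs) Set.left_mem_uIcc
    · intro s hs
      exact abs_sub_le_of_mem_uIcc Set.right_mem_uIcc (Set.uIoc_subset_uIcc hs)

end Duhamel

/-! ### Integrability of the nonlinear source. -/

theorem half_lt_critExp {p : ℝ} (hp3 : 3 < p) : 1 / 2 < critExp p := by
  have : 2 / (p - 1) < 1 := by rw [div_lt_one] <;> linarith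
  unfold critExp; linarith

theorem critExp_lt_one {p : ℝ} (hp3 : 3 < p) (hp5 : p < 5) : critExp p < 1 := by
  have : 1 / 2 < 2 / (p - 1) := by rw [div_lt_div_iff₀] <;> linarith
  unfold critExp; linarith

section Source

variable {p C₅ : ℝ} {F : ℝ → ℝ → ℝ}

theorem IsNonlinearity.continuous_comp_norm (hF : IsNonlinearity p C₅ F) :
    Continuous fun z : E3 × ℝ => F ‖z.1‖ z.2 :=
  hF.continuousOn.comp_continuous (f := fun z : E3 × ℝ => (‖z.1‖, z.2)) (by fun_prop)
    fun z => ⟨norm_nonneg _, Set.mem_univ _⟩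

theorem IsNonlinearity.aestronglyMeasurable_source (hF : IsNonlinearity p C₅ F) {u : ℝ → E3 → ℝ}
    {S : Set ℝ} (hu : AEStronglyMeasurable (Function.uncurry u) ((volume.restrict S).prod volume)) :
    AEStronglyMeasurable (Function.uncurry fun τ x => (F ‖x‖ (u τ x) : ℂ))
      ((volume.restrict S).prod volume) := by
  have hu' : AEStronglyMeasurable (fun z : ℝ × E3 => u z.1 z.2)
      ((volume.restrict S).prod volume) := hu
  have h0 : AEStronglyMeasurable (fun z : ℝ × E3 => z.2) ((volume.restrict S).prod volume) :=
    continuous_snd.aestronglyMeasurable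
  have h2 : Continuous (Function.uncurry fun (x : E3) (a : ℝ) => (F ‖x‖ a : ℂ)) :=
    Complex.continuous_ofReal.comp hF.continuous_comp_norm
  exact h2.comp_aestronglyMeasurable₂ h0 hu'

/-- By |F| ≤ |a|^p, the L^{2/(2-s_p)} norm of the source is at most N^p, where N is the spatial norm
in the definition of Y. As s_p < 1, the time exponent 2p/(1+s_p) is at least p, so N^p ≤ 1 +
N^{2p/(1+s_p)}, which is integrable over a bounded interval. -/
theorem IsNonlinearity.lintegral_source_ne_top (hp3 : 3 < p) (hp5 : p < 5)
    (hF : IsNonlinearity p C₅ F) {u : ℝ → E3 → ℝ} {a b : ℝ}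
    (hu : FiniteYNorm p (Set.Icc a b) u) :
    ∫⁻ τ in Set.Icc a b, (∫⁻ x, ‖(F ‖x‖ (u τ x) : ℂ)‖ₑ ^ (2 / (2 - critExp p))) ^
      (1 / (2 / (2 - critExp p))) ≠ ⊤ := by
  have hs1 := half_lt_critExp hp3
  have hs2 := critExp_lt_one hp3 hp5
  set s := critExp p
  have h2s : 0 < 2 - s := by linarith
  have hr : 0 < 2 * p / (2 - s) := by positivity
  have hle : p ≤ 2 * p / (1 + s) := by rw [le_div_iff₀ (by linarith)]; nlinarith
  refine ne_of_lt (lt_of_le_of_lt (lintegral_mono (g := fun τ =>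
    1 + eLpNorm (u τ) (ENNReal.ofReal (2 * p / (2 - s))) volume ^ (2 * p / (1 + s))) ?_) ?_)
  · intro τ
    set N := eLpNorm (u τ) (ENNReal.ofReal (2 * p / (2 - s))) volume with hN
    have hN' : N = (∫⁻ x, ‖u τ x‖ₑ ^ (2 * p / (2 - s))) ^ (1 / (2 * p / (2 - s))) := by
      rw [hN, eLpNorm_eq_lintegral_rpow_enorm_toReal (by simpa using hr) ENNReal.ofReal_ne_top,
        ENNReal.toReal_ofReal hr.le]
    have h1 : (∫⁻ x, ‖(F ‖x‖ (u τ x) : ℂ)‖ₑ ^ (2 / (2 - s))) ^ (1 / (2 / (2 - s))) ≤ N ^ p := by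
      rw [hN', ← ENNReal.rpow_mul,
        show 1 / (2 * p / (2 - s)) * p = 1 / (2 / (2 - s)) by field_simp]
      gcongr with x
      rw [show 2 * p / (2 - s) = p * (2 / (2 - s)) by ring, ENNReal.rpow_mul]
      gcongr
      rw [← ofReal_norm, Complex.norm_real, Real.norm_eq_abs, ← ofReal_norm (u τ x),
        Real.norm_eq_abs, ENNReal.ofReal_rpow_of_nonneg (abs_nonneg _) (by linarith)]
      exact ENNReal.ofReal_le_ofReal (hF.growth _ (norm_nonneg _) _)
    refine h1.trans ?_
    rcases le_total N 1 with h | h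
    · exact (ENNReal.rpow_le_one h (by linarith)).trans le_self_add
    · exact (ENNReal.rpow_le_rpow_of_exponent_le h hle).trans le_add_self
  · rw [lintegral_add_left measurable_const]
    exact ENNReal.add_lt_top.2 ⟨by simp, hu⟩

theorem holderConjugate_critExp (hp3 : 3 < p) (hp5 : p < 5) :
    (2 / (2 - critExp p)).HolderConjugate (2 / critExp p) := by
  have hs1 := half_lt_critExp hp3
  have hs2 := critExp_lt_one hp3 hp5
  rw [Real.holderConjugate_iff]
  constructor
  · rw [lt_div_iff₀] <;> linarith
  · rw [inv_div, inv_div]; ring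

end Source

/-! ### From Duhamel's formula to the equation integrated in time. -/

section Solution

variable {p C₅ : ℝ} {F : ℝ → ℝ → ℝ} {I : Set ℝ} {u : ℝ → E3 → ℝ} {U V : ℝ → 𝓢'(E3, ℂ)}

theorem IsSolution.continuousOn_pairing (sol : IsSolution p F I u U V) (φ : 𝓢(E3, ℂ)) :
    ContinuousOn (fun t => U t φ) I := fun t ht => (sol.timeDeriv t ht φ).continuousWithinAt

/-- `∂ₜ² u = Δ u + F(|x|, u)`, integrated twice in time. -/
theorem IsSolution.eq_add_integral (hp3 : 3 < p) (hp5 : p < 5) (hF : IsNonlinearity p C₅ F)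
    (hI : I.OrdConnected) (sol : IsSolution p F I u U V) {t₀ t : ℝ} (ht₀ : t₀ ∈ I) (ht : t ∈ I)
    (φ : 𝓢(E3, ℂ)) :
    IntervalIntegrable (fun s => ∫ x, φ x * (F ‖x‖ (u s x) : ℂ)) volume t₀ t ∧
    U t φ = U t₀ φ + ((t - t₀ : ℝ) : ℂ) * V t₀ φ + ∫ s in t₀..t, ((t - s : ℝ) : ℂ) *
      (U s (Laplacian.laplacian φ) + ∫ x, φ x * (F ‖x‖ (u s x) : ℂ)) := by
  have hIcc : Set.uIcc t₀ t ⊆ I := hI.uIcc_subset ht₀ ht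
  have hIoc : Set.uIoc t₀ t ⊆ I := Set.uIoc_subset_uIcc.trans hIcc
  have hq := holderConjugate_critExp hp3 hp5
  have hq' : 2 ≤ 2 / critExp p := by
    have hs1 := half_lt_critExp hp3
    have hs2 := critExp_lt_one hp3 hp5
    rw [le_div_iff₀] <;> linarith
  set f : ℝ → E3 → ℂ := fun τ x => (F ‖x‖ (u τ x) : ℂ) with hf_def
  have hf : AEStronglyMeasurable (Function.uncurry f)
      ((volume.restrict (Set.uIoc t₀ t)).prod volume) :=
    (hF.aestronglyMeasurable_source sol.measurable).mono_ac
      ((Measure.restrict_mono hIoc le_rfl).absolutelyContinuous.prod Measure.AbsolutelyContinuous.rfl)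
  have hfin : ∫⁻ τ in Set.uIoc t₀ t, (∫⁻ x, ‖f τ x‖ₑ ^ (2 / (2 - critExp p))) ^
      (1 / (2 / (2 - critExp p))) ≠ ⊤ :=
    ne_top_of_le_ne_top (hF.lintegral_source_ne_top hp3 hp5 (sol.finite_Y _ _ hIcc))
      (lintegral_mono_set Set.uIoc_subset_uIcc)
  have hφ : ∀ {b : ℝ → ℝ} {B : ℝ}, Continuous b → (∀ τ ∈ Set.uIoc t₀ t, |b τ| ≤ B) →
      Integrable (Function.uncurry fun τ x => ((b τ : ℂ) * φ x) * f τ x)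
        ((volume.restrict (Set.uIoc t₀ t)).prod volume) := by
    intro b B hb hB
    refine integrable_kernel_mul (M := B * SchwartzMap.seminorm ℝ 0 0 φ)
      (A := B ^ 2 * ∫ x, ‖φ x‖ ^ 2) hq hq' measurableSet_uIoc hf hfin ?_ ?_ ?_ ?_
    · exact (Complex.continuous_ofReal.comp (hb.comp _root_.continuous_fst)).mul
        (φ.continuous.comp _root_.continuous_snd)
    · intro τ hτ x
      rw [norm_mul, Complex.norm_real, Real.norm_eq_abs]
      exact mul_le_mul (hB τ hτ) (φ.norm_le_seminorm ℝ x) (norm_nonneg _)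
        ((abs_nonneg _).trans (hB τ hτ))
    · intro τ hτ
      simp_rw [norm_mul, mul_pow]
      exact (integrable_norm_sq _).const_mul _
    · intro τ hτ
      simp_rw [norm_mul, mul_pow, integral_const_mul, Complex.norm_real, Real.norm_eq_abs]
      exact mul_le_mul_of_nonneg_right (pow_le_pow_left₀ (abs_nonneg _) (hB τ hτ) 2)
        (integral_nonneg fun _ => sq_nonneg _)
  have hφ₁ : Integrable (Function.uncurry fun τ x => φ x * f τ x)
      ((volume.restrict (Set.uIoc t₀ t)).prod volume) := by
    simpa using hφ (b := fun _ => 1) (B := 1) continuous_const (by simp)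
  have hφ₂ := hφ (b := fun τ => t - τ) (B := |t - t₀|) (by fun_prop)
    fun τ hτ => abs_sub_le_of_mem_uIcc Set.right_mem_uIcc (Set.uIoc_subset_uIcc hτ)
  have hS := integrable_sinPropagator_mul (T := |t - t₀|) (a := 1) hq hq' hf hfin φ
    (c := fun τ => t - τ) (by fun_prop)
    (fun τ hτ => abs_sub_le_of_mem_uIcc Set.right_mem_uIcc (Set.uIoc_subset_uIcc hτ))
    (b := fun _ => 1) continuous_const (by simp)
  simp only [Complex.ofReal_one, one_mul] at hS
  have iφ₁ : IntervalIntegrable (fun s => ∫ x, φ x * f s x) volume t₀ t := by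
    rw [intervalIntegrable_iff, IntegrableOn]
    exact hφ₁.integral_prod_left
  have iφ₂ : IntervalIntegrable (fun s => ((t - s : ℝ) : ℂ) * ∫ x, φ x * f s x) volume t₀ t :=
    iφ₁.continuousOn_mul (Continuous.continuousOn (by fun_prop))
  refine ⟨iφ₁, ?_⟩
  obtain ⟨g₀, hg₀⟩ := sol.continuous_fst
  obtain ⟨g₁, hg₁⟩ := sol.continuous_snd
  have h₀ := (hg₀ t₀ ht₀).1
  have h₁ := (hg₁ t₀ ht₀).1
  set ψ := Laplacian.laplacian φ
  have iU : IntervalIntegrable (fun s => ((t - s : ℝ) : ℂ) * U s ψ) volume t₀ t :=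
    ContinuousOn.intervalIntegrable (ContinuousOn.mul (Continuous.continuousOn (by fun_prop))
      ((sol.continuousOn_pairing ψ).mono hIcc))
  have iL : IntervalIntegrable (fun s => ((t - s : ℝ) : ℂ) * linearWave (s - t₀) (U t₀) (V t₀) ψ)
      volume t₀ t := by
    have := (intervalIntegrable_linearWave h₀ h₁ (t - t₀) ψ).comp_sub_right t₀
    simpa using this
  have eL : ∫ s in (0 : ℝ)..(t - t₀), (((t - t₀) - s : ℝ) : ℂ) * linearWave s (U t₀) (V t₀) ψ =
      ∫ s in t₀..t, ((t - s : ℝ) : ℂ) * linearWave (s - t₀) (U t₀) (V t₀) ψ := by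
    have := intervalIntegral.integral_comp_sub_right (a := t₀) (b := t) (fun s =>
      (((t - t₀) - s : ℝ) : ℂ) * linearWave s (U t₀) (V t₀) ψ) t₀
    rw [sub_self] at this
    rw [← this]
    congr 1; funext s; rw [sub_sub_sub_cancel_right]
  -- Duhamel's formula at each intermediate time s expresses the free wave as `U s ψ` minus a
  -- Duhamel term; weighted with t - s and integrated, that term is evaluated by
  -- `integral_duhamel_eq`.
  have eD : ∫ s in t₀..t, ((t - s : ℝ) : ℂ) * linearWave (s - t₀) (U t₀) (V t₀) ψ =
      (∫ s in t₀..t, ((t - s : ℝ) : ℂ) * U s ψ) -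
      ∫ s in t₀..t, ((t - s : ℝ) : ℂ) * ∫ τ in t₀..s, ∫ x, sinPropagator (s - τ) ψ x * f τ x := by
    have hds : ∀ s ∈ Set.uIcc t₀ t, ((t - s : ℝ) : ℂ) * linearWave (s - t₀) (U t₀) (V t₀) ψ =
        ((t - s : ℝ) : ℂ) * U s ψ -
          ((t - s : ℝ) : ℂ) * ∫ τ in t₀..s, ∫ x, sinPropagator (s - τ) ψ x * f τ x := by
      intro s hs
      rw [sol.duhamel s (hIcc hs) t₀ ht₀ ψ]
      change _ = _ * (_ + ∫ τ in t₀..s, ∫ x, sinPropagator (s - τ) ψ x * f τ x) - _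
      ring
    have hi : IntervalIntegrable (fun s => ((t - s : ℝ) : ℂ) *
        ∫ τ in t₀..s, ∫ x, sinPropagator (s - τ) ψ x * f τ x) volume t₀ t := by
      refine (iU.sub iL).congr fun s hs => ?_
      simp only [hds s (Set.uIoc_subset_uIcc hs)]
      ring
    rw [← intervalIntegral.integral_sub iU hi]
    exact intervalIntegral.integral_congr hds
  have eS : ∫ τ in t₀..t, ∫ x, (sinPropagator (t - τ) φ x - ((t - τ : ℝ) : ℂ) * φ x) * f τ x =
      (∫ τ in t₀..t, ∫ x, sinPropagator (t - τ) φ x * f τ x) -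
        ∫ τ in t₀..t, ((t - τ : ℝ) : ℂ) * ∫ x, φ x * f τ x := by
    rw [← intervalIntegral.integral_sub _ iφ₂]
    · refine intervalIntegral.integral_congr_ae ?_
      rw [← ae_restrict_iff' measurableSet_uIoc]
      filter_upwards [hS.prod_right_ae, hφ₂.prod_right_ae] with τ h1 h2
      simp only [Function.uncurry] at h1 h2
      rw [← integral_const_mul, ← integral_sub h1 (by simpa only [mul_assoc] using h2)]
      refine integral_congr_ae (Eventually.of_forall fun x => ?_)
      simp only; ring
    · rw [intervalIntegrable_iff, IntegrableOn]
      exact hS.integral_prod_left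
  have eφ : ∫ s in t₀..t, ((t - s : ℝ) : ℂ) * (U s ψ + ∫ x, φ x * f s x) =
      (∫ s in t₀..t, ((t - s : ℝ) : ℂ) * U s ψ) +
        ∫ s in t₀..t, ((t - s : ℝ) : ℂ) * ∫ x, φ x * f s x := by
    rw [← intervalIntegral.integral_add iU iφ₂]
    congr 1; funext s; ring
  have hmain := sol.duhamel t ht t₀ ht₀ φ
  have hD := integral_duhamel_eq hq hq' hf hfin φ
  rw [linearWave_eq_integral h₀ h₁, eL, eD, hD, eS] at hmain
  rw [eφ, hmain]
  change _ + ∫ τ in t₀..t, ∫ x, sinPropagator (t - τ) φ x * f τ x = _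
  ring

/-- `∂ₜ v = Δ u + F(|x|, u)`, integrated in time. -/
theorem IsSolution.timeDeriv_sub (hp3 : 3 < p) (hp5 : p < 5) (hF : IsNonlinearity p C₅ F)
    (hI : I.OrdConnected) (sol : IsSolution p F I u U V) {t₀ t : ℝ} (ht₀ : t₀ ∈ I) (ht : t ∈ I)
    (φ : 𝓢(E3, ℂ)) :
    V t φ - V t₀ φ = ∫ s in t₀..t,
      (U s (Laplacian.laplacian φ) + ∫ x, φ x * (F ‖x‖ (u s x) : ℂ)) := by
  rcases eq_or_ne t t₀ with rfl | hne
  · simp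
  -- The twice integrated identity is used from t₀ to t and from t to t₀. In the sum the kernels t -
  -- s and t₀ - s leave the constant t - t₀, so dividing by it gives the once integrated identity
  -- without any differentiation.
  obtain ⟨i, h1⟩ := sol.eq_add_integral hp3 hp5 hF hI ht₀ ht φ
  obtain ⟨-, h2⟩ := sol.eq_add_integral hp3 hp5 hF hI ht ht₀ φ
  have iq : IntervalIntegrable (fun s => U s (Laplacian.laplacian φ) +
      ∫ x, φ x * (F ‖x‖ (u s x) : ℂ)) volume t₀ t :=
    (ContinuousOn.intervalIntegrable
      ((sol.continuousOn_pairing _).mono (hI.uIcc_subset ht₀ ht))).add i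
  set Q := fun s => U s (Laplacian.laplacian φ) + ∫ x, φ x * (F ‖x‖ (u s x) : ℂ)
  rw [intervalIntegral.integral_symm] at h2
  have h3 : (∫ s in t₀..t, ((t - s : ℝ) : ℂ) * Q s) - ∫ s in t₀..t, ((t₀ - s : ℝ) : ℂ) * Q s =
      ((t - t₀ : ℝ) : ℂ) * ∫ s in t₀..t, Q s := by
    rw [← intervalIntegral.integral_sub
      (iq.continuousOn_mul (Continuous.continuousOn (by fun_prop)))
      (iq.continuousOn_mul (Continuous.continuousOn (by fun_prop))),
      ← intervalIntegral.integral_const_mul]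
    congr 1; funext s; push_cast; ring
  have hne' : ((t - t₀ : ℝ) : ℂ) ≠ 0 := by exact_mod_cast sub_ne_zero.2 hne
  refine mul_left_cancel₀ hne' ?_
  rw [← h3]
  have h4 : ((t₀ - t : ℝ) : ℂ) = -((t - t₀ : ℝ) : ℂ) := by push_cast; ring
  rw [h4] at h2
  linear_combination h1 + h2

end Solution

/-! ### Bumps, mollification and one-variable estimates. -/

/-- A smooth function on the line with support in `[-κ, κ]`. -/
def IsBumpFunction (κ : ℝ) (θ : ℝ → ℝ) : Prop :=
  ContDiff ℝ (⊤ : ℕ∞) θ ∧ tsupport θ ⊆ Set.Icc (-κ) κ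

/-- A smooth compactly supported function on the half-line `(a, ∞)`. -/
def IsTestOn (a : ℝ) (θ : ℝ → ℝ) : Prop :=
  ContDiff ℝ (⊤ : ℕ∞) θ ∧ HasCompactSupport θ ∧ tsupport θ ⊆ Set.Ioi a

namespace IsBumpFunction

variable {κ : ℝ} {θ : ℝ → ℝ}

theorem deriv (h : IsBumpFunction κ θ) : IsBumpFunction κ (deriv θ) := by
  refine ⟨?_, tsupport_deriv_subset.trans h.2⟩
  exact (contDiff_infty_iff_deriv.1 h.1).2

theorem hasCompactSupport (h : IsBumpFunction κ θ) : HasCompactSupport θ :=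
  isCompact_Icc.of_isClosed_subset (isClosed_tsupport _) h.2

theorem continuous (h : IsBumpFunction κ θ) : Continuous θ := h.1.continuous

theorem differentiable (h : IsBumpFunction κ θ) : Differentiable ℝ θ :=
  h.1.differentiable (by simp)

theorem eq_zero (h : IsBumpFunction κ θ) {x : ℝ} (hx : x ∉ Set.Icc (-κ) κ) : θ x = 0 :=
  image_eq_zero_of_notMem_tsupport fun h' => hx (h.2 h')

theorem exists_bound (h : IsBumpFunction κ θ) : ∃ C, ∀ x, ‖θ x‖ ≤ C :=
  h.hasCompactSupport.exists_bound_of_continuous h.continuous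

theorem isTestOn (h : IsBumpFunction κ θ) {a ρ : ℝ} (hρ : a + κ < ρ) :
    IsTestOn a fun r => θ (r - ρ) := by
  have hts : tsupport (fun r => θ (r - ρ)) ⊆ Set.Icc (ρ - κ) (ρ + κ) := by
    refine closure_minimal (fun r hr => ?_) isClosed_Icc
    have := h.2 (subset_tsupport _ (show r - ρ ∈ Function.support θ from hr))
    constructor <;> linarith [this.1, this.2]
  exact ⟨h.1.comp (contDiff_id.sub contDiff_const),
    isCompact_Icc.of_isClosed_subset (isClosed_tsupport _) hts,
    hts.trans fun r hr => by simp only [Set.mem_Ioi]; linarith [hr.1]⟩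

end IsBumpFunction

/-- Differentiation of `σ ↦ ∫ f(x) θ(N x - σ) dμ` under the integral sign. -/
theorem hasDerivAt_integral_shift {X : Type*} [MeasurableSpace X] {μ : Measure X} {N f : X → ℝ}
    (hN : Measurable N) {a κ ρ : ℝ} (hf : ∀ c d, a < c → IntegrableOn f (N ⁻¹' Set.Icc c d) μ)
    {θ : ℝ → ℝ} (hθ : IsBumpFunction κ θ) (hρ : a + κ < ρ) :
    HasDerivAt (fun σ => ∫ x, f x * θ (N x - σ) ∂μ) (-∫ x, f x * deriv θ (N x - ρ) ∂μ) ρ := by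
  -- Half the distance to the boundary: for shifts σ within ε of ρ all the bumps live over one set K
  -- on which f is integrable, and this supplies the dominating function.
  set ε := (ρ - (a + κ)) / 2 with hε
  have hε0 : 0 < ε := by rw [hε]; linarith
  set K := N ⁻¹' Set.Icc (ρ - κ - ε) (ρ + κ + ε) with hK
  have hKm : MeasurableSet K := hN measurableSet_Icc
  have hfK : IntegrableOn f K μ := hf _ _ (by rw [hε]; linarith)
  have hoff : ∀ {ϑ : ℝ → ℝ}, IsBumpFunction κ ϑ → ∀ σ ∈ Metric.ball ρ ε, ∀ x, x ∉ K →
      ϑ (N x - σ) = 0 := by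
    intro ϑ hϑ σ hσ x hx
    refine hϑ.eq_zero fun h => hx ?_
    rw [Metric.mem_ball, Real.dist_eq, abs_lt] at hσ
    constructor <;> linarith [h.1, h.2]
  have hind : ∀ {ϑ : ℝ → ℝ}, IsBumpFunction κ ϑ → ∀ σ ∈ Metric.ball ρ ε,
      (fun x => f x * ϑ (N x - σ)) = fun x => K.indicator f x * ϑ (N x - σ) := by
    intro ϑ hϑ σ hσ
    funext x
    by_cases hx : x ∈ K
    · rw [Set.indicator_of_mem hx]
    · rw [hoff hϑ σ hσ x hx, mul_zero, mul_zero]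
  have hmeas : ∀ {ϑ : ℝ → ℝ}, IsBumpFunction κ ϑ → ∀ σ ∈ Metric.ball ρ ε,
      AEStronglyMeasurable (fun x => f x * ϑ (N x - σ)) μ := by
    intro ϑ hϑ σ hσ
    rw [hind hϑ σ hσ]
    exact (hfK.integrable_indicator hKm).aestronglyMeasurable.mul
      (hϑ.continuous.measurable.comp (hN.sub_const σ)).aestronglyMeasurable
  have hρm : ρ ∈ Metric.ball ρ ε := Metric.mem_ball_self hε0
  obtain ⟨C₀, hC₀⟩ := hθ.exists_bound
  obtain ⟨C, hC⟩ := hθ.deriv.exists_bound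
  have := (hasDerivAt_integral_of_dominated_loc_of_deriv_le (μ := μ)
    (F := fun σ x => f x * θ (N x - σ)) (F' := fun σ x => -(f x * deriv θ (N x - σ)))
    (bound := fun x => C * |K.indicator f x|) (Metric.ball_mem_nhds ρ hε0)
    (by filter_upwards [Metric.ball_mem_nhds ρ hε0] with σ hσ using hmeas hθ σ hσ)
    (by
      rw [hind hθ ρ hρm]
      exact (hfK.integrable_indicator hKm).mul_bdd (c := C₀)
        (hθ.continuous.measurable.comp (hN.sub_const ρ)).aestronglyMeasurable
        (Eventually.of_forall fun x => hC₀ _))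
    (hmeas hθ.deriv ρ hρm).neg
    (Eventually.of_forall fun x σ hσ => by
      have : f x * deriv θ (N x - σ) = K.indicator f x * deriv θ (N x - σ) :=
        congrFun (hind hθ.deriv σ hσ) x
      rw [this, norm_neg, norm_mul, mul_comm]
      exact mul_le_mul_of_nonneg_right (hC _) (norm_nonneg _))
    ((hfK.integrable_indicator hKm).abs.const_mul C)
    (Eventually.of_forall fun x σ hσ => by
      have h1 : HasDerivAt (fun σ => θ (N x - σ)) (-deriv θ (N x - σ)) σ := by
        refine ((hθ.differentiable (N x - σ)).hasDerivAt.comp σ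
          ((hasDerivAt_id' σ).const_sub (N x))).congr_deriv ?_
        ring
      simpa using h1.const_mul (f x))).2
  rwa [integral_neg] at this

/-- A chain rule along the lines of slope `ε`, for a function that has one-sided time derivatives
and jointly continuous space derivatives. -/
theorem hasDerivWithinAt_along_line {I : Set ℝ} {b t r ε m : ℝ} {M M₁ : ℝ → ℝ → ℝ} (ht : t ∈ I)
    (hr : b < r) (hM : HasDerivWithinAt (fun s => M s r) m I t)
    (hM₁ : ∀ s ∈ I, ∀ r, b < r → HasDerivAt (M s) (M₁ s r) r)
    (hc : ContinuousOn (Function.uncurry M₁) (I ×ˢ Set.Ioi b)) :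
    HasDerivWithinAt (fun s => M s (r + ε * (s - t))) (m + ε * M₁ t r) I t := by
  have key : HasDerivWithinAt (fun s => M s (r + ε * (s - t)) - M s r) (ε * M₁ t r) I t := by
    rw [hasDerivWithinAt_iff_isLittleO, Asymptotics.isLittleO_iff]
    intro c hc0
    have h1 : ∀ᶠ z in 𝓝[I ×ˢ Set.Ioi b] (t, r), dist (Function.uncurry M₁ z) (M₁ t r) <
        c / (|ε| + 1) :=
      Metric.tendsto_nhds.1 (hc (t, r) ⟨ht, hr⟩) _ (by positivity)
    obtain ⟨δ, hδ, hball⟩ := Metric.mem_nhdsWithin_iff.1 h1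
    have h2 : Metric.ball t (min δ (min δ (r - b) / (|ε| + 1))) ∩ I ∈ 𝓝[I] t := by
      rw [Set.inter_comm]
      exact inter_mem_nhdsWithin _ (Metric.ball_mem_nhds _
        (lt_min hδ (div_pos (lt_min hδ (by linarith)) (by positivity))))
    filter_upwards [h2] with s hs
    obtain ⟨hs1, hsI⟩ := hs
    rw [Metric.mem_ball, Real.dist_eq, lt_min_iff, lt_div_iff₀ (by positivity)] at hs1
    have hshift : |ε * (s - t)| < min δ (r - b) := by
      rw [abs_mul]; nlinarith [abs_nonneg (s - t), abs_nonneg ε]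
    have hpt : ∀ r' ∈ Set.uIcc r (r + ε * (s - t)), b < r' ∧ |M₁ s r' - M₁ t r| ≤ c / (|ε| + 1) := by
      intro r' hr'
      have h3 : |r' - r| < min δ (r - b) :=
        (Set.abs_sub_left_of_mem_uIcc hr').trans_lt (by simpa using hshift)
      have hb : b < r' := by
        have := (abs_lt.1 (h3.trans_le (min_le_right _ _))).1; linarith
      have hmem : (s, r') ∈ I ×ˢ Set.Ioi b := ⟨hsI, hb⟩
      refine ⟨hb, (hball ⟨?_, hmem⟩).le⟩
      rw [Metric.mem_ball, Prod.dist_eq, max_lt_iff]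
      exact ⟨hs1.1, h3.trans_le (min_le_left _ _)⟩
    -- Mean value inequality in the space variable at the fixed time s, after subtracting the linear
    -- function of slope `M₁ t r`. Joint continuity of `M₁` makes the remaining slope small, and no
    -- joint differentiability of M is required.
    have h4 := Convex.norm_image_sub_le_of_norm_hasDerivWithin_le
      (f := fun r' => M s r' - M₁ t r * r') (f' := fun r' => M₁ s r' - M₁ t r)
      (s := Set.uIcc r (r + ε * (s - t))) (x := r) (y := r + ε * (s - t)) (C := c / (|ε| + 1))
      (fun r' hr' => (((hM₁ s hsI r' (hpt r' hr').1).sub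
        ((hasDerivAt_id' r').const_mul (M₁ t r))).congr_deriv (by ring)).hasDerivWithinAt)
      (fun r' hr' => (hpt r' hr').2) (convex_uIcc _ _) Set.left_mem_uIcc Set.right_mem_uIcc
    have h5 : c / (|ε| + 1) * ‖r + ε * (s - t) - r‖ ≤ c * ‖s - t‖ := by
      rw [add_sub_cancel_left, norm_mul, Real.norm_eq_abs ε, div_mul_eq_mul_div,
        div_le_iff₀ (by positivity)]
      nlinarith [mul_nonneg hc0.le (norm_nonneg (s - t)), abs_nonneg ε]
    refine le_trans (le_of_eq ?_) (h4.trans h5)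
    congr 1
    simp only [sub_self, mul_zero, add_zero, smul_eq_mul]
    ring
  refine (key.add hM).congr_deriv (by ring) |>.congr_of_eventuallyEq ?_ ?_
  · exact Eventually.of_forall fun s => by simp
  · simp

/-- The correlation `ρ ↦ ∫ g(t, r) θ(r - ρ) dr`. -/
def mollify (g : ℝ → ℝ → ℝ) (θ : ℝ → ℝ) (t ρ : ℝ) : ℝ := ∫ r, g t r * θ (r - ρ)

/-- A nonnegative smooth bump function of integral one, supported in `[-κ, κ]`. -/
def unitBump (κ : ℝ) (hκ : 0 < κ) : ℝ → ℝ :=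
  (⟨κ / 2, κ, half_pos hκ, half_lt_self hκ⟩ : ContDiffBump (0 : ℝ)).normed volume

section unitBump

variable {κ : ℝ} (hκ : 0 < κ)

theorem isBumpFunction_unitBump : IsBumpFunction κ (unitBump κ hκ) := by
  refine ⟨ContDiffBump.contDiff_normed _, ?_⟩
  rw [unitBump, ContDiffBump.tsupport_normed_eq, Real.closedBall_eq_Icc, zero_sub, zero_add]

theorem unitBump_nonneg (x : ℝ) : 0 ≤ unitBump κ hκ x := ContDiffBump.nonneg_normed _ x

theorem integral_unitBump : ∫ x, unitBump κ hκ x = 1 := ContDiffBump.integral_normed _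

theorem integral_unitBump_sub (ρ : ℝ) : ∫ x, unitBump κ hκ (x - ρ) = 1 := by
  rw [integral_sub_right_eq_self (fun x => unitBump κ hκ x), integral_unitBump]

end unitBump

theorem integrable_mul_shift {g θ : ℝ → ℝ} {κ ρ : ℝ} (hθ : IsBumpFunction κ θ)
    (hg : IntegrableOn g (Set.Icc (ρ - κ) (ρ + κ))) : Integrable fun r => g r * θ (r - ρ) := by
  obtain ⟨C, hC⟩ := hθ.exists_bound
  have h : (fun r => g r * θ (r - ρ)) =
      fun r => (Set.Icc (ρ - κ) (ρ + κ)).indicator g r * θ (r - ρ) := by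
    funext r
    by_cases hr : r ∈ Set.Icc (ρ - κ) (ρ + κ)
    · rw [Set.indicator_of_mem hr]
    · rw [hθ.eq_zero (x := r - ρ) fun h => hr ⟨by linarith [h.1], by linarith [h.2]⟩]; simp
  rw [h]
  exact (hg.integrable_indicator measurableSet_Icc).mul_bdd (c := C)
    (hθ.continuous.comp (continuous_sub_right ρ)).aestronglyMeasurable
    (Eventually.of_forall fun x => hC _)

theorem mollify_eq_zero {g : ℝ → ℝ → ℝ} {θ : ℝ → ℝ} {κ t ρ : ℝ} (hθ : IsBumpFunction κ θ)
    (h : ∀ r ∈ Set.Icc (ρ - κ) (ρ + κ), g t r = 0) : mollify g θ t ρ = 0 := by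
  refine integral_eq_zero_of_ae (Eventually.of_forall fun r => ?_)
  by_cases hr : r ∈ Set.Icc (ρ - κ) (ρ + κ)
  · simp [h r hr]
  · simp [hθ.eq_zero (x := r - ρ) fun h => hr ⟨by linarith [h.1], by linarith [h.2]⟩]

theorem abs_mollify_le {g : ℝ → ℝ → ℝ} {κ t ρ B : ℝ} (hκ : 0 < κ)
    (h : ∀ r ∈ Set.Icc (ρ - κ) (ρ + κ), |g t r| ≤ B) :
    |mollify g (unitBump κ hκ) t ρ| ≤ B := by
  have hθ := isBumpFunction_unitBump hκ
  have hi : Integrable fun r => B * unitBump κ hκ (r - ρ) :=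
    (((hθ.continuous.integrable_of_hasCompactSupport hθ.hasCompactSupport).comp_sub_right ρ)).const_mul _
  have := norm_integral_le_of_norm_le (f := fun r => g t r * unitBump κ hκ (r - ρ)) hi
    (Eventually.of_forall fun r => by
      rw [norm_mul, Real.norm_of_nonneg (unitBump_nonneg hκ _)]
      by_cases hr : r ∈ Set.Icc (ρ - κ) (ρ + κ)
      · exact mul_le_mul_of_nonneg_right (h r hr) (unitBump_nonneg hκ _)
      · rw [hθ.eq_zero (x := r - ρ) fun h => hr ⟨by linarith [h.1], by linarith [h.2]⟩]; simp)
  rwa [integral_const_mul, integral_unitBump_sub, mul_one] at this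

theorem abs_mollify_sub_le {g : ℝ → ℝ → ℝ} {κ t ρ δ : ℝ} (hκ : 0 < κ)
    (hg : IntegrableOn (g t) (Set.Icc (ρ - κ) (ρ + κ)))
    (h : ∀ r ∈ Set.Icc (ρ - κ) (ρ + κ), |g t r - g t ρ| ≤ δ) :
    |mollify g (unitBump κ hκ) t ρ - g t ρ| ≤ δ := by
  have hθ := isBumpFunction_unitBump hκ
  have h1 := abs_mollify_le (g := fun s r => g s r - g t ρ) hκ h
  have h2 : mollify (fun s r => g s r - g t ρ) (unitBump κ hκ) t ρ =
      mollify g (unitBump κ hκ) t ρ - g t ρ := by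
    unfold mollify
    simp_rw [sub_mul]
    rw [integral_sub (integrable_mul_shift hθ hg), integral_const_mul, integral_unitBump_sub,
      mul_one]
    exact ((hθ.continuous.integrable_of_hasCompactSupport
      hθ.hasCompactSupport).comp_sub_right ρ).const_mul _
  rwa [h2] at h1

/-- Translating the integration variable fixes the bump and moves the parameter into g, so the
integrand has a compact support that does not depend on the parameters. -/
theorem continuousOn_mollify {I : Set ℝ} {a κ : ℝ} {g : ℝ → ℝ → ℝ} {θ : ℝ → ℝ}
    (hg : ContinuousOn (Function.uncurry g) (I ×ˢ Set.Ioi a)) (hθ : IsBumpFunction κ θ) :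
    ContinuousOn (Function.uncurry (mollify g θ)) (I ×ˢ Set.Ioi (a + κ)) := by
  have h1 : Function.uncurry (mollify g θ) =
      fun z : ℝ × ℝ => ∫ x, g z.1 (x + z.2) * θ x := by
    funext z
    rw [Function.uncurry, mollify, ← integral_add_right_eq_self _ z.2]
    simp
  rw [h1]
  refine continuousOn_integral_of_compact_support (k := Set.Icc (-κ) κ) isCompact_Icc ?_
    fun z x _ hx => by rw [hθ.eq_zero hx, mul_zero]
  rintro ⟨⟨t, ρ⟩, x⟩ ⟨⟨ht, hρ⟩, -⟩
  simp only [Set.mem_Ioi] at hρ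
  by_cases hx : x ∈ Set.Icc (-κ) κ
  · have hgt : a < x + ρ := by linarith [hx.1]
    have h2 : Tendsto (fun w : (ℝ × ℝ) × ℝ => (w.1.1, w.2 + w.1.2))
        (𝓝[(I ×ˢ Set.Ioi (a + κ)) ×ˢ Set.univ] ((t, ρ), x)) (𝓝[I ×ˢ Set.Ioi a] (t, x + ρ)) := by
      refine tendsto_nhdsWithin_iff.2 ⟨?_, ?_⟩
      · have : Continuous fun w : (ℝ × ℝ) × ℝ => (w.1.1, w.2 + w.1.2) := by fun_prop
        exact (this.tendsto ((t, ρ), x)).mono_left nhdsWithin_le_nhds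
      · have hc : Continuous fun w : (ℝ × ℝ) × ℝ => w.2 + w.1.2 := by fun_prop
        have h3 : ∀ᶠ w in 𝓝 ((t, ρ), x), a < w.2 + w.1.2 :=
          (hc.tendsto ((t, ρ), x)).eventually (lt_mem_nhds hgt)
        filter_upwards [nhdsWithin_le_nhds h3, self_mem_nhdsWithin] with w hw1 hw2
        exact ⟨hw2.1.1, hw1⟩
    have h4 : Tendsto (fun w : (ℝ × ℝ) × ℝ => g w.1.1 (w.2 + w.1.2))
        (𝓝[(I ×ˢ Set.Ioi (a + κ)) ×ˢ Set.univ] ((t, ρ), x)) (𝓝 (g t (x + ρ))) :=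
      Tendsto.comp (hg (t, x + ρ) ⟨ht, hgt⟩) h2
    exact h4.mul ((hθ.continuous.comp continuous_snd).tendsto _ |>.mono_left nhdsWithin_le_nhds)
  · have h5 : ∀ᶠ w : (ℝ × ℝ) × ℝ in 𝓝 ((t, ρ), x), w.2 ∉ Set.Icc (-κ) κ :=
      (continuous_snd.tendsto ((t, ρ), x)).eventually (isClosed_Icc.isOpen_compl.mem_nhds hx)
    refine ContinuousAt.continuousWithinAt (continuousAt_const (y := (0 : ℝ)) |>.congr ?_)
    filter_upwards [h5] with w hw
    simp [Function.uncurry, hθ.eq_zero hw]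

/-- If `f' ≤ B e^{λ|s - t₀|}` in absolute value between `t₀` and `t` then `f` changes by at most
`(B/λ) e^{λ|t - t₀|}`. -/
theorem abs_sub_le_exp {f f' : ℝ → ℝ} {t₀ t B l : ℝ} (hl : 0 < l) (hB : 0 ≤ B)
    (hf : ∀ s ∈ Set.uIcc t₀ t, HasDerivWithinAt f (f' s) (Set.uIcc t₀ t) s)
    (hf' : ∀ s ∈ Set.uIcc t₀ t, |f' s| ≤ B * Real.exp (l * |s - t₀|)) :
    |f t - f t₀| ≤ B / l * Real.exp (l * |t - t₀|) := by
  -- The sign σ is the direction of time; in the elapsed time both directions become one estimate on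
  -- [0, T].
  obtain ⟨σ, hσ, T, hT, ht⟩ : ∃ σ : ℝ, |σ| = 1 ∧ ∃ T, 0 ≤ T ∧ t = t₀ + σ * T := by
    rcases le_total t₀ t with h | h
    · exact ⟨1, by simp, t - t₀, by linarith, by ring⟩
    · exact ⟨-1, by simp, t₀ - t, by linarith, by ring⟩
  have habs : ∀ x, 0 ≤ x → |t₀ + σ * x - t₀| = x := fun x hx => by
    rw [add_sub_cancel_left, abs_mul, hσ, one_mul, abs_of_nonneg hx]
  have hmem : ∀ x ∈ Set.Icc 0 T, t₀ + σ * x ∈ Set.uIcc t₀ t := by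
    intro x hx
    rw [ht, Set.mem_uIcc]
    rcases le_total 0 σ with h | h
    · left; constructor <;> nlinarith [hx.1, hx.2]
    · right; constructor <;> nlinarith [hx.1, hx.2]
  have hd : ∀ x ∈ Set.Icc 0 T, HasDerivWithinAt (fun x => f (t₀ + σ * x) - f t₀)
      (f' (t₀ + σ * x) * σ) (Set.Icc 0 T) x := by
    intro x hx
    have h1 : HasDerivWithinAt (fun x => t₀ + σ * x) σ (Set.Icc 0 T) x := by
      simpa using (((hasDerivAt_id' x).const_mul σ).const_add t₀).hasDerivWithinAt
    exact ((hf _ (hmem x hx)).comp x h1 hmem).sub_const _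
  have hE : ∀ x, HasDerivAt (fun x => B / l * Real.exp (l * x)) (B * Real.exp (l * x)) x := by
    intro x
    refine ((((hasDerivAt_id' x).const_mul l).exp).const_mul (B / l)).congr_deriv ?_
    field_simp
  have key := image_norm_le_of_norm_deriv_right_le_deriv_boundary'
    (f := fun x => f (t₀ + σ * x) - f t₀) (f' := fun x => f' (t₀ + σ * x) * σ) (a := 0) (b := T)
    (fun x hx => (hd x hx).continuousWithinAt)
    (fun x hx => (hd x (Set.Ico_subset_Icc_self hx)).mono_of_mem_nhdsWithin
      (mem_of_superset (Icc_mem_nhdsGE hx.2) (Set.Icc_subset_Icc_left hx.1)))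
    (B := fun x => B / l * Real.exp (l * x)) (B' := fun x => B * Real.exp (l * x))
    (by simp; positivity)
    (fun x _ => (hE x).continuousAt.continuousWithinAt)
    (fun x _ => (hE x).hasDerivWithinAt)
    (fun x hx => by
      have hx' := Set.Ico_subset_Icc_self hx
      have := hf' _ (hmem x hx')
      rw [habs x hx'.1] at this
      rwa [norm_mul, Real.norm_eq_abs σ, hσ, mul_one])
    (Set.right_mem_Icc.2 hT)
  rw [ht, habs T hT]
  exact key

theorem nonpos_of_le_div_two_pow {x M E : ℝ} (h : ∀ n : ℕ, x ≤ M / 2 ^ n * E) : x ≤ 0 := by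
  have h1 : Tendsto (fun n : ℕ => M / 2 ^ n * E) atTop (𝓝 (0 * E)) :=
    (tendsto_const_nhds.div_atTop (tendsto_pow_atTop_atTop_of_one_lt one_lt_two)).mul_const E
  rw [zero_mul] at h1
  exact ge_of_tendsto' h1 h

theorem abs_sub_add_abs_sub_of_mem_uIcc {t₀ s σ : ℝ} (h : σ ∈ Set.uIcc t₀ s) :
    |σ - t₀| + |σ - s| = |s - t₀| := by
  rcases Set.mem_uIcc.1 h with h | h
  · rw [abs_of_nonneg, abs_of_nonpos, abs_of_nonneg] <;> linarith
  · rw [abs_of_nonpos, abs_of_nonneg, abs_of_nonpos] <;> linarith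

/-! ### The one-dimensional wave equation on a half-line and finite speed of propagation. -/

/-- A weak solution `y` of `∂ₜ²y - ∂ᵣ²y = h` on `I × (a, ∞)`, with `y` continuous; `Z t θ` is
the pairing of `∂ₜy(t)` with the test function `θ`. -/
structure IsHalfLineWave (I : Set ℝ) (a : ℝ) (y h : ℝ → ℝ → ℝ) (Z : ℝ → (ℝ → ℝ) → ℝ) : Prop where
  cont : ContinuousOn (Function.uncurry y) (I ×ˢ Set.Ioi a)
  hasDeriv_pairing : ∀ θ, IsTestOn a θ → ∀ t ∈ I, HasDerivWithinAt (fun s => ∫ r, y s r * θ r) (Z t θ) I t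
  hasDeriv_velocity : ∀ θ, IsTestOn a θ → ∀ t ∈ I, HasDerivWithinAt (fun s => Z s θ)
    ((∫ r, y t r * deriv (deriv θ) r) + ∫ r, h t r * θ r) I t
  shift : ∀ κ θ, IsBumpFunction κ θ → ∀ t ∈ I, ∀ ρ, a + κ < ρ →
    HasDerivAt (fun σ => Z t fun r => θ (r - σ)) (-Z t fun r => deriv θ (r - ρ)) ρ
  cont_shift : ∀ κ θ, IsBumpFunction κ θ →
    ContinuousOn (Function.uncurry fun t ρ => Z t fun r => θ (r - ρ)) (I ×ˢ Set.Ioi (a + κ))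
  source_le : ∀ K ⊆ I ×ˢ Set.Ioi a, IsCompact K → ∃ C, ∀ z ∈ K, |h z.1 z.2| ≤ C * |y z.1 z.2|

/-- The quantities `∂ₜy - ε ∂ᵣy` (for `ε = ± 1`), tested against `θ(· - ρ)`. -/
def charac (y : ℝ → ℝ → ℝ) (Z : ℝ → (ℝ → ℝ) → ℝ) (θ : ℝ → ℝ) (ε t ρ : ℝ) : ℝ :=
  (Z t fun r => θ (r - ρ)) + ε * mollify y (deriv θ) t ρ

namespace IsHalfLineWave

variable {I : Set ℝ} {a κ : ℝ} {y h : ℝ → ℝ → ℝ} {Z : ℝ → (ℝ → ℝ) → ℝ} {θ : ℝ → ℝ}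

theorem integrableOn_Icc (w : IsHalfLineWave I a y h Z) {t : ℝ} (ht : t ∈ I) {c d : ℝ} (hc : a < c) :
    IntegrableOn (y t) (Set.Icc c d) := by
  refine ContinuousOn.integrableOn_Icc ?_
  have : ContinuousOn (fun r => Function.uncurry y (t, r)) (Set.Icc c d) :=
    w.cont.comp (by fun_prop) fun r hr => ⟨ht, hc.trans_le hr.1⟩
  exact this

theorem hasDerivAt_mollify (w : IsHalfLineWave I a y h Z) (hθ : IsBumpFunction κ θ) {t ρ : ℝ}
    (ht : t ∈ I) (hρ : a + κ < ρ) :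
    HasDerivAt (mollify y θ t) (-mollify y (_root_.deriv θ) t ρ) ρ :=
  hasDerivAt_integral_shift measurable_id (fun _ _ hc => w.integrableOn_Icc ht hc) hθ hρ

theorem hasDerivWithinAt_mollify (w : IsHalfLineWave I a y h Z) (hθ : IsBumpFunction κ θ)
    {t ρ : ℝ} (ht : t ∈ I) (hρ : a + κ < ρ) :
    HasDerivWithinAt (fun s => mollify y θ s ρ) (Z t fun r => θ (r - ρ)) I t :=
  w.hasDeriv_pairing _ (hθ.isTestOn hρ) t ht

theorem hasDerivWithinAt_charac (w : IsHalfLineWave I a y h Z) (hθ : IsBumpFunction κ θ)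
    {t ρ ε : ℝ} (hε : ε ^ 2 = 1) (ht : t ∈ I) (hρ : a + κ < ρ) :
    HasDerivWithinAt (fun s => charac y Z θ ε s (ρ + ε * (s - t))) (mollify h θ t ρ) I t := by
  have hdd : ∀ r, _root_.deriv (_root_.deriv fun r => θ (r - ρ)) r =
      _root_.deriv (_root_.deriv θ) (r - ρ) := by
    intro r
    have : (_root_.deriv fun r => θ (r - ρ)) = fun r => _root_.deriv θ (r - ρ) :=
      funext fun r => deriv_comp_sub_const ..
    rw [this, deriv_comp_sub_const]
  have h1 : HasDerivWithinAt (fun s => charac y Z θ ε s ρ)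
      (mollify y (_root_.deriv (_root_.deriv θ)) t ρ + mollify h θ t ρ +
        ε * Z t fun r => _root_.deriv θ (r - ρ)) I t := by
    have h2 := w.hasDeriv_velocity _ (hθ.isTestOn hρ) t ht
    simp_rw [hdd] at h2
    exact h2.add ((w.hasDerivWithinAt_mollify hθ.deriv ht hρ).const_mul ε)
  have h3 := hasDerivWithinAt_along_line (ε := ε) ht hρ h1
    (M₁ := fun s r => (-Z s fun x => _root_.deriv θ (x - r)) +
      ε * -mollify y (_root_.deriv (_root_.deriv θ)) s r)
    (fun s hs r hr => (w.shift κ θ hθ s hs r hr).add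
      ((w.hasDerivAt_mollify hθ.deriv hs hr).const_mul ε))
    ((w.cont_shift κ _ hθ.deriv).neg.add
      ((continuousOn_mollify w.cont hθ.deriv.deriv).neg.const_smul ε))
  refine h3.congr_deriv ?_
  -- The terms in `deriv θ` cancel, and those in the second derivative of θ carry the factor 1 - ε².
  linear_combination (-mollify y (_root_.deriv (_root_.deriv θ)) t ρ) * hε

theorem hasDerivWithinAt_charac_line (w : IsHalfLineWave I a y h Z) (hθ : IsBumpFunction κ θ)
    {t s r ε : ℝ} (hε : ε ^ 2 = 1) (hs : s ∈ I) (hr : a + κ < r + ε * (s - t)) :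
    HasDerivWithinAt (fun σ => charac y Z θ ε σ (r + ε * (σ - t)))
      (mollify h θ s (r + ε * (s - t))) I s := by
  have := w.hasDerivWithinAt_charac hθ hε hs hr
  refine this.congr_of_mem (fun σ _ => ?_) hs
  congr 1; ring

/-- Finite speed of propagation. -/
theorem eq_zero_of_vanishing (w : IsHalfLineWave I a y h Z) (hI : I.OrdConnected) {t₀ R : ℝ}
    (ht₀ : t₀ ∈ I) (haR : a ≤ R) (hy : ∀ r, R < r → y t₀ r = 0)
    (hZ : ∀ θ, IsTestOn R θ → Z t₀ θ = 0) {t r : ℝ} (ht : t ∈ I) (hr : R + |t - t₀| < r) :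
    y t r = 0 := by
  set T := |t - t₀| with hT
  have hT0 : 0 ≤ T := abs_nonneg _
  obtain ⟨ρ₀, hρ₀, hρ₀r⟩ : ∃ ρ₀, R < ρ₀ ∧ ρ₀ + T < r :=
    ⟨(R + (r - T)) / 2, by linarith, by linarith⟩
  -- An upper cut-off. The region ρ₀ + |s - t₀| < x < r₂ - |s - t₀| contains (t, r), contains its
  -- own characteristics back to t₀, and lies in a compact set on which C is uniform.
  set r₂ := r + T + 1 with hr₂
  have hJ : Set.uIcc t₀ t ⊆ I := hI.uIcc_subset ht₀ ht
  set K := Set.uIcc t₀ t ×ˢ Set.Icc ρ₀ r₂ with hK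
  have hKsub : K ⊆ I ×ˢ Set.Ioi a := fun z hz => ⟨hJ hz.1, by
    have := hz.2.1; simp only [Set.mem_Ioi]; linarith⟩
  have hKc : IsCompact K := isCompact_uIcc.prod isCompact_Icc
  obtain ⟨C₁, hC₁⟩ := w.source_le K hKsub hKc
  obtain ⟨C, hC0, hC⟩ : ∃ C, 0 < C ∧ ∀ z ∈ K, |h z.1 z.2| ≤ C * |y z.1 z.2| :=
    ⟨max C₁ 1, by positivity, fun z hz => (hC₁ z hz).trans
      (mul_le_mul_of_nonneg_right (le_max_left _ _) (abs_nonneg _))⟩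
  obtain ⟨M₀, hM₀⟩ := hKc.exists_bound_of_continuousOn (w.cont.mono hKsub)
  have hM₀0 : 0 ≤ M₀ := (norm_nonneg _).trans (hM₀ (t₀, ρ₀)
    ⟨Set.left_mem_uIcc, le_rfl, by rw [hr₂]; linarith⟩)
  -- Two integrations in time cost 1/l each against the weight exp (l |s - t₀|), so l² = 2C gives
  -- the contraction factor C/l² = 1/2.
  set l := Real.sqrt (2 * C) with hl
  have hl0 : 0 < l := Real.sqrt_pos.2 (by linarith)
  have hl2 : l ^ 2 = 2 * C := Real.sq_sqrt (by linarith)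
  have hsT : ∀ s ∈ Set.uIcc t₀ t, |s - t₀| ≤ T := fun s hs => Set.abs_sub_left_of_mem_uIcc hs
  -- The bound on y bounds the source, hence both characteristic quantities, hence the velocity,
  -- hence y by a last integration in time. All this is done for a mollification at a scale κ so
  -- small that y changes by less than δ within distance κ of x, and δ is arbitrary.
  have step : ∀ M, 0 ≤ M → (∀ s ∈ Set.uIcc t₀ t, ∀ x, ρ₀ + |s - t₀| < x → x < r₂ - |s - t₀| →
        |y s x| ≤ M * Real.exp (l * |s - t₀|)) →
      ∀ s ∈ Set.uIcc t₀ t, ∀ x, ρ₀ + |s - t₀| < x → x < r₂ - |s - t₀| →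
        |y s x| ≤ M / 2 * Real.exp (l * |s - t₀|) := by
    intro M hM0 hM s hs x hx1 hx2
    refine le_of_forall_pos_le_add fun δ hδ => ?_
    have hax : a < x := by linarith [abs_nonneg (s - t₀)]
    have hcx : ContinuousAt (y s) x := by
      have h1 : ContinuousOn (fun r => Function.uncurry y (s, r)) (Set.Ioi a) :=
        w.cont.comp (by fun_prop) fun r hr => ⟨hJ hs, hr⟩
      exact h1.continuousAt (Ioi_mem_nhds hax)
    obtain ⟨δ', hδ', hyδ⟩ := Metric.continuousAt_iff.1 hcx δ hδ
    obtain ⟨κ, hκ, hκ1, hκ2, hκ3⟩ : ∃ κ, 0 < κ ∧ κ < δ' ∧ ρ₀ + κ + |s - t₀| < x ∧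
        x < r₂ - κ - |s - t₀| := by
      refine ⟨min (δ' / 2) (min ((x - (ρ₀ + |s - t₀|)) / 2) ((r₂ - |s - t₀| - x) / 2)), ?_, ?_, ?_, ?_⟩
      · exact lt_min (by linarith) (lt_min (by linarith) (by linarith))
      · exact (min_le_left _ _).trans_lt (by linarith)
      · have := (min_le_right (δ' / 2) _).trans (min_le_left ((x - (ρ₀ + |s - t₀|)) / 2)
          ((r₂ - |s - t₀| - x) / 2))
        linarith
      · have := (min_le_right (δ' / 2) _).trans (min_le_right ((x - (ρ₀ + |s - t₀|)) / 2)
          ((r₂ - |s - t₀| - x) / 2))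
        linarith
    have hη := isBumpFunction_unitBump hκ
    set η := unitBump κ hκ with hηdef
    have hchar : ∀ ε : ℝ, |ε| = 1 → ∀ s' ∈ Set.uIcc t₀ t, ∀ x', ρ₀ + κ + |s' - t₀| < x' →
        x' < r₂ - κ - |s' - t₀| →
        |charac y Z η ε s' x'| ≤ C * M / l * Real.exp (l * |s' - t₀|) := by
      intro ε hε s' hs' x' hx1' hx2'
      have hε2 : ε ^ 2 = 1 := by rw [← sq_abs, hε, one_pow]
      have hsub : Set.uIcc t₀ s' ⊆ Set.uIcc t₀ t := Set.uIcc_subset_uIcc_left hs'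
      -- On the way back to t₀ the line moves by |σ - s'| = |s' - t₀| - |σ - t₀|, which is exactly
      -- the room that the region gains.
      have hline : ∀ σ ∈ Set.uIcc t₀ s', ρ₀ + κ + |σ - t₀| < x' + ε * (σ - s') ∧
          x' + ε * (σ - s') < r₂ - κ - |σ - t₀| := by
        intro σ hσ
        have h1 := abs_sub_add_abs_sub_of_mem_uIcc hσ
        have h2 : |ε * (σ - s')| = |σ - s'| := by rw [abs_mul, hε, one_mul]
        have h3 := neg_abs_le (ε * (σ - s'))
        have h4 := le_abs_self (ε * (σ - s'))
        constructor <;> linarith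
      have hpos : ∀ σ ∈ Set.uIcc t₀ s', a + κ < x' + ε * (σ - s') := fun σ hσ => by
        linarith [(hline σ hσ).1, abs_nonneg (σ - t₀)]
      have key := abs_sub_le_exp (f := fun σ => charac y Z η ε σ (x' + ε * (σ - s')))
        (f' := fun σ => mollify h η σ (x' + ε * (σ - s'))) (t₀ := t₀) (t := s') (B := C * M)
        hl0 (by positivity)
        (fun σ hσ => (w.hasDerivWithinAt_charac_line hη hε2 (hJ (hsub hσ)) (hpos σ hσ)).mono
          (hsub.trans hJ))
        (fun σ hσ => abs_mollify_le hκ fun r' hr' => by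
          have h1 := hline σ hσ
          have h2 : ρ₀ + |σ - t₀| < r' := by linarith [hr'.1]
          have h3 : r' < r₂ - |σ - t₀| := by linarith [hr'.2]
          have h4 := abs_nonneg (σ - t₀)
          refine (hC (σ, r') ⟨hsub hσ, by linarith, by linarith⟩).trans ?_
          rw [mul_assoc]
          exact mul_le_mul_of_nonneg_left (hM σ (hsub hσ) r' h2 h3) hC0.le)
      have h0 : charac y Z η ε t₀ (x' + ε * (t₀ - s')) = 0 := by
        have h1 := (hline t₀ Set.left_mem_uIcc).1
        rw [sub_self, abs_zero, add_zero] at h1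
        rw [charac, hZ _ (hη.isTestOn (by linarith)),
          mollify_eq_zero hη.deriv fun r' hr' => hy r' (by linarith [hr'.1])]
        simp
      simp only [h0, sub_self, mul_zero, add_zero, sub_zero] at key
      exact key
    have hz : ∀ s' ∈ Set.uIcc t₀ t, ∀ x', ρ₀ + κ + |s' - t₀| < x' → x' < r₂ - κ - |s' - t₀| →
        |Z s' fun r => η (r - x')| ≤ C * M / l * Real.exp (l * |s' - t₀|) := by
      intro s' hs' x' h1 h2
      have e1 := hchar 1 (by simp) s' hs' x' h1 h2
      have e2 := hchar (-1) (by simp) s' hs' x' h1 h2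
      -- The half-sum of the two characteristic quantities is the velocity; the space derivative
      -- drops out.
      have e3 : (Z s' fun r => η (r - x')) =
          (charac y Z η 1 s' x' + charac y Z η (-1) s' x') / 2 := by
        simp only [charac]; ring
      rw [e3, abs_div, abs_two, div_le_iff₀ two_pos]
      exact (abs_add_le _ _).trans (by linarith)
    have hsub : Set.uIcc t₀ s ⊆ Set.uIcc t₀ t := Set.uIcc_subset_uIcc_left hs
    have key := abs_sub_le_exp (f := fun σ => mollify y η σ x)
      (f' := fun σ => Z σ fun r => η (r - x)) (t₀ := t₀) (t := s) (B := C * M / l) hl0 (by positivity)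
      (fun σ hσ => (w.hasDerivWithinAt_mollify hη (hJ (hsub hσ)) (by
        linarith [abs_nonneg (s - t₀)])).mono (hsub.trans hJ))
      (fun σ hσ => by
        have h1 := abs_sub_add_abs_sub_of_mem_uIcc hσ
        have h2 := abs_nonneg (σ - s)
        exact hz σ (hsub hσ) x (by linarith) (by linarith))
    have h0 : mollify y η t₀ x = 0 := mollify_eq_zero hη fun r' hr' => hy r' (by
      linarith [hr'.1, abs_nonneg (s - t₀)])
    simp only [h0, sub_zero] at key
    have happ : |mollify y η s x - y s x| ≤ δ := by
      refine abs_mollify_sub_le hκ (w.integrableOn_Icc (hJ hs) ?_) fun r' hr' => ?_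
      · linarith [abs_nonneg (s - t₀)]
      · refine (hyδ ?_).le
        rw [Real.dist_eq, abs_lt]; constructor <;> linarith [hr'.1, hr'.2]
    have hconst : C * M / l / l = M / 2 := by
      rw [div_div, ← sq, hl2]; field_simp
    rw [hconst] at key
    have h5 : |y s x| ≤ |mollify y η s x| + |mollify y η s x - y s x| := by
      have := abs_sub_abs_le_abs_sub (y s x) (mollify y η s x)
      rw [abs_sub_comm] at this; linarith
    linarith
  have all : ∀ n : ℕ, ∀ s ∈ Set.uIcc t₀ t, ∀ x, ρ₀ + |s - t₀| < x → x < r₂ - |s - t₀| →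
      |y s x| ≤ M₀ / 2 ^ n * Real.exp (l * |s - t₀|) := by
    intro n
    induction n with
    | zero =>
      intro s hs x h1 h2
      have h3 := abs_nonneg (s - t₀)
      have h4 := hM₀ (s, x) ⟨hs, by linarith, by linarith⟩
      rw [pow_zero, div_one]
      refine h4.trans (le_mul_of_one_le_right hM₀0 (Real.one_le_exp (by positivity)))
    | succ n ih =>
      have := step _ (by positivity) ih
      rwa [div_div, ← pow_succ] at this
  have hfin := nonpos_of_le_div_two_pow fun n => all n t Set.right_mem_uIcc r
    (by linarith) (by linarith)
  exact abs_eq_zero.1 (le_antisymm hfin (abs_nonneg _))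

end IsHalfLineWave


/-! ### Vanishing at one later and one earlier time forces vanishing in between. -/

namespace IsHalfLineWave

variable {I : Set ℝ} {a κ : ℝ} {y h : ℝ → ℝ → ℝ} {Z : ℝ → (ℝ → ℝ) → ℝ} {θ : ℝ → ℝ}

theorem continuousAt_snd (w : IsHalfLineWave I a y h Z) {s x : ℝ} (hs : s ∈ I) (hx : a < x) :
    ContinuousAt (y s) x := by
  have h1 : ContinuousOn (fun r => Function.uncurry y (s, r)) (Set.Ioi a) :=
    w.cont.comp (by fun_prop) fun r hr => ⟨hs, hr⟩
  exact h1.continuousAt (Ioi_mem_nhds hx)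

theorem charac_eq_zero (hθ : IsBumpFunction κ θ) {ε t ρ R : ℝ} (hy : ∀ r, R < r → y t r = 0)
    (hZ : ∀ θ, IsTestOn R θ → Z t θ = 0) (hρ : R + κ < ρ) : charac y Z θ ε t ρ = 0 := by
  rw [charac, hZ _ (hθ.isTestOn hρ),
    mollify_eq_zero hθ.deriv fun r' hr' => hy r' (by linarith [hr'.1])]
  simp

/-- A bound for the source bounds the variation of the characteristic quantities along their
lines. -/
theorem abs_charac_sub_le (w : IsHalfLineWave I a y h Z) {κ : ℝ} (hκ : 0 < κ) {ε s s' x B : ℝ}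
    (hε : ε ^ 2 = 1) (hI : Set.uIcc s s' ⊆ I)
    (hx : ∀ σ ∈ Set.uIcc s s', a + κ < x + ε * (σ - s))
    (hB : ∀ σ ∈ Set.uIcc s s', ∀ r ∈ Set.Icc (x + ε * (σ - s) - κ) (x + ε * (σ - s) + κ),
      |h σ r| ≤ B) :
    |charac y Z (unitBump κ hκ) ε s' (x + ε * (s' - s)) - charac y Z (unitBump κ hκ) ε s x| ≤
      B * |s' - s| := by
  have := Convex.norm_image_sub_le_of_norm_hasDerivWithin_le
    (f := fun σ => charac y Z (unitBump κ hκ) ε σ (x + ε * (σ - s)))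
    (f' := fun σ => mollify h (unitBump κ hκ) σ (x + ε * (σ - s))) (C := B)
    (s := Set.uIcc s s') (x := s) (y := s')
    (fun σ hσ => (w.hasDerivWithinAt_charac_line (isBumpFunction_unitBump hκ) hε (hI hσ)
      (hx σ hσ)).mono hI)
    (fun σ hσ => abs_mollify_le hκ (hB σ hσ)) (convex_uIcc _ _) Set.left_mem_uIcc
    Set.right_mem_uIcc
  simpa using this

/-- If a wave vanishes for `r > R₀ + |s - t₀|`, and moreover for `r > ρ₁ + |s - t₀|` at one time `t₁`
after and one time `t₂` before `t₀`, where `ρ₁ < R₀`, then at the times in between it vanishes for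
`r > ρ + |s - t₀|` with some `ρ < R₀`. -/
theorem exists_vanishing_of_two_times (w : IsHalfLineWave I a y h Z) {t₀ t₁ t₂ R₀ ρ₁ : ℝ}
    (hI : Set.Icc t₂ t₁ ⊆ I) (ht₁ : t₀ ≤ t₁) (ht₂ : t₂ ≤ t₀) (ha : a < ρ₁) (hρ₁ : ρ₁ < R₀)
    (hy : ∀ s ∈ Set.Icc t₂ t₁, ∀ r, R₀ + |s - t₀| < r → y s r = 0)
    (hy₁ : ∀ r, ρ₁ + |t₁ - t₀| < r → y t₁ r = 0)
    (hZ₁ : ∀ θ, IsTestOn (ρ₁ + |t₁ - t₀|) θ → Z t₁ θ = 0)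
    (hy₂ : ∀ r, ρ₁ + |t₂ - t₀| < r → y t₂ r = 0)
    (hZ₂ : ∀ θ, IsTestOn (ρ₁ + |t₂ - t₀|) θ → Z t₂ θ = 0) :
    ∃ ρ, ρ₁ ≤ ρ ∧ ρ < R₀ ∧ ∀ s ∈ Set.Icc t₂ t₁, ∀ r, ρ + |s - t₀| < r → y s r = 0 := by
  -- Adding 1 makes T positive even if t₁ = t₂, so that it may be divided by.
  set T := t₁ - t₂ + 1 with hT
  have hT0 : 0 < T := by linarith
  have hsT : ∀ s ∈ Set.Icc t₂ t₁, |s - t₀| ≤ T := fun s hs => by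
    rw [abs_le]; constructor <;> linarith [hs.1, hs.2]
  set K := Set.Icc t₂ t₁ ×ˢ Set.Icc ρ₁ (R₀ + T) with hK
  have hKsub : K ⊆ I ×ˢ Set.Ioi a := fun z hz => ⟨hI hz.1, ha.trans_le hz.2.1⟩
  have hKc : IsCompact K := isCompact_Icc.prod isCompact_Icc
  obtain ⟨C₁, hC₁⟩ := w.source_le K hKsub hKc
  obtain ⟨C, hC0, hC⟩ : ∃ C, 0 < C ∧ ∀ z ∈ K, |h z.1 z.2| ≤ C * |y z.1 z.2| :=
    ⟨max C₁ 1, by positivity, fun z hz => (hC₁ z hz).trans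
      (mul_le_mul_of_nonneg_right (le_max_left _ _) (abs_nonneg _))⟩
  -- Outside the compact set y is already zero, and `source_le` on a single point then gives h = 0
  -- there. One constant thus serves on the whole unbounded region.
  have hC' : ∀ s ∈ Set.Icc t₂ t₁, ∀ r, ρ₁ < r → |h s r| ≤ C * |y s r| := by
    intro s hs r hr
    rcases le_or_gt r (R₀ + T) with h1 | h1
    · exact hC (s, r) ⟨hs, hr.le, h1⟩
    · obtain ⟨C₂, hC₂⟩ := w.source_le {(s, r)} (by
        rintro z rfl; exact ⟨hI hs, ha.trans hr⟩) isCompact_singleton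
      have h2 := hC₂ (s, r) rfl
      simp only [hy s hs r (by linarith [hsT s hs]), abs_zero, mul_zero] at h2 ⊢
      exact h2
  obtain ⟨M₀, hM₀⟩ := hKc.exists_bound_of_continuousOn (w.cont.mono hKsub)
  have hM₀0 : 0 ≤ M₀ := (norm_nonneg _).trans (hM₀ (t₀, ρ₁)
    ⟨⟨ht₂, ht₁⟩, le_rfl, by linarith⟩)
  -- The slope of y will be at most 2CTM, and it acts over a strip of width R₀ - ρ. The choice makes
  -- the product at most M/2, whatever the size of T.
  obtain ⟨ρ, hρ₁ρ, hρR, hρC⟩ : ∃ ρ, ρ₁ ≤ ρ ∧ ρ < R₀ ∧ 2 * C * T * (R₀ - ρ) ≤ 1 / 2 := by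
    refine ⟨max ρ₁ (R₀ - 1 / (4 * C * T)), le_max_left _ _, max_lt hρ₁ ?_, ?_⟩
    · have : 0 < 1 / (4 * C * T) := by positivity
      linarith
    · have h1 : R₀ - max ρ₁ (R₀ - 1 / (4 * C * T)) ≤ 1 / (4 * C * T) := by
        linarith [le_max_right ρ₁ (R₀ - 1 / (4 * C * T))]
      refine (mul_le_mul_of_nonneg_left h1 (by positivity)).trans (le_of_eq ?_)
      field_simp; norm_num
  refine ⟨ρ, hρ₁ρ, hρR, ?_⟩
  have step : ∀ M, 0 ≤ M → (∀ s ∈ Set.Icc t₂ t₁, ∀ x, ρ + |s - t₀| < x → |y s x| ≤ M) →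
      ∀ s ∈ Set.Icc t₂ t₁, ∀ x, ρ + |s - t₀| < x → |y s x| ≤ M / 2 := by
    intro M hM0 hM s hs x hx
    rcases lt_or_ge (R₀ + |s - t₀|) x with hxR | hxR
    · rw [hy s hs x hxR, abs_zero]; positivity
    refine le_of_forall_pos_le_add fun δ hδ => ?_
    have habs := abs_nonneg (s - t₀)
    obtain ⟨δ', hδ', hyδ⟩ := Metric.continuousAt_iff.1
      (w.continuousAt_snd (hI hs) (show a < x by linarith)) δ hδ
    obtain ⟨κ, hκ, hκ1, hκ2⟩ : ∃ κ, 0 < κ ∧ κ < δ' ∧ ρ + κ + |s - t₀| < x := by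
      refine ⟨min (δ' / 2) ((x - (ρ + |s - t₀|)) / 2), lt_min (by linarith) (by linarith),
        (min_le_left _ _).trans_lt (by linarith), ?_⟩
      have := min_le_right (δ' / 2) ((x - (ρ + |s - t₀|)) / 2)
      linarith
    have hη := isBumpFunction_unitBump hκ
    set η := unitBump κ hκ with hηdef
    have hsrc : ∀ σ ∈ Set.Icc t₂ t₁, ∀ x', ρ + κ + |σ - t₀| < x' →
        ∀ r ∈ Set.Icc (x' - κ) (x' + κ), |h σ r| ≤ C * M := by
      intro σ hσ x' hx' r hr
      have h1 : ρ + |σ - t₀| < r := by linarith [hr.1]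
      exact (hC' σ hσ r (by linarith [abs_nonneg (σ - t₀)])).trans
        (mul_le_mul_of_nonneg_left (hM σ hσ r h1) hC0.le)
    -- The central step. The sign ε decides the time to aim for: t₁ if ε = 1, t₂ if ε = -1. In both
    -- cases the line is x' + |σ - t₀|, which runs outward, stays in the region where M is valid and
    -- ends where the characteristic quantity is zero. At t₀ it is therefore bounded by the source
    -- alone.
    have hzero : ∀ ε : ℝ, |ε| = 1 → ∀ x', ρ + κ < x' → |charac y Z η ε t₀ x'| ≤ C * M * T := by
      intro ε hε x' hx'
      obtain ⟨s', hs', hs'T, hline, hvan⟩ : ∃ s' ∈ Set.Icc t₂ t₁, |s' - t₀| ≤ T ∧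
          (∀ σ ∈ Set.uIcc t₀ s', ε * (σ - t₀) = |σ - t₀|) ∧
          ∀ z, ρ₁ + |s' - t₀| + κ < z → charac y Z η ε s' z = 0 := by
        rcases (abs_eq zero_le_one).1 hε with rfl | rfl
        · have hm : t₁ ∈ Set.Icc t₂ t₁ := ⟨ht₂.trans ht₁, le_rfl⟩
          refine ⟨t₁, hm, hsT _ hm, fun σ hσ => ?_, fun z hz => charac_eq_zero hη hy₁ hZ₁ hz⟩
          rw [Set.uIcc_of_le ht₁] at hσ
          rw [one_mul, abs_of_nonneg (by linarith [hσ.1])]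
        · have hm : t₂ ∈ Set.Icc t₂ t₁ := ⟨le_rfl, ht₂.trans ht₁⟩
          refine ⟨t₂, hm, hsT _ hm, fun σ hσ => ?_, fun z hz => charac_eq_zero hη hy₂ hZ₂ hz⟩
          rw [Set.uIcc_of_ge ht₂] at hσ
          rw [abs_of_nonpos (by linarith [hσ.2])]; ring
      have hsub : Set.uIcc t₀ s' ⊆ Set.Icc t₂ t₁ :=
        Set.OrdConnected.uIcc_subset Set.ordConnected_Icc ⟨ht₂, ht₁⟩ hs'
      have hε2 : ε ^ 2 = 1 := by rw [← sq_abs, hε, one_pow]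
      have h1 := w.abs_charac_sub_le hκ (ε := ε) (s := t₀) (s' := s') (x := x') (B := C * M) hε2
        (hsub.trans hI)
        (fun σ hσ => by rw [hline σ hσ]; linarith [abs_nonneg (σ - t₀)])
        (fun σ hσ => hsrc σ (hsub hσ) _ (by rw [hline σ hσ]; linarith))
      rw [hvan _ (by rw [hline _ Set.right_mem_uIcc]; linarith), zero_sub, abs_neg] at h1
      exact h1.trans (mul_le_mul_of_nonneg_left hs'T (by positivity))
    -- The line through (s, x') is followed to t₀ without leaving the region; this costs another C M
    -- T on top of the bound at t₀.
    have hchar : ∀ ε : ℝ, |ε| = 1 → ∀ x', ρ + κ + |s - t₀| < x' →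
        |charac y Z η ε s x'| ≤ 2 * (C * M * T) := by
      intro ε hε x' hx'
      have hε2 : ε ^ 2 = 1 := by rw [← sq_abs, hε, one_pow]
      have hsub : Set.uIcc s t₀ ⊆ Set.Icc t₂ t₁ :=
        Set.OrdConnected.uIcc_subset Set.ordConnected_Icc hs ⟨ht₂, ht₁⟩
      have hline : ∀ σ ∈ Set.uIcc s t₀, ρ + κ + |σ - t₀| < x' + ε * (σ - s) := by
        intro σ hσ
        rw [Set.uIcc_comm] at hσ
        have h1 := abs_sub_add_abs_sub_of_mem_uIcc hσ
        have h2 : |ε * (σ - s)| = |σ - s| := by rw [abs_mul, hε, one_mul]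
        have h3 := neg_abs_le (ε * (σ - s))
        linarith
      have h1 := w.abs_charac_sub_le hκ (ε := ε) (s := s) (s' := t₀) (x := x') (B := C * M) hε2
        (hsub.trans hI)
        (fun σ hσ => by linarith [abs_nonneg (σ - t₀), hline σ hσ])
        (fun σ hσ => hsrc σ (hsub hσ) _ (hline σ hσ))
      have h2 := hzero ε hε (x' + ε * (t₀ - s)) (by
        have := hline t₀ Set.right_mem_uIcc
        rwa [sub_self, abs_zero, add_zero] at this)
      have h3 : C * M * |t₀ - s| ≤ C * M * T := by
        rw [abs_sub_comm]; exact mul_le_mul_of_nonneg_left (hsT s hs) (by positivity)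
      have h4 := abs_sub_abs_le_abs_sub (charac y Z η ε s x')
        (charac y Z η ε t₀ (x' + ε * (t₀ - s)))
      rw [abs_sub_comm] at h4
      linarith
    have hgrad : ∀ x', ρ + κ + |s - t₀| < x' →
        |mollify y (_root_.deriv η) s x'| ≤ 2 * (C * M * T) := by
      intro x' hx'
      have e1 := hchar 1 (by simp) x' hx'
      have e2 := hchar (-1) (by simp) x' hx'
      have e3 : mollify y (_root_.deriv η) s x' =
          (charac y Z η 1 s x' - charac y Z η (-1) s x') / 2 := by
        simp only [charac]; ring
      rw [e3, abs_div, abs_two, div_le_iff₀ two_pos]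
      exact (abs_sub _ _).trans (by linarith)
    -- A point at which the mollification is known to vanish, placed so that X - x is exactly R₀ - ρ
    -- and the scale κ does not enter the estimate.
    set X := R₀ + |s - t₀| + κ + (x - (ρ + κ + |s - t₀|)) with hX
    have hxX : x ≤ X := by linarith
    have hmX : mollify y η s X = 0 := mollify_eq_zero hη fun r hr => hy s hs r (by linarith [hr.1])
    have key := Convex.norm_image_sub_le_of_norm_hasDerivWithin_le (f := mollify y η s)
      (f' := fun r => -mollify y (_root_.deriv η) s r) (C := 2 * (C * M * T)) (s := Set.Icc x X)
      (x := X) (y := x)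
      (fun r hr => (w.hasDerivAt_mollify hη (hI hs) (by linarith [hr.1])).hasDerivWithinAt)
      (fun r hr => by rw [norm_neg]; exact hgrad r (by linarith [hr.1]))
      (convex_Icc _ _) ⟨hxX, le_rfl⟩ ⟨le_rfl, hxX⟩
    have hXx : X - x = R₀ - ρ := by rw [hX]; ring
    rw [hmX, sub_zero, Real.norm_eq_abs, Real.norm_eq_abs, abs_sub_comm, hXx,
      abs_of_pos (by linarith : 0 < R₀ - ρ)] at key
    have happ : |mollify y η s x - y s x| ≤ δ := by
      refine abs_mollify_sub_le hκ (w.integrableOn_Icc (hI hs) (by linarith)) fun r' hr' => ?_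
      refine (hyδ ?_).le
      rw [Real.dist_eq, abs_lt]; constructor <;> linarith [hr'.1, hr'.2]
    have h5 : |y s x| ≤ |mollify y η s x| + |mollify y η s x - y s x| := by
      have := abs_sub_abs_le_abs_sub (y s x) (mollify y η s x)
      rw [abs_sub_comm] at this; linarith
    have h6 : 2 * (C * M * T) * (R₀ - ρ) ≤ M / 2 := by
      have := mul_le_mul_of_nonneg_right hρC hM0
      linarith
    linarith
  have all : ∀ n : ℕ, ∀ s ∈ Set.Icc t₂ t₁, ∀ x, ρ + |s - t₀| < x → |y s x| ≤ M₀ / 2 ^ n := by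
    intro n
    induction n with
    | zero =>
      intro s hs x hx
      rw [pow_zero, div_one]
      rcases lt_or_ge (R₀ + |s - t₀|) x with hxR | hxR
      · rw [hy s hs x hxR]; simpa using hM₀0
      · exact hM₀ (s, x) ⟨hs, by linarith [abs_nonneg (s - t₀)], by linarith [hsT s hs]⟩
    | succ n ih =>
      have := step _ (by positivity) ih
      rwa [div_div, ← pow_succ] at this
  intro s hs r hr
  refine abs_eq_zero.1 (le_antisymm (nonpos_of_le_div_two_pow (M := M₀) (E := 1) fun n => ?_)
    (abs_nonneg _))
  rw [mul_one]
  exact all n s hs r hr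

end IsHalfLineWave


/-! ### Radial test functions and radial calculus in ℝ³. -/

namespace IsTestOn

variable {a b : ℝ} {θ : ℝ → ℝ}

theorem mono (h : IsTestOn b θ) (hab : a ≤ b) : IsTestOn a θ :=
  ⟨h.1, h.2.1, h.2.2.trans (Set.Ioi_subset_Ioi hab)⟩

theorem deriv (h : IsTestOn a θ) : IsTestOn a (deriv θ) :=
  ⟨(contDiff_infty_iff_deriv.1 h.1).2, h.2.1.deriv, tsupport_deriv_subset.trans h.2.2⟩

theorem eq_zero (h : IsTestOn a θ) {r : ℝ} (hr : r ≤ a) : θ r = 0 :=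
  image_eq_zero_of_notMem_tsupport fun h' => absurd (h.2.2 h') (not_lt.2 hr)

theorem continuous (h : IsTestOn a θ) : Continuous θ := h.1.continuous

theorem differentiable (h : IsTestOn a θ) : Differentiable ℝ θ := h.1.differentiable (by simp)

theorem mul_left (h : IsTestOn a θ) {A : ℝ → ℝ} (hA : ContDiffOn ℝ (⊤ : ℕ∞) A (Set.Ioi a)) :
    IsTestOn a fun r => A r * θ r := by
  refine ⟨contDiff_iff_contDiffAt.2 fun r => ?_, h.2.1.mul_left,
    (tsupport_mul_subset_right (f := A) (g := θ)).trans h.2.2⟩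
  by_cases hr : r ∈ tsupport θ
  · exact (hA.contDiffAt (Ioi_mem_nhds (h.2.2 hr))).mul h.1.contDiffAt
  · refine contDiffAt_const (c := (0 : ℝ)) |>.congr_of_eventuallyEq ?_
    filter_upwards [(isClosed_tsupport θ).isOpen_compl.mem_nhds hr] with x hx
    rw [image_eq_zero_of_notMem_tsupport hx, mul_zero]

theorem div_pow (h : IsTestOn a θ) (ha : 0 ≤ a) (k : ℕ) : IsTestOn a fun r => θ r / r ^ k := by
  have : (fun r => θ r / r ^ k) = fun r => (r ^ k)⁻¹ * θ r := by
    funext r; rw [div_eq_inv_mul]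
  rw [this]
  exact h.mul_left ((contDiffOn_id.pow k).inv fun r hr => pow_ne_zero _ (ha.trans_lt hr).ne')

theorem exists_tsupport_subset_Icc (h : IsTestOn a θ) :
    ∃ c d, a < c ∧ c < d ∧ tsupport θ ⊆ Set.Icc c d := by
  have hK : IsCompact (tsupport θ) := h.2.1
  obtain ⟨B, hB⟩ := hK.isBounded.subset_closedBall 0
  rcases (tsupport θ).eq_empty_or_nonempty with h0 | h0
  · exact ⟨a + 1, a + 2, by linarith, by linarith, by simp [h0]⟩
  · obtain ⟨c, hc, hmin⟩ := hK.exists_isMinOn h0 continuous_id.continuousOn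
    refine ⟨c, max (c + 1) B, h.2.2 hc, by simp, fun r hr => ⟨hmin hr, ?_⟩⟩
    have := hB hr
    rw [Metric.mem_closedBall, dist_zero_right, Real.norm_eq_abs] at this
    exact (le_abs_self r).trans (this.trans (le_max_right _ _))

theorem exists_Icc (h : IsTestOn a θ) :
    ∃ c d, a < c ∧ c < d ∧ ∀ r, r ∉ Set.Icc c d → θ r = 0 := by
  obtain ⟨c, d, h1, h2, h3⟩ := h.exists_tsupport_subset_Icc
  exact ⟨c, d, h1, h2, fun r hr => image_eq_zero_of_notMem_tsupport fun h => hr (h3 h)⟩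

/-- The support of θ keeps a positive distance from 0, so the composite vanishes near the origin,
where the norm is not smooth. -/
theorem contDiff_norm (h : IsTestOn a θ) (ha : 0 ≤ a) :
    ContDiff ℝ (⊤ : ℕ∞) fun x : E3 => θ ‖x‖ := by
  refine contDiff_iff_contDiffAt.2 fun x => ?_
  rcases eq_or_ne x 0 with rfl | hx
  · refine contDiffAt_const (c := (0 : ℝ)) |>.congr_of_eventuallyEq ?_
    obtain ⟨c, d, h1, h2, h3⟩ := h.exists_Icc
    filter_upwards [Metric.ball_mem_nhds (0 : E3) (ha.trans_lt h1)] with x hx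
    rw [mem_ball_zero_iff] at hx
    exact h3 _ fun h' => absurd h'.1 (not_le.2 hx)
  · exact h.1.contDiffAt.comp x (contDiffAt_norm ℝ hx)

theorem tsupport_norm_subset (h : IsTestOn a θ) : tsupport (fun x : E3 => θ ‖x‖) ⊆ exterior a :=
  fun _ hx => h.2.2 (tsupport_comp_subset_preimage θ continuous_norm hx)

theorem hasCompactSupport_norm (h : IsTestOn a θ) : HasCompactSupport fun x : E3 => θ ‖x‖ := by
  obtain ⟨c, d, h1, h2, h3⟩ := h.exists_Icc
  refine HasCompactSupport.of_support_subset_isCompact (isCompact_closedBall (0 : E3) d)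
    fun x hx => ?_
  rw [mem_closedBall_zero_iff]
  by_contra hd
  exact hx (h3 _ fun h' => hd h'.2)

end IsTestOn

section RadialCalculus

theorem hasFDerivAt_norm {x : E3} (hx : x ≠ 0) :
    HasFDerivAt (fun y : E3 => ‖y‖) (‖x‖⁻¹ • innerSL ℝ x) x := by
  have h1 := (hasStrictFDerivAt_norm_sq x).hasFDerivAt.sqrt (pow_ne_zero 2 (norm_ne_zero_iff.2 hx))
  simp only [Real.sqrt_sq (norm_nonneg _)] at h1
  refine h1.congr_fderiv ?_
  ext v
  have : ‖x‖ ≠ 0 := norm_ne_zero_iff.2 hx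
  simp
  field_simp

theorem hasFDerivAt_comp_norm {A : ℝ → ℝ} {A' : ℝ} {x : E3} (hx : x ≠ 0)
    (hA : HasDerivAt A A' ‖x‖) :
    HasFDerivAt (fun y : E3 => A ‖y‖) ((A' / ‖x‖) • innerSL ℝ x) x := by
  refine (hA.comp_hasFDerivAt x (hasFDerivAt_norm hx)).congr_fderiv ?_
  rw [smul_smul, div_eq_mul_inv]

theorem fderiv_comp_norm_mul_inner {A : ℝ → ℝ} {A' : ℝ} {x : E3} (hx : x ≠ 0)
    (hA : HasDerivAt A A' ‖x‖) (v : E3) :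
    fderiv ℝ (fun y : E3 => A ‖y‖ * inner ℝ y v) x v =
      A' / ‖x‖ * inner ℝ x v ^ 2 + A ‖x‖ * ‖v‖ ^ 2 := by
  have h1 : HasFDerivAt (fun y : E3 => inner ℝ y v) (innerSL ℝ v) x := by
    have := (innerSL ℝ v).hasFDerivAt (x := x)
    refine this.congr_of_eventuallyEq (Eventually.of_forall fun y => ?_)
    simp [real_inner_comm]
  have h2 : HasFDerivAt (fun y : E3 => A ‖y‖ * inner ℝ y v) _ x :=
    (hasFDerivAt_comp_norm hx hA).mul h1
  rw [h2.fderiv]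
  simp
  ring

/-- The divergence of the radial field `A(|x|) x`. -/
theorem sum_fderiv_comp_norm_mul_inner {A : ℝ → ℝ} {A' : ℝ} {x : E3} (hx : x ≠ 0)
    (hA : HasDerivAt A A' ‖x‖) :
    ∑ i, fderiv ℝ (fun y : E3 => A ‖y‖ * inner ℝ y (stdOrthonormalBasis ℝ E3 i)) x
      (stdOrthonormalBasis ℝ E3 i) = A' * ‖x‖ + 3 * A ‖x‖ := by
  simp_rw [fderiv_comp_norm_mul_inner hx hA]
  rw [Finset.sum_add_distrib, ← Finset.mul_sum, OrthonormalBasis.sum_sq_inner_left]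
  have : ‖x‖ ≠ 0 := norm_ne_zero_iff.2 hx
  simp
  field_simp

/-- The Laplacian of `f(|x|)/|x|` is `f''(|x|)/|x|`. -/
theorem laplacian_comp_norm_div_norm {f : ℝ → ℝ} {x : E3} (hx : x ≠ 0)
    (hf : ContDiffAt ℝ 2 f ‖x‖) :
    Laplacian.laplacian (fun y : E3 => f ‖y‖ / ‖y‖) x = deriv (deriv f) ‖x‖ / ‖x‖ := by
  have hx0 : ‖x‖ ≠ 0 := norm_ne_zero_iff.2 hx
  have hcd : ContDiffAt ℝ 2 (fun y : E3 => f ‖y‖ / ‖y‖) x :=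
    (hf.comp x (contDiffAt_norm ℝ hx)).div (contDiffAt_norm ℝ hx) hx0
  have hfe : ∀ᶠ r in 𝓝 ‖x‖, HasDerivAt f (deriv f r) r := by
    filter_upwards [hf.eventually (by simp)] with r hr
    exact (hr.differentiableAt (by simp)).hasDerivAt
  have hd2 : HasDerivAt (deriv f) (deriv (deriv f) ‖x‖) ‖x‖ := by
    have : ContDiffAt ℝ 1 (deriv f) ‖x‖ := hf.derivWithin (by norm_num)
    exact (this.differentiableAt (by simp)).hasDerivAt
  set B : ℝ → ℝ := fun r => (deriv f r * r - f r) / r ^ 2 / r with hB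
  have hBd : HasDerivAt B ((deriv (deriv f) ‖x‖ * ‖x‖ ^ 2 - 3 * (deriv f ‖x‖ * ‖x‖ - f ‖x‖)) /
      ‖x‖ ^ 4) ‖x‖ := by
    have h1 := (((hd2.mul (hasDerivAt_id ‖x‖)).sub hfe.self_of_nhds).div
      ((hasDerivAt_id ‖x‖).pow 2) (pow_ne_zero 2 hx0)).div (hasDerivAt_id ‖x‖) hx0
    refine h1.congr_deriv ?_
    simp
    field_simp
    ring
  have hfd : ∀ᶠ y in 𝓝 x, fderiv ℝ (fun y : E3 => f ‖y‖ / ‖y‖) y = B ‖y‖ • innerSL ℝ y := by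
    filter_upwards [continuous_norm.continuousAt.eventually hfe,
      isOpen_ne.mem_nhds hx] with y hy hy0
    have hy0' : ‖y‖ ≠ 0 := norm_ne_zero_iff.2 hy0
    have h1 := hasFDerivAt_comp_norm hy0 (hy.div (hasDerivAt_id ‖y‖) hy0')
    simp only [id, mul_one] at h1
    exact h1.fderiv
  have hdd : DifferentiableAt ℝ (fderiv ℝ fun y : E3 => f ‖y‖ / ‖y‖) x :=
    (hcd.fderiv_right (m := 1) (by norm_num)).differentiableAt (by simp)
  rw [InnerProductSpace.laplacian_eq_iteratedFDeriv_stdOrthonormalBasis]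
  have h2 : ∀ v : E3, iteratedFDeriv ℝ 2 (fun y : E3 => f ‖y‖ / ‖y‖) x ![v, v] =
      fderiv ℝ (fun y : E3 => B ‖y‖ * inner ℝ y v) x v := by
    intro v
    rw [iteratedFDeriv_two_apply]
    simp only [Matrix.cons_val_zero, Matrix.cons_val_one]
    have h3 : fderiv ℝ (fun y => fderiv ℝ (fun y : E3 => f ‖y‖ / ‖y‖) y v) x v =
        fderiv ℝ (fderiv ℝ fun y : E3 => f ‖y‖ / ‖y‖) x v v := by
      rw [fderiv_clm_apply hdd (differentiableAt_const v)]
      simp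
    rw [← h3]
    congr 1
    refine Filter.EventuallyEq.fderiv_eq ?_
    filter_upwards [hfd] with y hy
    rw [hy]; simp
  simp_rw [h2]
  rw [sum_fderiv_comp_norm_mul_inner hx hBd]
  simp only [hB]
  field_simp
  ring

end RadialCalculus


section RadialTest

variable {a : ℝ} {θ : ℝ → ℝ}

/-- The test function `θ(|x|)/|x|` on `ℝ³`. -/
def radialTest (h : IsTestOn a θ) (ha : 0 ≤ a) : 𝓢(E3, ℂ) :=
  HasCompactSupport.toSchwartzMap (f := fun x : E3 => ((θ ‖x‖ / ‖x‖ : ℝ) : ℂ))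
    (by
      have := (h.div_pow ha 1).hasCompactSupport_norm
      simp only [pow_one] at this
      exact this.comp_left (g := fun r : ℝ => (r : ℂ)) Complex.ofReal_zero)
    (by
      have := (h.div_pow ha 1).contDiff_norm ha
      simp only [pow_one] at this
      exact Complex.ofRealCLM.contDiff.comp this)

theorem radialTest_apply (h : IsTestOn a θ) (ha : 0 ≤ a) (x : E3) :
    radialTest h ha x = ((θ ‖x‖ / ‖x‖ : ℝ) : ℂ) := rfl

theorem support_radialTest_subset (h : IsTestOn a θ) (ha : 0 ≤ a) :
    Function.support (radialTest h ha) ⊆ Function.support fun x : E3 => θ ‖x‖ := by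
  intro x hx h0
  refine hx ?_
  simp only [radialTest_apply]
  simp only at h0
  rw [h0]; simp

theorem tsupport_radialTest_subset (h : IsTestOn a θ) (ha : 0 ≤ a) :
    tsupport (radialTest h ha) ⊆ exterior a :=
  (closure_mono (support_radialTest_subset h ha)).trans h.tsupport_norm_subset

theorem hasCompactSupport_radialTest (h : IsTestOn a θ) (ha : 0 ≤ a) :
    HasCompactSupport (radialTest h ha) :=
  h.hasCompactSupport_norm.mono (support_radialTest_subset h ha)

theorem laplacian_radialTest (h : IsTestOn a θ) (ha : 0 ≤ a) :
    Laplacian.laplacian (radialTest h ha) = radialTest h.deriv.deriv ha := by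
  ext x
  rw [SchwartzMap.laplacian_apply]
  rcases eq_or_ne x 0 with rfl | hx
  · have h1 : (radialTest h ha : E3 → ℂ) =ᶠ[𝓝 0] fun _ => 0 := by
      obtain ⟨c, d, h1, h2, h3⟩ := h.exists_Icc
      filter_upwards [Metric.ball_mem_nhds (0 : E3) (ha.trans_lt h1)] with x hx
      rw [mem_ball_zero_iff] at hx
      rw [radialTest_apply, h3 _ fun h' => absurd h'.1 (not_le.2 hx)]
      simp
    rw [(InnerProductSpace.laplacian_congr_nhds h1).self_of_nhds]
    simp [radialTest_apply]
  · have hcd : ContDiffAt ℝ 2 (fun y : E3 => θ ‖y‖ / ‖y‖) x :=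
      ((h.1.of_le (by norm_cast)).contDiffAt.comp x (contDiffAt_norm ℝ hx)).div
        (contDiffAt_norm ℝ hx) (norm_ne_zero_iff.2 hx)
    have h2 := hcd.laplacian_CLM_comp_left (l := Complex.ofRealCLM)
    have h3 : (radialTest h ha : E3 → ℂ) = Complex.ofRealCLM ∘ fun y : E3 => θ ‖y‖ / ‖y‖ := rfl
    rw [h3, h2, Function.comp_apply,
      laplacian_comp_norm_div_norm hx (h.1.of_le (by norm_cast)).contDiffAt]
    rfl

end RadialTest

/-! ### Polar coordinates. -/

section Polar

/-- The area `4π` of the unit sphere of `ℝ³`. -/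
def sphereArea : ℝ := 3 * volume.real (Metric.ball (0 : E3) 1)

theorem sphereArea_pos : 0 < sphereArea :=
  mul_pos three_pos (ENNReal.toReal_pos (Metric.measure_ball_pos volume _ one_pos).ne'
    measure_ball_lt_top.ne)

theorem integral_comp_norm (f : ℝ → ℝ) :
    ∫ x : E3, f ‖x‖ = sphereArea * ∫ r in Set.Ioi (0 : ℝ), r ^ 2 * f r := by
  rw [integral_fun_norm_addHaar volume f, sphereArea]
  simp [mul_assoc]

theorem integrable_comp_norm_iff {f : ℝ → ℝ} :
    Integrable (fun x : E3 => f ‖x‖) ↔ IntegrableOn (fun r : ℝ => r ^ 2 * f r) (Set.Ioi 0) := by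
  rw [integrable_fun_norm_addHaar volume (f := f)]
  simp

/-- The indicator of a measurable null set that contains the bad radii has radial integral zero.
Polar coordinates give integral zero over ℝ³, and a nonnegative function with integral zero vanishes
almost everywhere. The origin is discarded separately. -/
theorem ae_comp_norm {P : ℝ → Prop} (h : ∀ᵐ r : ℝ, 0 < r → P r) : ∀ᵐ x : E3, P ‖x‖ := by
  set N := toMeasurable volume {r : ℝ | ¬ (0 < r → P r)} with hN
  have hN0 : volume N = 0 := by rw [measure_toMeasurable]; exact h
  set f : ℝ → ℝ := N.indicator 1 with hf
  have hfm : Measurable f := measurable_one.indicator (measurableSet_toMeasurable _ _)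
  have hf0 : ∀ᵐ r : ℝ ∂volume.restrict (Set.Ioi 0), r ^ 2 * f r = 0 := by
    refine ae_restrict_of_ae ?_
    filter_upwards [measure_eq_zero_iff_ae_notMem.1 hN0] with r hr
    rw [hf, Set.indicator_of_notMem hr, mul_zero]
  have hi : Integrable fun x : E3 => f ‖x‖ :=
    integrable_comp_norm_iff.2 ((integrable_congr hf0).2 (integrable_zero _ _ _))
  have hz : ∫ x : E3, f ‖x‖ = 0 := by
    rw [integral_comp_norm, integral_congr_ae hf0]; simp
  have hnn : ∀ r, 0 ≤ f r := fun r => Set.indicator_nonneg (fun _ _ => zero_le_one) r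
  have h0 := (integral_eq_zero_iff_of_nonneg (fun x : E3 => hnn ‖x‖) hi).1 hz
  filter_upwards [h0, measure_eq_zero_iff_ae_notMem.1 (measure_singleton (μ := volume) (0 : E3))]
    with x hx hx0
  by_contra hP
  have hmem : ‖x‖ ∈ N := subset_toMeasurable _ _ fun h' => hP (h' (norm_pos_iff.2 hx0))
  simp [hf, Set.indicator_of_mem hmem] at hx

/-- Polar coordinates for the pairing with `θ(|x|)/|x|`. -/
theorem integral_comp_norm_mul_div {θ : ℝ → ℝ} (h : ∀ r ≤ 0, θ r = 0) (g : ℝ → ℝ) :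
    ∫ x : E3, θ ‖x‖ / ‖x‖ * g ‖x‖ = sphereArea * ∫ r, r * g r * θ r := by
  rw [integral_comp_norm fun r => θ r / r * g r]
  congr 1
  rw [← setIntegral_eq_integral_of_forall_compl_eq_zero (s := Set.Ioi 0) (μ := volume)
    (f := fun r => r * g r * θ r) fun r hr => by rw [h r (not_lt.1 hr), mul_zero]]
  refine setIntegral_congr_fun measurableSet_Ioi fun r hr => ?_
  have : r ≠ 0 := (Set.mem_Ioi.1 hr).ne'
  field_simp

end Polar

/-! ### The stationary profile as a function of r. -/

section Profile

variable {a RW : ℝ} {θ : ℝ → ℝ} {W : E3 → ℝ}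

theorem integral_mul_deriv {f : ℝ → ℝ} (hf : ContDiffOn ℝ 1 f (Set.Ioi a)) (h : IsTestOn a θ) :
    ∫ r, f r * deriv θ r = -∫ r, deriv f r * θ r := by
  obtain ⟨c, d, hac, hcd, h0⟩ := h.exists_tsupport_subset_Icc
  have hs : ∀ {k : ℝ → ℝ}, tsupport k ⊆ Set.Icc c d → ∀ g : ℝ → ℝ,
      ∫ r, g r * k r = ∫ r in ((a + c) / 2)..(d + 1), g r * k r := by
    intro k hk g
    rw [intervalIntegral.integral_of_le (by linarith),
      setIntegral_eq_integral_of_forall_compl_eq_zero]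
    intro r hr
    rw [image_eq_zero_of_notMem_tsupport (f := k) fun h' => hr ?_, mul_zero]
    have := hk h'
    constructor <;> linarith [this.1, this.2]
  rw [hs (tsupport_deriv_subset.trans h0), hs h0]
  have hsub : Set.uIcc ((a + c) / 2) (d + 1) ⊆ Set.Ioi a := by
    rw [Set.uIcc_of_le (by linarith)]
    intro r hr; simp only [Set.mem_Ioi]; linarith [hr.1]
  have hz : ∀ r, r ∉ Set.Icc c d → θ r = 0 := fun r hr =>
    image_eq_zero_of_notMem_tsupport fun h' => hr (h0 h')
  rw [intervalIntegral.integral_mul_deriv_eq_deriv_mul (u' := deriv f)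
    (fun r hr => ((hf.contDiffAt (Ioi_mem_nhds (hsub hr))).differentiableAt
      (by simp)).hasDerivAt)
    (fun r _ => (h.differentiable r).hasDerivAt)
    (((hf.continuousOn_deriv_of_isOpen isOpen_Ioi le_rfl).mono hsub).intervalIntegrable)
    h.deriv.continuous.continuousOn.intervalIntegrable,
    hz (d + 1) fun h' => by linarith [h'.2], hz ((a + c) / 2) fun h' => by linarith [h'.1]]
  ring

theorem integral_mul_deriv_deriv {f : ℝ → ℝ} (hf : ContDiffOn ℝ 2 f (Set.Ioi a))
    (h : IsTestOn a θ) : ∫ r, f r * deriv (deriv θ) r = ∫ r, deriv (deriv f) r * θ r := by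
  rw [integral_mul_deriv (hf.of_le (by norm_num)) h.deriv,
    integral_mul_deriv (hf.deriv_of_isOpen isOpen_Ioi (by norm_num)) h, neg_neg]

/-- The function `w` with `W(x) = w(|x|)`. -/
def profile (W : E3 → ℝ) (r : ℝ) : ℝ := W (r • EuclideanSpace.single 0 1)

theorem norm_smul_single {r : ℝ} (hr : 0 ≤ r) :
    ‖r • (EuclideanSpace.single 0 1 : E3)‖ = r := by
  rw [norm_smul, PiLp.norm_single, norm_one, mul_one, Real.norm_of_nonneg hr]

theorem IsRadialProfile.eq_profile (hW : IsRadialProfile RW W) {x : E3}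
    (hx : x ∈ exterior RW) : W x = profile W ‖x‖ :=
  hW.radial x hx _ (by
    show RW < _
    rw [norm_smul_single (norm_nonneg _)]; exact hx) (norm_smul_single (norm_nonneg _)).symm

theorem IsRadialProfile.contDiffOn_profile (hRW : 0 ≤ RW) (hW : IsRadialProfile RW W) :
    ContDiffOn ℝ 2 (profile W) (Set.Ioi RW) := by
  refine hW.contDiffOn.comp (ContDiff.contDiffOn (by fun_prop)) fun r hr => ?_
  show RW < _
  rw [norm_smul_single (hRW.trans (le_of_lt hr))]; exact hr

/-- Near the point, W is f(|x|)/|x| with f = r w, and the Laplacian of such a function is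
f''(|x|)/|x|. -/
theorem IsRadialProfile.deriv_deriv_profile (hRW : 0 ≤ RW) (hW : IsRadialProfile RW W)
    {F : ℝ → ℝ → ℝ} (hFW : SolvesElliptic RW F W) {r : ℝ} (hr : RW < r) :
    deriv (deriv fun r => r * profile W r) r = -(r * F r (profile W r)) := by
  have hr0 : 0 < r := hRW.trans_lt hr
  set x : E3 := r • EuclideanSpace.single 0 1 with hx
  have hxr : ‖x‖ = r := norm_smul_single hr0.le
  have hxe : x ∈ exterior RW := by show RW < _; rwa [hxr]
  have hx0 : x ≠ 0 := norm_pos_iff.1 (by rwa [hxr])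
  have h1 := hFW x hxe
  have hcong : W =ᶠ[𝓝 x] fun y => (fun r => r * profile W r) ‖y‖ / ‖y‖ := by
    have ho : IsOpen (exterior RW) := isOpen_lt continuous_const continuous_norm
    filter_upwards [ho.mem_nhds hxe, isOpen_ne.mem_nhds hx0] with y hy hy0
    have : ‖y‖ ≠ 0 := norm_ne_zero_iff.2 hy0
    rw [hW.eq_profile hy]
    field_simp
  rw [(InnerProductSpace.laplacian_congr_nhds hcong).self_of_nhds,
    laplacian_comp_norm_div_norm (f := fun r => r * profile W r) hx0 (by
    rw [hxr]
    exact contDiffAt_id.mul ((hW.contDiffOn_profile hRW).contDiffAt (Ioi_mem_nhds hr))),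
    hW.eq_profile hxe, hxr] at h1
  field_simp at h1
  linarith

theorem IsRadialProfile.integral_profile_mul_deriv_deriv (hRW : 0 ≤ RW)
    (hW : IsRadialProfile RW W) {F : ℝ → ℝ → ℝ} (hFW : SolvesElliptic RW F W)
    (h : IsTestOn RW θ) :
    ∫ r, r * profile W r * deriv (deriv θ) r = -∫ r, r * F r (profile W r) * θ r := by
  rw [integral_mul_deriv_deriv (f := fun r => r * profile W r)
    (contDiffOn_id.mul (hW.contDiffOn_profile hRW)) h, ← integral_neg]
  refine integral_congr_ae (Eventually.of_forall fun r => ?_)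
  rcases le_or_gt r RW with hr | hr
  · simp [h.eq_zero hr]
  · have := hW.deriv_deriv_profile hRW hFW hr
    simp only
    rw [← neg_mul, ← this]

end Profile


/-! ### Hölder regularity in r and continuous representatives. -/

section BumpPrimitive

variable {κ : ℝ} (hκ : 0 < κ)

/-- The primitive of `unitBump κ` that vanishes at `-κ`. -/
def bumpPrimitive (s : ℝ) : ℝ := ∫ x in (-κ)..s, unitBump κ hκ x

theorem integrable_unitBump : Integrable (unitBump κ hκ) :=
  (isBumpFunction_unitBump hκ).continuous.integrable_of_hasCompactSupport
    (isBumpFunction_unitBump hκ).hasCompactSupport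

theorem hasDerivAt_bumpPrimitive (s : ℝ) : HasDerivAt (bumpPrimitive hκ) (unitBump κ hκ s) s :=
  intervalIntegral.integral_hasDerivAt_right (integrable_unitBump hκ).intervalIntegrable
    (isBumpFunction_unitBump hκ).continuous.stronglyMeasurable.stronglyMeasurableAtFilter
    (isBumpFunction_unitBump hκ).continuous.continuousAt

theorem contDiff_bumpPrimitive : ContDiff ℝ (⊤ : ℕ∞) (bumpPrimitive hκ) := by
  refine contDiff_infty_iff_deriv.2 ⟨fun s => (hasDerivAt_bumpPrimitive hκ s).differentiableAt, ?_⟩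
  rw [funext fun s => (hasDerivAt_bumpPrimitive hκ s).deriv]
  exact (isBumpFunction_unitBump hκ).1

theorem bumpPrimitive_mem_Icc (s : ℝ) (hs : -κ ≤ s) : bumpPrimitive hκ s ∈ Set.Icc (0 : ℝ) 1 := by
  rw [bumpPrimitive, intervalIntegral.integral_of_le hs]
  refine ⟨integral_nonneg fun x => unitBump_nonneg hκ x, ?_⟩
  rw [← integral_unitBump hκ]
  exact setIntegral_le_integral (integrable_unitBump hκ)
    (Eventually.of_forall fun x => unitBump_nonneg hκ x)

theorem bumpPrimitive_eq_zero {s : ℝ} (hs : s ≤ -κ) : bumpPrimitive hκ s = 0 := by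
  rw [bumpPrimitive]
  refine intervalIntegral.integral_zero_ae ((measure_eq_zero_iff_ae_notMem.1
    (measure_singleton (-κ))).mono fun x hx hx' => ?_)
  rw [Set.uIoc_of_ge hs] at hx'
  exact (isBumpFunction_unitBump hκ).eq_zero fun h => hx (le_antisymm hx'.2 h.1)

theorem bumpPrimitive_eq_one {s : ℝ} (hs : κ ≤ s) : bumpPrimitive hκ s = 1 := by
  rw [bumpPrimitive, intervalIntegral.integral_of_le (by linarith), ← integral_unitBump hκ,
    ← integral_indicator measurableSet_Ioc]
  refine integral_congr_ae ((measure_eq_zero_iff_ae_notMem.1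
    (measure_singleton (-κ))).mono fun x hx => ?_)
  by_cases h : x ∈ Set.Ioc (-κ) s
  · rw [Set.indicator_of_mem h]
  · rw [Set.indicator_of_notMem h, (isBumpFunction_unitBump hκ).eq_zero fun h' => h ⟨?_, ?_⟩]
    · exact lt_of_le_of_ne h'.1 fun h'' => hx h''.symm
    · exact h'.2.trans hs

theorem abs_bumpPrimitive_sub_le {κ' : ℝ} (hκ' : 0 < κ') (s s' : ℝ) :
    |bumpPrimitive hκ s - bumpPrimitive hκ' s'| ≤ 1 := by
  have h : ∀ {κ : ℝ} (hκ : 0 < κ) (s : ℝ), bumpPrimitive hκ s ∈ Set.Icc (0 : ℝ) 1 := by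
    intro κ hκ s
    rcases le_total (-κ) s with h | h
    · exact bumpPrimitive_mem_Icc hκ s h
    · rw [bumpPrimitive_eq_zero hκ h]; simp
  rw [abs_le]
  constructor <;> linarith [(h hκ s).1, (h hκ s).2, (h hκ' s').1, (h hκ' s').2]

end BumpPrimitive

section Regularity

variable {a : ℝ} {g : ℝ → ℝ → ℝ} {t N : ℝ}

/-- If the weak derivative of `g t` is square integrable with weight `r²` then the mollified
functions satisfy a uniform Hölder estimate. -/
theorem abs_mollify_sub_mollify_le (ha : 0 ≤ a)
    (hg : ∀ c d, a < c → IntegrableOn (g t) (Set.Icc c d)) (hN0 : 0 ≤ N)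
    (hN : ∀ Θ, IsTestOn a Θ → |∫ r, g t r * deriv Θ r| ≤ N * √(∫ r, (Θ r / r) ^ 2))
    {κ κ' c r r' : ℝ} (hκ : 0 < κ) (hκ' : 0 < κ') (hc : a < c) (hr : c ≤ r - κ)
    (hr' : c ≤ r' - κ') :
    |mollify g (unitBump κ hκ) t r - mollify g (unitBump κ' hκ') t r'| ≤
      N / c * √(|r - r'| + 2 * κ + 2 * κ') := by
  have hc0 : 0 < c := ha.trans_lt hc
  -- Its derivative is the difference of the two shifted bumps. It is a test function because both
  -- primitives are 0 far to the left and 1 far to the right.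
  set Θ : ℝ → ℝ := fun s => bumpPrimitive hκ (s - r) - bumpPrimitive hκ' (s - r') with hΘ
  set A := min (r - κ) (r' - κ') with hA
  set B := max (r + κ) (r' + κ') with hB
  have hcA : c ≤ A := le_min hr hr'
  have hz : ∀ s, s ∉ Set.Icc A B → Θ s = 0 := by
    intro s hs
    rw [Set.mem_Icc, not_and_or, not_le, not_le] at hs
    simp only [hΘ]
    rcases hs with h | h
    · rw [bumpPrimitive_eq_zero hκ (by linarith [min_le_left (r - κ) (r' - κ')]),
        bumpPrimitive_eq_zero hκ' (by linarith [min_le_right (r - κ) (r' - κ')]), sub_zero]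
    · rw [bumpPrimitive_eq_one hκ (by linarith [le_max_left (r + κ) (r' + κ')]),
        bumpPrimitive_eq_one hκ' (by linarith [le_max_right (r + κ) (r' + κ')]), sub_self]
  have hts : tsupport Θ ⊆ Set.Icc A B :=
    closure_minimal (fun s hs => by by_contra h; exact hs (hz s h)) isClosed_Icc
  have hT : IsTestOn a Θ := by
    refine ⟨?_, isCompact_Icc.of_isClosed_subset (isClosed_tsupport _) hts,
      hts.trans fun s hs => hc.trans_le (hcA.trans hs.1)⟩
    exact ((contDiff_bumpPrimitive hκ).comp (contDiff_id.sub contDiff_const)).sub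
      ((contDiff_bumpPrimitive hκ').comp (contDiff_id.sub contDiff_const))
  have hd : ∀ s, deriv Θ s = unitBump κ hκ (s - r) - unitBump κ' hκ' (s - r') := fun s =>
    (((hasDerivAt_bumpPrimitive hκ (s - r)).comp_sub_const s r).sub
      ((hasDerivAt_bumpPrimitive hκ' (s - r')).comp_sub_const s r')).deriv
  have hdiff : ∫ s, g t s * deriv Θ s =
      mollify g (unitBump κ hκ) t r - mollify g (unitBump κ' hκ') t r' := by
    unfold mollify
    rw [← integral_sub (integrable_mul_shift (isBumpFunction_unitBump hκ) (hg _ _ (by linarith)))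
      (integrable_mul_shift (isBumpFunction_unitBump hκ') (hg _ _ (by linarith)))]
    simp_rw [hd, mul_sub]
  rw [← hdiff]
  refine (hN Θ hT).trans ?_
  -- Θ is bounded by 1 and lives on an interval to the right of c of length at most |r - r'| + 2κ +
  -- 2κ'; the square root of this length is the Hölder modulus.
  have hint : ∫ s, (Θ s / s) ^ 2 ≤ (1 / c) ^ 2 * (|r - r'| + 2 * κ + 2 * κ') := by
    have h1 : ∀ s, (Θ s / s) ^ 2 ≤ (Set.Icc A B).indicator (fun _ => (1 / c) ^ 2) s := by
      intro s
      by_cases hs : s ∈ Set.Icc A B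
      · rw [Set.indicator_of_mem hs, ← sq_abs, abs_div]
        have hs0 : c ≤ |s| := (hcA.trans hs.1).trans (le_abs_self s)
        refine pow_le_pow_left₀ (by positivity) ?_ 2
        exact div_le_div₀ zero_le_one (abs_bumpPrimitive_sub_le hκ hκ' _ _) hc0 hs0
      · rw [Set.indicator_of_notMem hs, hz s hs]; simp
    refine (integral_mono_of_nonneg (Eventually.of_forall fun s => sq_nonneg _)
      ((integrable_indicator_iff measurableSet_Icc).2 (integrableOn_const (by simp)))
      (Eventually.of_forall h1)).trans ?_
    rw [integral_indicator measurableSet_Icc, setIntegral_const, smul_eq_mul, mul_comm]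
    refine mul_le_mul_of_nonneg_left ?_ (sq_nonneg _)
    have hAB : A ≤ B := (min_le_left _ _).trans ((by linarith : r - κ ≤ r + κ).trans (le_max_left _ _))
    rw [measureReal_def, Real.volume_Icc, ENNReal.toReal_ofReal (by linarith)]
    have h2 := le_abs_self (r - r')
    have h3 := neg_abs_le (r - r')
    rcases min_choice (r - κ) (r' - κ') with h | h <;>
      rcases max_choice (r + κ) (r' + κ') with h' | h' <;> rw [hA, hB, h, h'] <;> linarith
  calc N * √(∫ r, (Θ r / r) ^ 2) ≤ N * √((1 / c) ^ 2 * (|r - r'| + 2 * κ + 2 * κ')) :=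
        mul_le_mul_of_nonneg_left (Real.sqrt_le_sqrt hint) hN0
    _ = N / c * √(|r - r'| + 2 * κ + 2 * κ') := by
        rw [Real.sqrt_mul (sq_nonneg _), Real.sqrt_sq (by positivity)]; ring

/-- The mollified functions converge almost everywhere. -/
theorem ae_tendsto_mollify (hg : ∀ c d, a < c → IntegrableOn (g t) (Set.Icc c d)) {k : ℕ → ℝ}
    (hk : ∀ n, 0 < k n) (hk0 : Tendsto k atTop (𝓝 0)) :
    ∀ᵐ r, a < r → Tendsto (fun n => mollify g (unitBump (k n) (hk n)) t r) atTop (𝓝 (g t r)) := by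
  have main : ∀ c d, a < c → ∀ᵐ r, r ∈ Set.Ioo c d →
      Tendsto (fun n => mollify g (unitBump (k n) (hk n)) t r) atTop (𝓝 (g t r)) := by
    intro c d hc
    have hi : Integrable ((Set.Icc c d).indicator (g t)) :=
      (hg c d hc).integrable_indicator measurableSet_Icc
    have := ContDiffBump.ae_convolution_tendsto_right_of_locallyIntegrable (μ := volume)
      (φ := fun n => (⟨k n / 2, k n, half_pos (hk n), half_lt_self (hk n)⟩ : ContDiffBump (0 : ℝ)))
      (K := 2) hk0 (Eventually.of_forall fun n => (by linarith : k n ≤ 2 * (k n / 2))) hi.locallyIntegrable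
    filter_upwards [this] with r hr hrcd
    rw [Set.indicator_of_mem (Set.Ioo_subset_Icc_self hrcd)] at hr
    refine hr.congr' ?_
    have hpos : 0 < min (r - c) (d - r) := lt_min (by linarith [hrcd.1]) (by linarith [hrcd.2])
    filter_upwards [hk0.eventually (gt_mem_nhds hpos)] with n hn
    rw [convolution_eq_swap, mollify]
    refine integral_congr_ae (Eventually.of_forall fun s => ?_)
    simp only [ContinuousLinearMap.lsmul_apply, smul_eq_mul]
    -- `mollify` is a correlation; evenness of the bump turns it into the convolution to which the
    -- differentiation theorem applies.
    have heven : (⟨k n / 2, k n, half_pos (hk n), half_lt_self (hk n)⟩ :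
        ContDiffBump (0 : ℝ)).normed volume (r - s) = unitBump (k n) (hk n) (s - r) := by
      rw [unitBump, ← ContDiffBump.normed_neg, neg_sub]
    rw [heven, mul_comm]
    by_cases hs : s ∈ Set.Icc c d
    · rw [Set.indicator_of_mem hs]
    · rw [(isBumpFunction_unitBump (hk n)).eq_zero (x := s - r), mul_zero, mul_zero]
      intro h
      have h1 := hn.trans_le (min_le_left (r - c) (d - r))
      have h2 := hn.trans_le (min_le_right (r - c) (d - r))
      exact hs ⟨by linarith [h.1], by linarith [h.2]⟩
  have hall := ae_all_iff.2 fun n : ℕ => main (a + 1 / (n + 1)) n (by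
    have : (0 : ℝ) < 1 / (n + 1) := by positivity
    linarith)
  filter_upwards [hall] with r hr har
  obtain ⟨n₁, hn₁⟩ := exists_nat_one_div_lt (sub_pos.2 har)
  obtain ⟨n₂, hn₂⟩ := exists_nat_gt r
  refine hr (max n₁ n₂) ⟨?_, hn₂.trans_le (by exact_mod_cast le_max_right n₁ n₂)⟩
  have : (1 : ℝ) / ((max n₁ n₂ : ℕ) + 1) ≤ 1 / (n₁ + 1) := by
    apply one_div_le_one_div_of_le (by positivity)
    have : (n₁ : ℝ) ≤ (max n₁ n₂ : ℕ) := by exact_mod_cast le_max_left n₁ n₂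
    linarith
  linarith

/-- The Hölder estimate makes the mollifications at scale 1/(n+1) a Cauchy sequence at every point,
and its limit is the representative. Joint continuity combines the Hölder bound in r, whose constant
is locally bounded in t, with the continuity in t of the mollification at one fixed small scale. -/
theorem exists_continuous_representative {I : Set ℝ} {N : ℝ → ℝ} (ha : 0 ≤ a)
    (hg : ∀ t ∈ I, ∀ c d, a < c → IntegrableOn (g t) (Set.Icc c d)) (hN0 : ∀ t ∈ I, 0 ≤ N t)
    (hN : ∀ t ∈ I, ∀ Θ, IsTestOn a Θ →
      |∫ r, g t r * deriv Θ r| ≤ N t * √(∫ r, (Θ r / r) ^ 2))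
    (hNb : ∀ t ∈ I, ∃ B, ∀ᶠ t' in 𝓝[I] t, N t' ≤ B)
    (hc : ∀ θ, IsTestOn a θ → ContinuousOn (fun t => ∫ r, g t r * θ r) I) :
    ∃ g' : ℝ → ℝ → ℝ, ContinuousOn (Function.uncurry g') (I ×ˢ Set.Ioi a) ∧
      ∀ t ∈ I, ∀ᵐ r, a < r → g t r = g' t r := by
  set k : ℕ → ℝ := fun n => 1 / (n + 1) with hk_def
  have hk : ∀ n, 0 < k n := fun n => by simp only [hk_def]; positivity
  have hk0 : Tendsto k atTop (𝓝 0) := tendsto_one_div_add_atTop_nhds_zero_nat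
  set m : ℝ → ℝ → ℕ → ℝ := fun t r n => mollify g (unitBump (k n) (hk n)) t r with hm
  have hcauchy : ∀ t ∈ I, ∀ r, a < r → CauchySeq (m t r) := by
    intro t ht r hr
    rw [Metric.cauchySeq_iff]
    intro ε hε
    set c := (a + r) / 2 with hcdef
    have hlim : Tendsto (fun n => N t / c * √(|r - r| + 4 * k n)) atTop (𝓝 0) := by
      have h1 : Tendsto (fun n => N t / c * √(|r - r| + 4 * k n)) atTop
          (𝓝 (N t / c * √(|r - r| + 4 * 0))) :=
        ((hk0.const_mul 4).const_add _).sqrt.const_mul _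
      simpa using h1
    obtain ⟨n₀, hn₀⟩ := ((hlim.eventually (gt_mem_nhds hε)).and
      (hk0.eventually (gt_mem_nhds (show 0 < r - c by rw [hcdef]; linarith)))).exists_forall_of_atTop
    refine ⟨n₀, fun i hi j hj => ?_⟩
    have hki : ∀ i ≥ n₀, k i ≤ k n₀ := fun i hi => one_div_le_one_div_of_le (by positivity)
      (by have : (n₀ : ℝ) ≤ i := by exact_mod_cast hi
          linarith)
    rw [Real.dist_eq]
    refine (abs_mollify_sub_mollify_le ha (hg t ht) (hN0 t ht) (hN t ht) (hk i) (hk j) (c := c)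
      (by rw [hcdef]; linarith) (by linarith [(hn₀ i hi).2]) (by linarith [(hn₀ j hj).2])).trans_lt
      (lt_of_le_of_lt ?_ (hn₀ n₀ le_rfl).1)
    refine mul_le_mul_of_nonneg_left (Real.sqrt_le_sqrt ?_)
      (div_nonneg (hN0 t ht) (by rw [hcdef]; linarith))
    linarith [hki i hi, hki j hj]
  set g' : ℝ → ℝ → ℝ := fun t r => limUnder atTop (m t r) with hg'
  have hlim : ∀ t ∈ I, ∀ r, a < r → Tendsto (m t r) atTop (𝓝 (g' t r)) := fun t ht r hr =>
    (hcauchy t ht r hr).tendsto_limUnder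
  have hb1 : ∀ t ∈ I, ∀ c r r', a < c → c < r → c < r' →
      |g' t r - g' t r'| ≤ N t / c * √|r - r'| := by
    intro t ht c r r' hac hr hr'
    have h1 : Tendsto (fun n => N t / c * √(|r - r'| + 2 * k n + 2 * k n)) atTop
        (𝓝 (N t / c * √(|r - r'| + 2 * 0 + 2 * 0))) :=
      (((hk0.const_mul 2).const_add _).add (hk0.const_mul 2)).sqrt.const_mul _
    simp only [mul_zero, add_zero] at h1
    refine le_of_tendsto_of_tendsto ((hlim t ht r (hac.trans hr)).sub
      (hlim t ht r' (hac.trans hr'))).abs h1 ?_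
    filter_upwards [hk0.eventually (gt_mem_nhds (sub_pos.2 hr)),
      hk0.eventually (gt_mem_nhds (sub_pos.2 hr'))] with n h2 h3
    exact abs_mollify_sub_mollify_le ha (hg t ht) (hN0 t ht) (hN t ht) (hk n) (hk n) hac
      (by linarith) (by linarith)
  have hb2 : ∀ t ∈ I, ∀ c r κ, ∀ hκ : 0 < κ, a < c → c ≤ r - κ →
      |mollify g (unitBump κ hκ) t r - g' t r| ≤ N t / c * √(2 * κ) := by
    intro t ht c r κ hκ hac hr
    have h1 : Tendsto (fun n => N t / c * √(|r - r| + 2 * κ + 2 * k n)) atTop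
        (𝓝 (N t / c * √(|r - r| + 2 * κ + 2 * 0))) :=
      ((hk0.const_mul 2).const_add _).sqrt.const_mul _
    simp only [sub_self, abs_zero, zero_add, mul_zero, add_zero] at h1
    refine le_of_tendsto_of_tendsto (tendsto_const_nhds.sub
      (hlim t ht r (by linarith))).abs h1 ?_
    filter_upwards [hk0.eventually (gt_mem_nhds (show 0 < r - c by linarith))] with n h2
    have := abs_mollify_sub_mollify_le ha (hg t ht) (hN0 t ht) (hN t ht) hκ (hk n) hac hr
      (r' := r) (by linarith)
    simpa using this
  refine ⟨g', ?_, fun t ht => ?_⟩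
  · rintro ⟨t, r⟩ ⟨ht, hr⟩
    simp only [Set.mem_Ioi] at hr
    obtain ⟨B₀, hB₀⟩ := hNb t ht
    set B := max B₀ 0 with hBdef
    have hB : ∀ᶠ t' in 𝓝[I] t, N t' ≤ B := hB₀.mono fun t' h => h.trans (le_max_left _ _)
    have hB0 : 0 ≤ B := le_max_right _ _
    set c := (a + r) / 2 with hcdef
    have hac : a < c := by rw [hcdef]; linarith
    have hcr : c < r := by rw [hcdef]; linarith
    have hc0 : 0 < c := ha.trans_lt hac
    refine Metric.continuousWithinAt_iff'.2 fun ε hε => ?_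
    obtain ⟨κ, hκ, hκr, hκε⟩ : ∃ κ, 0 < κ ∧ c ≤ r - κ ∧ B / c * √(2 * κ) < ε / 4 := by
      have h1 : Tendsto (fun κ : ℝ => B / c * √(2 * κ)) (𝓝[>] 0) (𝓝 0) := by
        have : Continuous fun κ : ℝ => B / c * √(2 * κ) := by fun_prop
        have h := (this.tendsto 0).mono_left (nhdsWithin_le_nhds (s := Set.Ioi 0))
        simpa using h
      obtain ⟨κ, h2, h3, h4⟩ := ((h1.eventually (gt_mem_nhds (show 0 < ε / 4 by linarith))).and
        ((eventually_nhdsWithin_of_forall fun x hx => hx : ∀ᶠ x in 𝓝[>] (0 : ℝ), x ∈ Set.Ioi 0).and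
        (nhdsWithin_le_nhds (gt_mem_nhds (show 0 < r - c by linarith))))).exists
      have h5 : κ < r - c := h4
      exact ⟨κ, h3, by linarith, h2⟩
    have hmt : ContinuousWithinAt (fun t => mollify g (unitBump κ hκ) t r) I t :=
      hc _ ((isBumpFunction_unitBump hκ).isTestOn (by linarith)) t ht
    have e1 : ∀ᶠ t' in 𝓝[I] t, dist (mollify g (unitBump κ hκ) t' r)
        (mollify g (unitBump κ hκ) t r) < ε / 4 :=
      Metric.tendsto_nhds.1 hmt _ (by linarith)
    have e2 : ∀ᶠ r' in 𝓝 r, c < r' ∧ B / c * √|r' - r| < ε / 4 := by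
      have : Continuous fun r' : ℝ => B / c * √|r' - r| := by fun_prop
      have h := this.tendsto r
      simp only [sub_self, abs_zero, Real.sqrt_zero, mul_zero] at h
      exact (lt_mem_nhds hcr).and (h.eventually (gt_mem_nhds (show 0 < ε / 4 by linarith)))
    have hfst : Tendsto Prod.fst (𝓝[I ×ˢ Set.Ioi a] (t, r)) (𝓝[I] t) :=
      continuousWithinAt_fst.tendsto_nhdsWithin fun z hz => hz.1
    have hsnd : Tendsto Prod.snd (𝓝[I ×ˢ Set.Ioi a] (t, r)) (𝓝 r) := continuousWithinAt_snd
    filter_upwards [hfst.eventually e1, hfst.eventually hB, hsnd.eventually e2,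
      self_mem_nhdsWithin] with z hz1 hzB hz2 hz3
    obtain ⟨t', r'⟩ := z
    simp only [Function.uncurry] at hz1 hzB hz2 ⊢
    rw [Real.dist_eq] at hz1 ⊢
    have hB' : N t ≤ B := hB.self_of_nhdsWithin ht
    have b1 := hb1 t' hz3.1 c r' r hac hz2.1 hcr
    have b2 := hb2 t' hz3.1 c r κ hκ hac hκr
    have b3 := hb2 t ht c r κ hκ hac hκr
    have b4 : N t' / c * √|r' - r| ≤ B / c * √|r' - r| := by gcongr
    have b5 : N t' / c * √(2 * κ) ≤ B / c * √(2 * κ) := by gcongr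
    have b6 : N t / c * √(2 * κ) ≤ B / c * √(2 * κ) := by gcongr
    rw [abs_le] at b1 b2 b3
    rw [abs_lt] at hz1 ⊢
    constructor <;> linarith
  · filter_upwards [ae_tendsto_mollify (hg t ht) hk hk0] with r hr har
    exact tendsto_nhds_unique (hr har) (hlim t ht r har)

end Regularity


/-! ### Radial pairings and the weak gradient in polar coordinates. -/

section CauchySchwarz

variable {X : Type*} [MeasurableSpace X] {μ : Measure X}

theorem integral_mul_norm_le_eLpNorm_mul_sqrt {f g : X → ℝ} (hf : MemLp f 2 μ) (hg : MemLp g 2 μ) :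
    ∫ x, ‖f x‖ * ‖g x‖ ∂μ ≤ (eLpNorm f 2 μ).toReal * √(∫ x, g x ^ 2 ∂μ) := by
  have h2 : ENNReal.ofReal 2 = 2 := by simp
  have h := integral_mul_norm_le_Lp_mul_Lq (μ := μ) Real.HolderConjugate.two_two
    (by rwa [h2] : MemLp f (ENNReal.ofReal 2) μ) (by rwa [h2] : MemLp g (ENNReal.ofReal 2) μ)
  refine h.trans (le_of_eq ?_)
  rw [hf.eLpNorm_eq_integral_rpow_norm (by simp) (by simp), ENNReal.toReal_ofReal (by positivity),
    Real.sqrt_eq_rpow]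
  simp

end CauchySchwarz

section Pairing

variable {a : ℝ} {θ : ℝ → ℝ}

theorem integral_radialTest_mul (h : IsTestOn a θ) (ha : 0 ≤ a) {f : E3 → ℝ} {k : ℝ → ℝ}
    (hf : ∀ᵐ x, x ∈ exterior a → f x = k ‖x‖) :
    ∫ x, radialTest h ha x * (f x : ℂ) = ((sphereArea * ∫ r, r * k r * θ r : ℝ) : ℂ) := by
  rw [← integral_comp_norm_mul_div (fun r hr => h.eq_zero (hr.trans ha)) k, ← integral_complex_ofReal]
  refine integral_congr_ae (hf.mono fun x hx => ?_)
  simp only [radialTest_apply]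
  by_cases hxa : x ∈ exterior a
  · rw [hx hxa]; push_cast; rfl
  · rw [h.eq_zero (not_lt.1 hxa)]; simp

/-- Test with a smooth bump that equals 1 on the ball. -/
theorem integrableOn_closedBall {T : 𝓢'(E3, ℂ)} {f : E3 → ℝ}
    (hT : IsFunction T fun x => (f x : ℂ)) (R : ℝ) : IntegrableOn f (Metric.closedBall 0 R) := by
  have hR : 0 < max R 1 := by positivity
  set b : ContDiffBump (0 : E3) := ⟨max R 1, max R 1 + 1, hR, by linarith⟩ with hb
  have h := (hT (HasCompactSupport.toSchwartzMap (f := fun x : E3 => ((b x : ℝ) : ℂ))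
    (b.hasCompactSupport.comp_left (g := fun r : ℝ => (r : ℂ)) Complex.ofReal_zero)
    (Complex.ofRealCLM.contDiff.comp b.contDiff))).1.re
  refine (h.integrableOn (s := Metric.closedBall 0 R)).congr_fun (fun x hx => ?_)
    measurableSet_closedBall
  have : b x = 1 := b.one_of_mem_closedBall
    (Metric.closedBall_subset_closedBall (le_max_left _ _) hx)
  have h2 : ((((b x : ℝ) : ℂ)) * (f x : ℂ)).re = f x := by simp [this]
  exact h2

theorem integrableOn_profile {f : E3 → ℝ} {g : ℝ → ℝ}
    (hf : ∀ R, IntegrableOn f (Metric.closedBall 0 R)) (hg : f =ᵐ[volume] fun x => g ‖x‖)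
    {c : ℝ} (hc : 0 < c) (d : ℝ) : IntegrableOn g (Set.Icc c d) := by
  have hm : MeasurableSet {x : E3 | ‖x‖ ∈ Set.Icc c d} := measurable_norm measurableSet_Icc
  have h1 : Integrable fun x : E3 => (Set.Icc c d).indicator g ‖x‖ := by
    have h2 : IntegrableOn f {x : E3 | ‖x‖ ∈ Set.Icc c d} :=
      (hf d).mono_set fun x hx => by rw [mem_closedBall_zero_iff]; exact hx.2
    refine (h2.integrable_indicator hm).congr (hg.mono fun x hx => ?_)
    by_cases hxm : ‖x‖ ∈ Set.Icc c d
    · show _ = (Set.Icc c d).indicator g ‖x‖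
      rw [Set.indicator_of_mem hxm, Set.indicator_of_mem (show x ∈ {x : E3 | ‖x‖ ∈ Set.Icc c d}
        from hxm), hx]
    · show _ = (Set.Icc c d).indicator g ‖x‖
      rw [Set.indicator_of_notMem hxm, Set.indicator_of_notMem
        (show x ∉ {x : E3 | ‖x‖ ∈ Set.Icc c d} from hxm)]
  rw [integrable_comp_norm_iff] at h1
  have hsub : Set.Icc c d ⊆ Set.Ioi 0 := fun r hr => hc.trans_le hr.1
  have h3 : IntegrableOn (fun r => r ^ 2 * g r) (Set.Icc c d) :=
    (h1.mono_set hsub).congr_fun (fun r hr => by simp only [Set.indicator_of_mem hr])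
      measurableSet_Icc
  have h4 : ContinuousOn (fun r : ℝ => (r ^ 2)⁻¹) (Set.Icc c d) :=
    ContinuousOn.inv₀ (by fun_prop) fun r hr => pow_ne_zero _ (hsub hr : (0 : ℝ) < r).ne'
  refine (h3.continuousOn_mul h4 isCompact_Icc).congr_fun (fun r hr => ?_) measurableSet_Icc
  have : r ≠ 0 := (hsub hr : (0 : ℝ) < r).ne'
  field_simp

end Pairing

section Gradient

variable {a : ℝ} {Θ : ℝ → ℝ} {f : E3 → ℝ} {G : E3 → E3}

theorem norm_radialField {x : E3} : ‖(Θ ‖x‖ / ‖x‖ ^ 3) • x‖ = |Θ ‖x‖ / ‖x‖ ^ 2| := by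
  rcases eq_or_ne x 0 with rfl | hx
  · simp
  · have : ‖x‖ ≠ 0 := norm_ne_zero_iff.2 hx
    rw [norm_smul, Real.norm_eq_abs, ← abs_norm x, ← abs_mul, abs_norm]
    congr 1; field_simp

/-- The weak gradient tested against the field `Θ(|x|) x / |x|³`, of divergence `Θ'(|x|) / |x|²`. -/
theorem IsWeakGradientOn.integral_radial (ha : 0 ≤ a) (hG : IsWeakGradientOn f G (exterior a))
    (hf : ∀ R, IntegrableOn f (Metric.closedBall 0 R)) (hG2 : MemLp G 2 (volume.restrict (exterior a)))
    (h : IsTestOn a Θ) :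
    ∫ x, f x * (deriv Θ ‖x‖ / ‖x‖ ^ 2) =
      -∫ x in exterior a, inner ℝ (G x) ((Θ ‖x‖ / ‖x‖ ^ 3) • x) := by
  set A : ℝ → ℝ := fun r => Θ r / r ^ 3 with hA
  have hAt : IsTestOn a A := h.div_pow ha 3
  set e := stdOrthonormalBasis ℝ E3 with he
  -- The components of the field A(|x|) x with A = Θ/r³. Its divergence is A' r + 3A = Θ'/r², since
  -- the terms without derivative cancel.
  set φ : Fin (Module.finrank ℝ E3) → E3 → ℝ := fun i x => A ‖x‖ * inner ℝ x (e i) with hφ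
  have hφs : ∀ i, ContDiff ℝ (⊤ : ℕ∞) (φ i) := fun i =>
    (hAt.contDiff_norm ha).mul (contDiff_id.inner ℝ contDiff_const)
  have hφc : ∀ i, HasCompactSupport (φ i) := fun i => hAt.hasCompactSupport_norm.mul_right
  have hφt : ∀ i, tsupport (φ i) ⊆ exterior a := fun i =>
    tsupport_mul_subset_left.trans hAt.tsupport_norm_subset
  have hmeas : MeasurableSet (exterior a) := measurableSet_lt measurable_const measurable_norm
  have h1 := fun i => hG (φ i) (hφs i) (hφc i) (hφt i) (e i)
  have hbd : ∀ {k : E3 → ℝ}, Continuous k → HasCompactSupport k →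
      Integrable fun x => f x * k x := by
    intro k hk hkc
    obtain ⟨R, hR⟩ := hkc.isCompact.isBounded.subset_closedBall 0
    obtain ⟨C, hC⟩ := hkc.exists_bound_of_continuous hk
    have h2 : (fun x => f x * k x) = fun x => (Metric.closedBall 0 R).indicator f x * k x := by
      funext x
      by_cases hx : x ∈ Metric.closedBall 0 R
      · rw [Set.indicator_of_mem hx]
      · rw [image_eq_zero_of_notMem_tsupport fun h' => hx (hR h'), mul_zero, mul_zero]
    rw [h2]
    exact ((hf R).integrable_indicator measurableSet_closedBall).mul_bdd (c := C)
      hk.aestronglyMeasurable (Eventually.of_forall hC)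
  have hl : ∀ i, Integrable fun x => f x * fderiv ℝ (φ i) x (e i) := fun i =>
    hbd (((hφs i).continuous_fderiv (by simp)).clm_apply continuous_const)
      ((hφc i).fderiv_apply (𝕜 := ℝ) (e i))
  have hzero : ∀ i x, x ∉ exterior a → φ i x = 0 := fun i x hx =>
    image_eq_zero_of_notMem_tsupport fun h' => hx (hφt i h')
  have hr : ∀ i, IntegrableOn (fun x => inner ℝ (G x) (e i) * φ i x) (exterior a) := by
    intro i
    have h2 : MemLp (fun x => inner ℝ (G x) (e i)) 2 (volume.restrict (exterior a)) :=
      hG2.inner_const (𝕜 := ℝ) (e i)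
    have h3 : MemLp (φ i) 2 (volume.restrict (exterior a)) :=
      ((hφs i).continuous.memLp_of_hasCompactSupport (hφc i)).restrict _
    exact h2.integrable_mul h3
  have h4 : ∀ i, ∫ x, inner ℝ (G x) (e i) * φ i x =
      ∫ x in exterior a, inner ℝ (G x) (e i) * φ i x := fun i =>
    (setIntegral_eq_integral_of_forall_compl_eq_zero fun x hx => by
      rw [hzero i x hx, mul_zero]).symm
  have hsum : ∑ i, ∫ x, f x * fderiv ℝ (φ i) x (e i) =
      -∑ i, ∫ x in exterior a, inner ℝ (G x) (e i) * φ i x := by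
    rw [← Finset.sum_neg_distrib]
    exact Finset.sum_congr rfl fun i _ => by rw [h1 i, h4 i]
  rw [← integral_finsetSum _ fun i _ => hl i, ← integral_finsetSum _ fun i _ => hr i] at hsum
  have hL : ∀ x : E3, ∑ i, f x * fderiv ℝ (φ i) x (e i) = f x * (deriv Θ ‖x‖ / ‖x‖ ^ 2) := by
    intro x
    rw [← Finset.mul_sum]
    congr 1
    rcases eq_or_ne x 0 with rfl | hx
    · have : ∀ i, fderiv ℝ (φ i) 0 = 0 := fun i => image_eq_zero_of_notMem_tsupport fun h' => by
        have := hφt i (tsupport_fderiv_subset ℝ h')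
        simp only [exterior, Set.mem_ofPred_eq, norm_zero] at this
        linarith
      simp [this]
    · have hx0 : ‖x‖ ≠ 0 := norm_ne_zero_iff.2 hx
      have hd : HasDerivAt A ((deriv Θ ‖x‖ * ‖x‖ ^ 3 - Θ ‖x‖ * (3 * ‖x‖ ^ 2)) / (‖x‖ ^ 3) ^ 2) ‖x‖ := by
        have : HasDerivAt A _ ‖x‖ :=
          (h.differentiable ‖x‖).hasDerivAt.div (hasDerivAt_pow 3 ‖x‖) (pow_ne_zero 3 hx0)
        simpa using this
      simp only [hφ]
      rw [sum_fderiv_comp_norm_mul_inner hx hd]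
      simp only [hA]
      field_simp
      ring
  have hR : ∀ x : E3, ∑ i, inner ℝ (G x) (e i) * φ i x = inner ℝ (G x) ((Θ ‖x‖ / ‖x‖ ^ 3) • x) := by
    intro x
    rw [inner_smul_right, ← e.sum_inner_mul_inner (G x) x, Finset.mul_sum]
    refine Finset.sum_congr rfl fun i _ => ?_
    simp only [hφ, hA]
    rw [real_inner_comm x (e i)]
    ring
  simp_rw [hL, hR] at hsum
  exact hsum

/-- The integral of g Θ' is, up to the sphere area, that of f against the divergence of Θ(|x|)
x/|x|³. This field has length |Θ|/|x|², whose L² norm is √`sphereArea` times that of Θ/r;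
Cauchy–Schwarz then leaves one factor √`sphereArea` in the denominator. -/
theorem abs_integral_profile_mul_deriv_le (ha : 0 ≤ a) (hG : IsWeakGradientOn f G (exterior a))
    (hf : ∀ R, IntegrableOn f (Metric.closedBall 0 R)) (hG2 : MemLp G 2 (volume.restrict (exterior a)))
    {g : ℝ → ℝ} (hg : f =ᵐ[volume] fun x => g ‖x‖) (h : IsTestOn a Θ) :
    |∫ r, g r * deriv Θ r| ≤ (eLpNorm G 2 (volume.restrict (exterior a))).toReal / √sphereArea *
      √(∫ r, (Θ r / r) ^ 2) := by
  have hc := sphereArea_pos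
  have h1 := hG.integral_radial ha hf hG2 h
  have h2 : ∫ x, f x * (deriv Θ ‖x‖ / ‖x‖ ^ 2) = sphereArea * ∫ r, g r * deriv Θ r := by
    have h3 := integral_comp_norm_mul_div (θ := fun r => deriv Θ r / r)
      (fun r hr => by rw [h.deriv.eq_zero (hr.trans ha), zero_div]) g
    have h4 : ∫ r, r * g r * (deriv Θ r / r) = ∫ r, g r * deriv Θ r := by
      refine integral_congr_ae (Eventually.of_forall fun r => ?_)
      rcases eq_or_ne r 0 with rfl | hr
      · simp [h.deriv.eq_zero ha]
      · field_simp
    rw [h4] at h3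
    rw [← h3]
    refine integral_congr_ae (hg.mono fun x hx => ?_)
    simp only [hx]
    rw [div_div, ← sq, mul_comm]
  have hψ : MemLp (fun x : E3 => Θ ‖x‖ / ‖x‖ ^ 2) 2 (volume.restrict (exterior a)) :=
    (((h.div_pow ha 2).contDiff_norm ha).continuous.memLp_of_hasCompactSupport
      (h.div_pow ha 2).hasCompactSupport_norm).restrict _
  have hcs := integral_mul_norm_le_eLpNorm_mul_sqrt (μ := volume.restrict (exterior a))
    (f := fun x => ‖G x‖) (g := fun x : E3 => Θ ‖x‖ / ‖x‖ ^ 2) hG2.norm hψ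
  rw [eLpNorm_norm] at hcs
  have h5 : ∫ x in exterior a, (Θ ‖x‖ / ‖x‖ ^ 2) ^ 2 = sphereArea * ∫ r, (Θ r / r) ^ 2 := by
    rw [setIntegral_eq_integral_of_forall_compl_eq_zero fun x hx => by
      rw [h.eq_zero (not_lt.1 hx)]; simp,
      integral_comp_norm fun r => (Θ r / r ^ 2) ^ 2]
    congr 1
    rw [← setIntegral_eq_integral_of_forall_compl_eq_zero (s := Set.Ioi 0) (μ := volume)
      (f := fun r => (Θ r / r) ^ 2) fun r hr => by
        rw [h.eq_zero ((not_lt.1 hr).trans ha)]; simp]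
    refine setIntegral_congr_fun measurableSet_Ioi fun r hr => ?_
    have : r ≠ 0 := (Set.mem_Ioi.1 hr).ne'
    field_simp
  rw [h5, Real.sqrt_mul hc.le] at hcs
  have h6 : |∫ x in exterior a, inner ℝ (G x) ((Θ ‖x‖ / ‖x‖ ^ 3) • x)| ≤
      ∫ x in exterior a, ‖‖G x‖‖ * ‖Θ ‖x‖ / ‖x‖ ^ 2‖ := by
    rw [← Real.norm_eq_abs]
    refine norm_integral_le_of_norm_le ?_ (Eventually.of_forall fun x => ?_)
    · exact MemLp.integrable_mul (p := 2) (q := 2) hG2.norm.norm hψ.norm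
    · rw [norm_norm, Real.norm_eq_abs (Θ ‖x‖ / ‖x‖ ^ 2), ← norm_radialField]
      exact norm_inner_le_norm _ _
  rw [h2] at h1
  have h7 : sphereArea * |∫ r, g r * deriv Θ r| =
      |∫ x in exterior a, inner ℝ (G x) ((Θ ‖x‖ / ‖x‖ ^ 3) • x)| := by
    rw [← abs_neg (∫ x in exterior a, inner ℝ (G x) ((Θ ‖x‖ / ‖x‖ ^ 3) • x)), ← h1, abs_mul, abs_of_pos hc]
  have hs0 : 0 < √sphereArea := Real.sqrt_pos.2 hc
  have hss : √sphereArea * √sphereArea = sphereArea := Real.mul_self_sqrt hc.le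
  rw [div_mul_eq_mul_div, le_div_iff₀ hs0]
  have h8 := h7.le.trans (h6.trans hcs)
  have h9 : √sphereArea * (|∫ r, g r * deriv Θ r| * √sphereArea) ≤ √sphereArea *
      ((eLpNorm G 2 (volume.restrict (exterior a))).toReal * √(∫ r, (Θ r / r) ^ 2)) := by
    calc _ = sphereArea * |∫ r, g r * deriv Θ r| := by
          linear_combination |∫ r, g r * deriv Θ r| * hss
      _ ≤ _ := h8
      _ = _ := by ring
  exact le_of_mul_le_mul_left h9 hs0

end Gradient


/-! ### The jointly continuous radial representative of the solution. -/

section Representative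

variable {p : ℝ} {F : ℝ → ℝ → ℝ} {I : Set ℝ} {u : ℝ → E3 → ℝ} {U V : ℝ → 𝓢'(E3, ℂ)}

theorem eventually_eLpNorm_le {X E : Type*} [MeasurableSpace X] [NormedAddCommGroup E]
    {μ : Measure X} {G : ℝ → X → E} {l : Filter ℝ} {t : ℝ} (hm : ∀ᶠ t' in l, MemLp (G t') 2 μ)
    (ht : MemLp (G t) 2 μ)
    (hG : Tendsto (fun t' => eLpNorm (fun x => G t' x - G t x) 2 μ) l (𝓝 0)) :
    ∀ᶠ t' in l, (eLpNorm (G t') 2 μ).toReal ≤ (eLpNorm (G t) 2 μ).toReal + 1 := by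
  filter_upwards [hm, hG.eventually (gt_mem_nhds one_pos)] with t' h1 h2
  have h3 : eLpNorm (G t') 2 μ ≤ eLpNorm (G t) 2 μ + 1 := by
    have h4 := eLpNorm_add_le ht.1 (h1.sub ht).1 (p := 2) (by simp)
    rw [add_sub_cancel] at h4
    exact h4.trans (by gcongr; exact h2.le)
  have h5 := ENNReal.toReal_mono (by finiteness [ht.2.ne]) h3
  rwa [ENNReal.toReal_add ht.2.ne (by simp), ENNReal.toReal_one] at h5

theorem exists_radial_representative {RW : ℝ} (hRW : 0 ≤ RW) (sol : IsSolution p F I u U V)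
    (hrad : ∀ t ∈ I, IsRadial (u t)) (hcont : ContinuousInEnergy (exterior RW) I u V) :
    ∃ g : ℝ → ℝ → ℝ, ContinuousOn (Function.uncurry g) (I ×ˢ Set.Ioi RW) ∧
      ∀ t ∈ I, ∀ᵐ x : E3, x ∈ exterior RW → u t x = g t ‖x‖ := by
  have hc := sphereArea_pos
  choose! g₀ hg₀ using hrad
  obtain ⟨G, v, hGv⟩ := hcont
  have hu : ∀ t ∈ I, ∀ R, IntegrableOn (u t) (Metric.closedBall 0 R) := fun t ht =>
    integrableOn_closedBall (sol.isFunction t ht)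
  obtain ⟨g, hgc, hg⟩ := exists_continuous_representative (a := RW) (g := g₀) (I := I)
    (N := fun t => (eLpNorm (G t) 2 (volume.restrict (exterior RW))).toReal / √sphereArea) hRW
    (fun t ht c d hcd => integrableOn_profile (hu t ht) (hg₀ t ht) (hRW.trans_lt hcd) d)
    (fun t _ => by positivity)
    (fun t ht Θ hΘ => abs_integral_profile_mul_deriv_le hRW (hGv t ht).1 (hu t ht)
      (hGv t ht).2.2.1 (hg₀ t ht) hΘ)
    (fun t ht => by
      refine ⟨((eLpNorm (G t) 2 (volume.restrict (exterior RW))).toReal + 1) / √sphereArea, ?_⟩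
      filter_upwards [eventually_eLpNorm_le (eventually_nhdsWithin_of_forall fun t' ht' =>
        (hGv t' ht').2.2.1) (hGv t ht).2.2.1 (hGv t ht).2.2.2.2.1] with t' ht'
      gcongr)
    (fun θ hθ => by
      -- Polar coordinates turn `radialTest` of θ into integration against r θ; dividing θ by r
      -- beforehand removes the weight.
      have hθ' := hθ.div_pow hRW 1
      have h1 : ∀ t ∈ I, ∫ r, g₀ t r * θ r = (U t (radialTest hθ' hRW)).re / sphereArea := by
        intro t ht
        rw [(sol.isFunction t ht _).2,
          integral_radialTest_mul hθ' hRW ((hg₀ t ht).mono fun x hx _ => hx), Complex.ofReal_re,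
          mul_div_cancel_left₀ _ hc.ne']
        refine integral_congr_ae (Eventually.of_forall fun r => ?_)
        rcases eq_or_ne r 0 with rfl | hr
        · simp [hθ.eq_zero hRW]
        · field_simp
      refine ContinuousOn.congr ?_ h1
      exact (Complex.continuous_re.comp_continuousOn (sol.continuousOn_pairing _)).div_const _)
  refine ⟨g, hgc, fun t ht => ?_⟩
  have h2 : ∀ᵐ x : E3, RW < ‖x‖ → g₀ t ‖x‖ = g t ‖x‖ :=
    ae_comp_norm ((hg t ht).mono fun r hr _ => hr)
  filter_upwards [hg₀ t ht, h2] with x h3 h4 hx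
  rw [h3, h4 hx]

end Representative

/-! ### The velocity as a functional on radial test functions. -/

section Velocity

variable {a : ℝ} {θ : ℝ → ℝ} {I : Set ℝ} {v : ℝ → E3 → ℝ}

/-- The pairing of the velocity with a radial test function. -/
def velocityPairing (v : ℝ → E3 → ℝ) (t : ℝ) (θ : ℝ → ℝ) : ℝ :=
  sphereArea⁻¹ * ∫ x, v t x / ‖x‖ * θ ‖x‖

theorem apply_radialTest (ha : 0 ≤ a) {T : 𝓢'(E3, ℂ)} {t : ℝ}
    (hT : AgreesOn T (fun x => (v t x : ℂ)) (exterior a)) (h : IsTestOn a θ) :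
    (T (radialTest h ha)).re = sphereArea * velocityPairing v t θ := by
  rw [hT _ (hasCompactSupport_radialTest h ha) (tsupport_radialTest_subset h ha), velocityPairing,
    mul_inv_cancel_left₀ sphereArea_pos.ne', ← Complex.ofReal_re (∫ x, _), ← integral_complex_ofReal]
  congr 2
  funext x
  rw [radialTest_apply]
  push_cast
  ring

theorem integrableOn_div_norm (ha : 0 ≤ a) {f : E3 → ℝ}
    (hf : MemLp f 2 (volume.restrict (exterior a))) {c : ℝ} (hc : a < c) (d : ℝ) :
    IntegrableOn (fun x => f x / ‖x‖) ((fun x : E3 => ‖x‖) ⁻¹' Set.Icc c d) := by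
  set K := (fun x : E3 => ‖x‖) ⁻¹' Set.Icc c d with hK
  have hKm : MeasurableSet K := measurable_norm measurableSet_Icc
  have hKe : K ⊆ exterior a := fun x hx => hc.trans_le hx.1
  have hKf : volume K < ⊤ := by
    refine lt_of_le_of_lt (measure_mono fun x hx => ?_)
      (isCompact_closedBall (0 : E3) d).measure_lt_top
    rw [mem_closedBall_zero_iff]; exact hx.2
  have : IsFiniteMeasure (volume.restrict K) := ⟨by rwa [Measure.restrict_apply_univ]⟩
  have h1 : IntegrableOn f K :=
    MemLp.integrable (q := 2) (by norm_num) (hf.mono_measure (Measure.restrict_mono hKe le_rfl))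
  have h2 := h1.mul_bdd (c := c⁻¹) (g := fun x : E3 => ‖x‖⁻¹)
    (measurable_norm.inv.aestronglyMeasurable)
    ((ae_restrict_iff' hKm).2 (Eventually.of_forall fun x hx => by
      rw [norm_inv, norm_norm]
      exact inv_anti₀ (ha.trans_lt hc) hx.1))
  exact h2

theorem integrable_div_norm_mul (ha : 0 ≤ a) {f : E3 → ℝ}
    (hf : MemLp f 2 (volume.restrict (exterior a))) (h : IsTestOn a θ) :
    Integrable fun x => f x / ‖x‖ * θ ‖x‖ := by
  obtain ⟨c, d, hac, -, h0⟩ := h.exists_Icc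
  obtain ⟨C, hC⟩ := h.2.1.exists_bound_of_continuous h.continuous
  have hKm : MeasurableSet ((fun x : E3 => ‖x‖) ⁻¹' Set.Icc c d) := measurable_norm measurableSet_Icc
  refine ((integrableOn_div_norm ha hf hac d).integrable_indicator hKm).mul_bdd (c := C)
    (g := fun x : E3 => θ ‖x‖) (h.continuous.comp continuous_norm).aestronglyMeasurable
    (Eventually.of_forall fun x => hC _) |>.congr (Eventually.of_forall fun x => ?_)
  simp only
  by_cases hx : x ∈ (fun x : E3 => ‖x‖) ⁻¹' Set.Icc c d
  · rw [Set.indicator_of_mem hx]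
  · rw [h0 _ hx, mul_zero, mul_zero]

theorem hasDerivAt_velocityPairing (ha : 0 ≤ a) {t : ℝ}
    (hv : MemLp (v t) 2 (volume.restrict (exterior a))) {κ ρ : ℝ} (hθ : IsBumpFunction κ θ)
    (hρ : a + κ < ρ) :
    HasDerivAt (fun σ => velocityPairing v t fun r => θ (r - σ))
      (-velocityPairing v t fun r => deriv θ (r - ρ)) ρ := by
  have := (hasDerivAt_integral_shift (μ := volume) (N := fun x : E3 => ‖x‖)
    (f := fun x => v t x / ‖x‖) measurable_norm
    (fun c d hc => integrableOn_div_norm ha hv hc d) hθ hρ).const_mul sphereArea⁻¹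
  rwa [mul_neg] at this

/-- Continuous dependence of the velocity pairing on time, uniformly for translates of a bump. -/
theorem exists_velocityPairing_sub_le (ha : 0 ≤ a)
    (hv : ∀ t ∈ I, MemLp (v t) 2 (volume.restrict (exterior a))) {κ : ℝ} (hθ : IsBumpFunction κ θ)
    (c d : ℝ) (hc : a < c) : ∃ C, ∀ t ∈ I, ∀ t' ∈ I, ∀ ρ, c + κ ≤ ρ → ρ + κ ≤ d →
      |velocityPairing v t' (fun r => θ (r - ρ)) - velocityPairing v t fun r => θ (r - ρ)| ≤
        C * (eLpNorm (fun x => v t' x - v t x) 2 (volume.restrict (exterior a))).toReal := by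
  have hc0 : 0 < c := ha.trans_lt hc
  obtain ⟨M, hM⟩ := hθ.exists_bound
  have hM0 : 0 ≤ M := (norm_nonneg _).trans (hM 0)
  set K := (fun x : E3 => ‖x‖) ⁻¹' Set.Icc c d with hK
  have hKm : MeasurableSet K := measurable_norm measurableSet_Icc
  have hKe : K ⊆ exterior a := fun x hx => hc.trans_le hx.1
  have hKf : volume K < ⊤ := by
    refine lt_of_le_of_lt (measure_mono fun x hx => ?_)
      (isCompact_closedBall (0 : E3) d).measure_lt_top
    rw [mem_closedBall_zero_iff]; exact hx.2
  -- One function on a fixed shell dominates θ(|x| - ρ)/|x| for all admissible ρ, so Cauchy–Schwarz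
  -- gives a constant independent of the translate.
  set b : E3 → ℝ := K.indicator fun _ => M / c with hb
  have hbL : MemLp b 2 (volume.restrict (exterior a)) :=
    (memLp_indicator_const 2 hKm _ (Or.inr hKf.ne)).restrict _
  refine ⟨sphereArea⁻¹ * √(∫ x in exterior a, b x ^ 2), fun t ht t' ht' ρ hρ1 hρ2 => ?_⟩
  have hT : IsTestOn a fun r => θ (r - ρ) := hθ.isTestOn (by linarith)
  have hd : MemLp (fun x => v t' x - v t x) 2 (volume.restrict (exterior a)) :=
    (hv t' ht').sub (hv t ht)
  have h1 : velocityPairing v t' (fun r => θ (r - ρ)) - velocityPairing v t (fun r => θ (r - ρ)) =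
      sphereArea⁻¹ * ∫ x, (v t' x - v t x) / ‖x‖ * θ (‖x‖ - ρ) := by
    rw [velocityPairing, velocityPairing, ← mul_sub,
      ← integral_sub (integrable_div_norm_mul ha (hv t' ht') hT)
        (integrable_div_norm_mul ha (hv t ht) hT)]
    congr 2
    funext x
    ring
  have h2 : ∫ x, (v t' x - v t x) / ‖x‖ * θ (‖x‖ - ρ) =
      ∫ x in exterior a, (v t' x - v t x) / ‖x‖ * θ (‖x‖ - ρ) :=
    (setIntegral_eq_integral_of_forall_compl_eq_zero fun x hx => by
      rw [hT.eq_zero (not_lt.1 hx), mul_zero]).symm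
  have h3 : |∫ x in exterior a, (v t' x - v t x) / ‖x‖ * θ (‖x‖ - ρ)| ≤
      ∫ x in exterior a, ‖v t' x - v t x‖ * ‖b x‖ := by
    rw [← Real.norm_eq_abs]
    refine norm_integral_le_of_norm_le (MemLp.integrable_mul (p := 2) (q := 2) hd.norm hbL.norm)
      (Eventually.of_forall fun x => ?_)
    by_cases hx : x ∈ K
    · rw [hb, Set.indicator_of_mem hx, norm_mul, norm_div, div_mul_eq_mul_div, mul_div_assoc,
        Real.norm_of_nonneg (show 0 ≤ M / c by positivity), norm_norm]
      refine mul_le_mul_of_nonneg_left ?_ (norm_nonneg _)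
      exact div_le_div₀ hM0 (hM _) hc0 hx.1
    · rw [hθ.eq_zero (x := ‖x‖ - ρ) fun h => hx ⟨by linarith [h.1], by linarith [h.2]⟩, mul_zero,
        norm_zero]
      positivity
  have h4 := integral_mul_norm_le_eLpNorm_mul_sqrt hd hbL
  rw [h1, h2, abs_mul, abs_of_pos (inv_pos.2 sphereArea_pos)]
  refine (mul_le_mul_of_nonneg_left (h3.trans h4) (inv_pos.2 sphereArea_pos).le).trans (le_of_eq ?_)
  ring

/-- Differentiability in ρ at a fixed time, combined with continuity in t that is uniform over
nearby ρ. -/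
theorem continuousOn_velocityPairing (ha : 0 ≤ a)
    (hv : ∀ t ∈ I, MemLp (v t) 2 (volume.restrict (exterior a)))
    (hvc : ∀ t ∈ I, Tendsto (fun t' => eLpNorm (fun x => v t' x - v t x) 2
      (volume.restrict (exterior a))) (𝓝[I] t) (𝓝 0)) {κ : ℝ} (hθ : IsBumpFunction κ θ) :
    ContinuousOn (Function.uncurry fun t ρ => velocityPairing v t fun r => θ (r - ρ))
      (I ×ˢ Set.Ioi (a + κ)) := by
  rintro ⟨t, ρ⟩ ⟨ht, hρ⟩
  simp only [Set.mem_Ioi] at hρ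
  set ε := (ρ - (a + κ)) / 3 with hε
  have hε0 : 0 < ε := by rw [hε]; linarith
  obtain ⟨C, hC⟩ := exists_velocityPairing_sub_le ha hv hθ (a + ε) (ρ + κ + ε) (by linarith)
  have hfst : Tendsto Prod.fst (𝓝[I ×ˢ Set.Ioi (a + κ)] (t, ρ)) (𝓝[I] t) :=
    continuousWithinAt_fst.tendsto_nhdsWithin fun z hz => hz.1
  have hsnd : Tendsto Prod.snd (𝓝[I ×ˢ Set.Ioi (a + κ)] (t, ρ)) (𝓝 ρ) := continuousWithinAt_snd
  have h1 : Tendsto (fun z : ℝ × ℝ => velocityPairing v t fun r => θ (r - z.2))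
      (𝓝[I ×ˢ Set.Ioi (a + κ)] (t, ρ)) (𝓝 (velocityPairing v t fun r => θ (r - ρ))) :=
    Tendsto.comp (g := fun σ => velocityPairing v t fun r => θ (r - σ))
      (hasDerivAt_velocityPairing ha (hv t ht) hθ hρ).continuousAt hsnd
  have h2 : Tendsto (fun z : ℝ × ℝ => velocityPairing v z.1 (fun r => θ (r - z.2)) -
      velocityPairing v t fun r => θ (r - z.2)) (𝓝[I ×ˢ Set.Ioi (a + κ)] (t, ρ)) (𝓝 0) := by
    have h3 : Tendsto (fun z : ℝ × ℝ => C * (eLpNorm (fun x => v z.1 x - v t x) 2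
        (volume.restrict (exterior a))).toReal) (𝓝[I ×ˢ Set.Ioi (a + κ)] (t, ρ)) (𝓝 0) := by
      have h4 := ((ENNReal.tendsto_toReal ENNReal.zero_ne_top).comp
        ((hvc t ht).comp hfst)).const_mul C
      simpa using h4
    refine squeeze_zero_norm' ?_ h3
    have h5 : ∀ᶠ z in 𝓝[I ×ˢ Set.Ioi (a + κ)] (t, ρ), z.2 ∈ Set.Icc (ρ - ε) (ρ + ε) :=
      hsnd.eventually (Icc_mem_nhds (by linarith) (by linarith))
    filter_upwards [h5, self_mem_nhdsWithin] with z hz1 hz2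
    exact hC t ht z.1 hz2.1 z.2 (by linarith [hz1.1]) (by linarith [hz1.2])
  have h6 := h2.add h1
  simp only [sub_add_cancel, zero_add] at h6
  exact h6

end Velocity


/-! ### The half-line wave equation for r (u - W). -/

section TestIntegrals

variable {a : ℝ} {θ : ℝ → ℝ} {I : Set ℝ}

theorem continuous_mul_test {k : ℝ → ℝ} (hk : ContinuousOn k (Set.Ioi a)) (h : IsTestOn a θ) :
    Continuous fun r => k r * θ r := by
  refine continuous_iff_continuousAt.2 fun r => ?_
  by_cases hr : r ∈ tsupport θ
  · exact (hk.continuousAt (Ioi_mem_nhds (h.2.2 hr))).mul h.continuous.continuousAt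
  · refine continuousAt_const (y := (0 : ℝ)) |>.congr ?_
    filter_upwards [(isClosed_tsupport θ).isOpen_compl.mem_nhds hr] with x hx
    rw [image_eq_zero_of_notMem_tsupport hx, mul_zero]

theorem integrable_mul_test {k : ℝ → ℝ} (hk : ContinuousOn k (Set.Ioi a)) (h : IsTestOn a θ) :
    Integrable fun r => k r * θ r :=
  (continuous_mul_test hk h).integrable_of_hasCompactSupport h.2.1.mul_left

theorem continuousOn_integral_mul_test {k : ℝ → ℝ → ℝ}
    (hk : ContinuousOn (Function.uncurry k) (I ×ˢ Set.Ioi a)) (h : IsTestOn a θ) :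
    ContinuousOn (fun t => ∫ r, k t r * θ r) I := by
  refine continuousOn_integral_of_compact_support (k := tsupport θ) h.2.1 ?_
    fun t r _ hr => by rw [image_eq_zero_of_notMem_tsupport hr, mul_zero]
  rintro ⟨t, r⟩ ⟨ht, -⟩
  by_cases hr : r ∈ tsupport θ
  · have h1 : 𝓝[I ×ˢ Set.univ] (t, r) = 𝓝[I ×ˢ Set.Ioi a] (t, r) := by
      rw [nhdsWithin_prod_eq, nhdsWithin_prod_eq, nhdsWithin_univ,
        (isOpen_Ioi.nhdsWithin_eq (h.2.2 hr))]
    have h2 : Tendsto (Function.uncurry k) (𝓝[I ×ˢ Set.univ] (t, r)) (𝓝 (k t r)) := by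
      rw [h1]; exact hk (t, r) ⟨ht, h.2.2 hr⟩
    exact h2.mul ((h.continuous.comp continuous_snd).continuousAt.continuousWithinAt)
  · have h5 : ∀ᶠ w : ℝ × ℝ in 𝓝 (t, r), w.2 ∉ tsupport θ :=
      (continuous_snd.tendsto (t, r)).eventually
        ((isClosed_tsupport θ).isOpen_compl.mem_nhds hr)
    refine ContinuousAt.continuousWithinAt (continuousAt_const (y := (0 : ℝ)) |>.congr ?_)
    filter_upwards [h5] with w hw
    simp [Function.uncurry, image_eq_zero_of_notMem_tsupport hw]

theorem hasDerivWithinAt_of_sub_eq_integral {f m : ℝ → ℝ} (hI : I.OrdConnected)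
    (hm : ContinuousOn m I) {t : ℝ} (ht : t ∈ I)
    (hf : ∀ s ∈ I, f s - f t = ∫ σ in t..s, m σ) : HasDerivWithinAt f (m t) I t := by
  rw [hasDerivWithinAt_iff_isLittleO, Asymptotics.isLittleO_iff]
  intro c hc
  have h1 : ∀ᶠ s in 𝓝[I] t, dist (m s) (m t) < c := Metric.tendsto_nhds.1 (hm t ht) c hc
  obtain ⟨δ, hδ, hball⟩ := Metric.mem_nhdsWithin_iff.1 h1
  filter_upwards [inter_mem_nhdsWithin I (Metric.ball_mem_nhds t hδ)] with s hs
  have hsub : Set.uIcc t s ⊆ I := hI.uIcc_subset ht hs.1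
  have hint : IntervalIntegrable m volume t s := (hm.mono hsub).intervalIntegrable
  have h2 : f s - f t - (s - t) • m t = ∫ σ in t..s, (m σ - m t) := by
    rw [hf s hs.1, intervalIntegral.integral_sub hint intervalIntegrable_const,
      intervalIntegral.integral_const]
  rw [h2]
  refine intervalIntegral.norm_integral_le_of_norm_le_const fun σ hσ => ?_
  have hσ' := Set.uIoc_subset_uIcc hσ
  have h3 : σ ∈ Metric.ball t δ := by
    rw [Metric.mem_ball, Real.dist_eq]
    exact (Set.abs_sub_left_of_mem_uIcc hσ').trans_lt (by simpa [Real.dist_eq] using hs.2)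
  exact (hball ⟨h3, hsub hσ'⟩ : dist (m σ) (m t) < c).le

end TestIntegrals

section Instance

variable {p C₅ RW : ℝ} {F : ℝ → ℝ → ℝ} {I : Set ℝ} {u v : ℝ → E3 → ℝ} {U V : ℝ → 𝓢'(E3, ℂ)}
  {W : E3 → ℝ} {g : ℝ → ℝ → ℝ}

theorem IsNonlinearity.continuousOn_source (hF : IsNonlinearity p C₅ F) (hRW : 0 ≤ RW)
    {k : ℝ → ℝ → ℝ} (hk : ContinuousOn (Function.uncurry k) (I ×ˢ Set.Ioi RW)) :
    ContinuousOn (Function.uncurry fun t r => r * F r (k t r)) (I ×ˢ Set.Ioi RW) := by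
  have h1 : ContinuousOn (fun z : ℝ × ℝ => Function.uncurry F (z.2, Function.uncurry k z))
      (I ×ˢ Set.Ioi RW) :=
    hF.continuousOn.comp (continuousOn_snd.prodMk hk) fun z hz =>
      ⟨hRW.trans (le_of_lt hz.2), Set.mem_univ _⟩
  exact continuousOn_snd.mul h1

/-- On a compact set both functions are bounded, so the factors |a|^{p-1} + |b|^{p-1} in the
Lipschitz condition become a constant and the source is controlled linearly by the difference. -/
theorem IsNonlinearity.exists_source_le (hp3 : 3 < p) (hF : IsNonlinearity p C₅ F) (hRW : 0 ≤ RW)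
    {k w : ℝ → ℝ → ℝ} (hk : ContinuousOn (Function.uncurry k) (I ×ˢ Set.Ioi RW))
    (hw : ContinuousOn (Function.uncurry w) (I ×ˢ Set.Ioi RW)) {K : Set (ℝ × ℝ)}
    (hK : K ⊆ I ×ˢ Set.Ioi RW) (hKc : IsCompact K) :
    ∃ C, ∀ z ∈ K, |z.2 * (F z.2 (k z.1 z.2) - F z.2 (w z.1 z.2))| ≤
      C * |z.2 * (k z.1 z.2 - w z.1 z.2)| := by
  obtain ⟨A, hA⟩ := hKc.exists_bound_of_continuousOn (hk.mono hK)
  obtain ⟨B, hB⟩ := hKc.exists_bound_of_continuousOn (hw.mono hK)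
  refine ⟨|C₅| * (|A| ^ (p - 1) + |B| ^ (p - 1)), fun z hz => ?_⟩
  have hz2 : 0 ≤ z.2 := hRW.trans (le_of_lt (hK hz).2)
  have h1 := hF.lipschitz z.2 hz2 (k z.1 z.2) (w z.1 z.2)
  have h2 : |k z.1 z.2| ^ (p - 1) ≤ |A| ^ (p - 1) :=
    Real.rpow_le_rpow (abs_nonneg _) ((hA z hz).trans (le_abs_self A)) (by linarith)
  have h3 : |w z.1 z.2| ^ (p - 1) ≤ |B| ^ (p - 1) :=
    Real.rpow_le_rpow (abs_nonneg _) ((hB z hz).trans (le_abs_self B)) (by linarith)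
  have h4 : |F z.2 (k z.1 z.2) - F z.2 (w z.1 z.2)| ≤
      |C₅| * (|A| ^ (p - 1) + |B| ^ (p - 1)) * |k z.1 z.2 - w z.1 z.2| := by
    refine h1.trans ?_
    calc C₅ * |k z.1 z.2 - w z.1 z.2| * (|k z.1 z.2| ^ (p - 1) + |w z.1 z.2| ^ (p - 1))
        ≤ |C₅| * |k z.1 z.2 - w z.1 z.2| * (|A| ^ (p - 1) + |B| ^ (p - 1)) := by
          gcongr
          exact le_abs_self _
      _ = _ := by ring
  rw [abs_mul, abs_mul, abs_of_nonneg hz2]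
  calc z.2 * |F z.2 (k z.1 z.2) - F z.2 (w z.1 z.2)|
      ≤ z.2 * (|C₅| * (|A| ^ (p - 1) + |B| ^ (p - 1)) * |k z.1 z.2 - w z.1 z.2|) := by gcongr
    _ = _ := by ring

/-- The difference `r (u - W)` solves a half-line wave equation. -/
theorem isHalfLineWave_sub (hp3 : 3 < p) (hp5 : p < 5) (hRW : 0 ≤ RW) (hW : IsRadialProfile RW W)
    (hF : IsNonlinearity p C₅ F) (hFW : SolvesElliptic RW F W) (hI : I.OrdConnected)
    (sol : IsSolution p F I u U V)
    (hg : ContinuousOn (Function.uncurry g) (I ×ˢ Set.Ioi RW))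
    (hug : ∀ t ∈ I, ∀ᵐ x : E3, x ∈ exterior RW → u t x = g t ‖x‖)
    (hV : ∀ t ∈ I, AgreesOn (V t) (fun x => (v t x : ℂ)) (exterior RW))
    (hv : ∀ t ∈ I, MemLp (v t) 2 (volume.restrict (exterior RW)))
    (hvc : ∀ t ∈ I, Tendsto (fun t' => eLpNorm (fun x => v t' x - v t x) 2
      (volume.restrict (exterior RW))) (𝓝[I] t) (𝓝 0)) :
    IsHalfLineWave I RW (fun t r => r * (g t r - profile W r))
      (fun t r => r * (F r (g t r) - F r (profile W r))) (velocityPairing v) := by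
  have hc := sphereArea_pos
  have hw1 : ContinuousOn (profile W) (Set.Ioi RW) := (hW.contDiffOn_profile hRW).continuousOn
  have hw : ContinuousOn (Function.uncurry fun (_ : ℝ) r => profile W r) (I ×ˢ Set.Ioi RW) :=
    hw1.comp continuousOn_snd fun z hz => hz.2
  have hsec : ∀ {k : ℝ → ℝ → ℝ}, ContinuousOn (Function.uncurry k) (I ×ˢ Set.Ioi RW) →
      ∀ t ∈ I, ContinuousOn (k t) (Set.Ioi RW) := fun {k} hk t ht => by
    have : ContinuousOn (fun r => Function.uncurry k (t, r)) (Set.Ioi RW) :=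
      hk.comp (by fun_prop) fun r hr => ⟨ht, hr⟩
    exact this
  have hcont : ContinuousOn (Function.uncurry fun t r => r * (g t r - profile W r))
      (I ×ˢ Set.Ioi RW) := continuousOn_snd.mul (hg.sub hw)
  have hrg : ContinuousOn (Function.uncurry fun t r => r * g t r) (I ×ˢ Set.Ioi RW) :=
    continuousOn_snd.mul hg
  have hrw : ContinuousOn (fun r => r * profile W r) (Set.Ioi RW) := continuousOn_id.mul hw1
  have hFg := hF.continuousOn_source hRW hg
  have hFw := hF.continuousOn_source hRW hw
  have hcs : ContinuousOn (Function.uncurry fun t r => r * (F r (g t r) - F r (profile W r)))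
      (I ×ˢ Set.Ioi RW) :=
    (hFg.sub hFw).congr fun z _ => by
      simp only [Function.uncurry, Pi.sub_apply]; ring
  have hU : ∀ t ∈ I, ∀ θ, ∀ hθ : IsTestOn RW θ,
      U t (radialTest hθ hRW) = ((sphereArea * ∫ r, r * g t r * θ r : ℝ) : ℂ) := fun t ht θ hθ => by
    rw [(sol.isFunction t ht _).2, integral_radialTest_mul hθ hRW (hug t ht)]
  have hsplit : ∀ t ∈ I, ∀ θ, IsTestOn RW θ → ∫ r, r * (g t r - profile W r) * θ r =
      (∫ r, r * g t r * θ r) - ∫ r, r * profile W r * θ r := fun t ht θ hθ => by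
    rw [← integral_sub (integrable_mul_test (hsec hrg t ht) hθ) (integrable_mul_test hrw hθ)]
    congr 1; funext r; ring
  have hsplitF : ∀ t ∈ I, ∀ θ, IsTestOn RW θ →
      ∫ r, r * (F r (g t r) - F r (profile W r)) * θ r =
      (∫ r, r * F r (g t r) * θ r) - ∫ r, r * F r (profile W r) * θ r := fun t ht θ hθ => by
    rw [← integral_sub (integrable_mul_test (hsec hFg t ht) hθ)
      (integrable_mul_test (hsec hFw t ht) hθ)]
    congr 1; funext r; ring
  have hVp : ∀ t ∈ I, ∀ θ, ∀ hθ : IsTestOn RW θ,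
      velocityPairing v t θ = (V t (radialTest hθ hRW)).re / sphereArea := fun t ht θ hθ => by
    rw [apply_radialTest hRW (hV t ht) hθ, mul_div_cancel_left₀ _ hc.ne']
  constructor
  · exact hcont
  · intro θ hθ t ht
    have h1 : HasDerivWithinAt (fun s => (U s (radialTest hθ hRW)).re)
        (V t (radialTest hθ hRW)).re I t :=
      Complex.reCLM.hasFDerivAt.comp_hasDerivWithinAt t (sol.timeDeriv t ht _)
    have h2 := (h1.div_const sphereArea).sub_const (∫ r, r * profile W r * θ r)
    rw [← hVp t ht θ hθ] at h2
    refine h2.congr_of_mem (fun s hs => ?_) ht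
    rw [hsplit s hs θ hθ, hU s hs θ hθ, Complex.ofReal_re, mul_div_cancel_left₀ _ hc.ne']
  · intro θ hθ t ht
    refine hasDerivWithinAt_of_sub_eq_integral (f := fun s => velocityPairing v s θ)
      (m := fun s => (∫ r, r * (g s r - profile W r) * deriv (deriv θ) r) +
        ∫ r, r * (F r (g s r) - F r (profile W r)) * θ r) hI
      ((continuousOn_integral_mul_test hcont hθ.deriv.deriv).add
        (continuousOn_integral_mul_test hcs hθ)) ht fun s hs => ?_
    have hsub : Set.uIcc t s ⊆ I := hI.uIcc_subset ht hs
    have h1 := sol.timeDeriv_sub hp3 hp5 hF hI ht hs (radialTest hθ hRW)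
    -- The profile enters by adding zero: tested against θ, its stationary equation moves two
    -- derivatives onto θ, so the equation for u becomes the one for the difference.
    have h2 : ∀ σ ∈ Set.uIcc t s, U σ (Laplacian.laplacian (radialTest hθ hRW)) +
        ∫ x, radialTest hθ hRW x * (F ‖x‖ (u σ x) : ℂ) =
        ((sphereArea * ((∫ r, r * (g σ r - profile W r) * deriv (deriv θ) r) +
          ∫ r, r * (F r (g σ r) - F r (profile W r)) * θ r) : ℝ) : ℂ) := by
      intro σ hσ
      rw [laplacian_radialTest, hU σ (hsub hσ) _ hθ.deriv.deriv,
        integral_radialTest_mul hθ hRW (f := fun x => F ‖x‖ (u σ x)) (k := fun r => F r (g σ r))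
          ((hug σ (hsub hσ)).mono fun x hx hxe => by rw [hx hxe]),
        hsplit σ (hsub hσ) _ hθ.deriv.deriv, hsplitF σ (hsub hσ) θ hθ,
        hW.integral_profile_mul_deriv_deriv hRW hFW hθ, ← Complex.ofReal_add]
      congr 1; ring
    rw [intervalIntegral.integral_congr h2, intervalIntegral.integral_ofReal] at h1
    have h3 := congrArg Complex.re h1
    rw [Complex.sub_re, Complex.ofReal_re, intervalIntegral.integral_const_mul] at h3
    rw [hVp s hs θ hθ, hVp t ht θ hθ, ← sub_div, h3, mul_div_cancel_left₀ _ hc.ne']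
  · exact fun κ θ hθ t ht ρ hρ => hasDerivAt_velocityPairing hRW (hv t ht) hθ hρ
  · exact fun κ θ hθ => continuousOn_velocityPairing hRW hv hvc hθ
  · intro K hK hKc
    exact hF.exists_source_le hp3 hRW hg hw hK hKc

end Instance


/-! ### Back from the half-line wave to the essential radius. -/

section Extraction

variable {p RW R ρ t t₀ : ℝ} {F : ℝ → ℝ → ℝ} {I : Set ℝ} {u v : ℝ → E3 → ℝ} {U V : ℝ → 𝓢'(E3, ℂ)}
  {W : E3 → ℝ} {g : ℝ → ℝ → ℝ} {θ : ℝ → ℝ}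

theorem exterior_subset (h : RW ≤ R) : exterior R ⊆ exterior RW := fun _ hx => h.trans_lt hx

theorem isOpen_exterior (R : ℝ) : IsOpen (exterior R) := isOpen_lt continuous_const continuous_norm

/-- Both sides are continuous in |x| on the exterior region, and almost everywhere equality of
continuous functions on an open set is equality. -/
theorem eq_profile_of_ae_eq (hRW : 0 ≤ RW) (hR : RW ≤ R) (hW : IsRadialProfile RW W)
    (hg : ContinuousOn (g t) (Set.Ioi RW)) (hug : ∀ᵐ x : E3, x ∈ exterior RW → u t x = g t ‖x‖)
    (h : ∀ᵐ x : E3, x ∈ exterior R → u t x = W x) {r : ℝ} (hr : R < r) : g t r = profile W r := by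
  have hs := exterior_subset hR
  have h1 : (fun x : E3 => g t ‖x‖) =ᵐ[volume.restrict (exterior R)] fun x => profile W ‖x‖ := by
    refine (ae_restrict_iff' (isOpen_exterior R).measurableSet).2 ?_
    filter_upwards [hug, h] with x h2 h3 hx
    rw [← h2 (hs hx), h3 hx, hW.eq_profile (hs hx)]
  have hmaps : Set.MapsTo (fun x : E3 => ‖x‖) (exterior R) (Set.Ioi RW) := fun x hx => hs hx
  have h2 := Measure.eqOn_open_of_ae_eq h1 (isOpen_exterior R)
    (hg.comp continuous_norm.continuousOn hmaps)
    ((hW.contDiffOn_profile hRW).continuousOn.comp continuous_norm.continuousOn hmaps)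
  have hr0 : 0 ≤ r := hRW.trans (hR.trans hr.le)
  have h3 := h2 (show r • (EuclideanSpace.single 0 1 : E3) ∈ exterior R by
    show R < _; rwa [norm_smul_single hr0])
  simpa only [norm_smul_single hr0] using h3

theorem velocityPairing_eq_zero (hRW : 0 ≤ RW) (hR : RW ≤ R)
    (hV : AgreesOn (V t) (fun x => (v t x : ℂ)) (exterior RW))
    (h : Distribution.IsVanishingOn (V t) (exterior R)) (hθ : IsTestOn R θ) :
    velocityPairing v t θ = 0 := by
  have h1 := apply_radialTest (v := v) (t := t) (hRW.trans hR)
    (fun φ hφ hs => hV φ hφ (hs.trans (exterior_subset hR))) hθ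
  rw [h _ (tsupport_radialTest_subset hθ (hRW.trans hR)), Complex.zero_re] at h1
  exact (mul_eq_zero.1 h1.symm).resolve_left sphereArea_pos.ne'

theorem ae_eq_of_eq_profile (hR : RW ≤ R) (hW : IsRadialProfile RW W)
    (hug : ∀ᵐ x : E3, x ∈ exterior RW → u t x = g t ‖x‖) (h : ∀ r, R < r → g t r = profile W r) :
    ∀ᵐ x : E3, x ∈ exterior R → u t x = W x := by
  filter_upwards [hug] with x hx hxR
  rw [hx (exterior_subset hR hxR), h _ hxR, hW.eq_profile (exterior_subset hR hxR)]

/-- The support of a Schwartz function need not be compact, but its part within |x| ≤ R + 1 is, and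
there the norm attains its minimum. -/
theorem exists_lt_norm_of_isClosed {S : Set E3} (hS : IsClosed S) (h : S ⊆ exterior R) :
    ∃ R', R < R' ∧ ∀ x ∈ S, R' ≤ ‖x‖ := by
  have hK : IsCompact (S ∩ Metric.closedBall 0 (R + 1)) := (isCompact_closedBall _ _).inter_left hS
  rcases (S ∩ Metric.closedBall 0 (R + 1)).eq_empty_or_nonempty with h0 | h0
  · refine ⟨R + 1, by linarith, fun x hx => ?_⟩
    by_contra hlt
    have : x ∈ S ∩ Metric.closedBall 0 (R + 1) :=
      ⟨hx, by rw [mem_closedBall_zero_iff]; exact (not_le.1 hlt).le⟩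
    simp [h0] at this
  · obtain ⟨x₀, hx₀, hmin⟩ := hK.exists_isMinOn h0 continuous_norm.continuousOn
    refine ⟨min ‖x₀‖ (R + 1), lt_min (h hx₀.1) (by linarith), fun x hx => ?_⟩
    rcases le_or_gt ‖x‖ (R + 1) with h1 | h1
    · exact (min_le_left _ _).trans (hmin ⟨hx, by rwa [mem_closedBall_zero_iff]⟩)
    · exact (min_le_right _ _).trans h1.le

/-- If `u = W` on the exterior of a ball whose radius grows at unit speed, then `∂ₜu` vanishes
there. -/
theorem IsSolution.isVanishingOn (sol : IsSolution p F I u U V) (hI : I.OrdConnected)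
    (hIn : (interior I).Nonempty) (ht : t ∈ I)
    (h : ∀ᶠ s in 𝓝[I] t, ∀ᵐ x : E3, x ∈ exterior (ρ + |s - t₀|) → u s x = W x) :
    Distribution.IsVanishingOn (V t) (exterior (ρ + |t - t₀|)) := by
  intro φ hφ
  obtain ⟨R', hR', hmin⟩ := exists_lt_norm_of_isClosed (isClosed_tsupport φ) hφ
  have hnear : ∀ᶠ s in 𝓝[I] t, ρ + |s - t₀| < R' := by
    have hcont : Continuous fun s : ℝ => ρ + |s - t₀| := by fun_prop
    exact nhdsWithin_le_nhds ((hcont.tendsto t).eventually (gt_mem_nhds hR'))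
  -- As long as the ball of radius ρ + |s - t₀| stays inside radius R', the pairing sees only W and
  -- does not depend on s. Its derivative, which is `V t φ`, is therefore 0.
  have hval : ∀ s ∈ I, ρ + |s - t₀| < R' →
      (∀ᵐ x : E3, x ∈ exterior (ρ + |s - t₀|) → u s x = W x) → U s φ = ∫ x, φ x * (W x : ℂ) := by
    intro s hs hsR hae
    rw [(sol.isFunction s hs φ).2]
    refine integral_congr_ae (hae.mono fun x hx => ?_)
    simp only
    by_cases hxs : x ∈ tsupport φ
    · rw [hx (hsR.trans_le (hmin x hxs))]
    · rw [image_eq_zero_of_notMem_tsupport hxs, zero_mul, zero_mul]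
  have hd : HasDerivWithinAt (fun s => U s φ) 0 I t := by
    refine (hasDerivWithinAt_const t I (∫ x, φ x * (W x : ℂ))).congr_of_eventuallyEq ?_ ?_
    · filter_upwards [h, hnear, self_mem_nhdsWithin] with s h1 h2 h3 using hval s h3 h2 h1
    · exact hval t ht hR' (h.self_of_nhdsWithin ht)
  -- The nonempty interior of I makes the one-sided derivative unique also at an endpoint of I.
  exact (uniqueDiffWithinAt_convex hI.convex hIn (subset_closure ht)).eq_deriv _
    (sol.timeDeriv t ht φ) hd

end Extraction

end RadialWave

end


/-! ### The theorem. -/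

theorem mainTheorem6 (p : ℝ) (hp3 : 3 < p) (hp5 : p < 5) (RW R₁ C₅ : ℝ) (hRW : 0 ≤ RW)
    (hR₁ : RW < R₁) (W : RadialWave.E3 → ℝ) (hW : RadialWave.IsRadialProfile RW W) :
    ∃ τ : ℝ, 0 < τ ∧
      ∀ F : ℝ → ℝ → ℝ, RadialWave.IsNonlinearity p C₅ F → RadialWave.SolvesElliptic RW F W →
      ∀ (I : Set ℝ) (t₀ : ℝ), I.OrdConnected → I ∈ 𝓝 t₀ →
      ∀ (u : ℝ → RadialWave.E3 → ℝ) (U V : ℝ → 𝓢'(RadialWave.E3, ℂ)),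
        RadialWave.IsSolution p F I u U V →
        (∀ t ∈ I, RadialWave.IsRadial (u t)) →
        RadialWave.ContinuousInEnergy (RadialWave.exterior RW) I u V →
        ∀ R₀ : ℝ, RadialWave.IsEssentialRadius RW W (u t₀) (V t₀) R₀ → R₁ < R₀ →
          (∀ t ∈ Set.Icc t₀ (t₀ + τ) ∩ I,
            RadialWave.IsEssentialRadius RW W (u t) (V t) (R₀ + |t - t₀|)) ∨
          (∀ t ∈ Set.Icc (t₀ - τ) t₀ ∩ I,
            RadialWave.IsEssentialRadius RW W (u t) (V t) (R₀ + |t - t₀|)) := by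
  -- The value 1 is arbitrary: the argument uses no smallness of the time interval.
  refine ⟨1, one_pos, fun F hF hFW I t₀ hI hIt₀ u U V sol hrad hcont R₀ hR₀ hR₁₀ => ?_⟩
  have ht₀ : t₀ ∈ I := mem_of_mem_nhds hIt₀
  have hIn : (interior I).Nonempty := ⟨t₀, mem_interior_iff_mem_nhds.2 hIt₀⟩
  obtain ⟨g, hg, hug⟩ := RadialWave.exists_radial_representative hRW sol hrad hcont
  obtain ⟨G, v, hGv⟩ := hcont
  have w := RadialWave.isHalfLineWave_sub hp3 hp5 hRW hW hF hFW hI sol hg hug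
    (fun t ht => (hGv t ht).2.1) (fun t ht => (hGv t ht).2.2.2.1) (fun t ht => (hGv t ht).2.2.2.2.2)
  have hgt : ∀ t ∈ I, ContinuousOn (g t) (Set.Ioi RW) := fun t ht => by
    have : ContinuousOn (fun r => Function.uncurry g (t, r)) (Set.Ioi RW) :=
      hg.comp (by fun_prop) fun r hr => ⟨ht, hr⟩
    exact this
  have hne : ∀ {r R : ℝ}, RW ≤ R → R < r → r ≠ 0 := fun h1 h2 => by linarith
  have hdata : ∀ t ∈ I, ∀ R, RW ≤ R →
      (∀ᵐ x : RadialWave.E3, x ∈ RadialWave.exterior R → u t x = W x) →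
      Distribution.IsVanishingOn (V t) (RadialWave.exterior R) →
      (∀ r, R < r → r * (g t r - RadialWave.profile W r) = 0) ∧
        ∀ θ, RadialWave.IsTestOn R θ → RadialWave.velocityPairing v t θ = 0 := by
    intro t ht R hR h1 h2
    refine ⟨fun r hr => ?_, fun θ hθ =>
      RadialWave.velocityPairing_eq_zero hRW hR (hGv t ht).2.1 h2 hθ⟩
    rw [RadialWave.eq_profile_of_ae_eq hRW hR hW (hgt t ht) (hug t ht) h1 hr, sub_self, mul_zero]
  have hmem : ∀ ρ, RW ≤ ρ → ∀ t ∈ I, (∀ᶠ s in 𝓝[I] t, ∀ r, ρ + |s - t₀| < r →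
      r * (g s r - RadialWave.profile W r) = 0) →
      RW ≤ ρ + |t - t₀| ∧
        (∀ᵐ x : RadialWave.E3, x ∈ RadialWave.exterior (ρ + |t - t₀|) → u t x = W x) ∧
        Distribution.IsVanishingOn (V t) (RadialWave.exterior (ρ + |t - t₀|)) := by
    intro ρ hρ t ht h
    have hle : ∀ s, RW ≤ ρ + |s - t₀| := fun s => hρ.trans (le_add_of_nonneg_right (abs_nonneg _))
    have h1 : ∀ᶠ s in 𝓝[I] t,
        ∀ᵐ x : RadialWave.E3, x ∈ RadialWave.exterior (ρ + |s - t₀|) → u s x = W x := by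
      filter_upwards [h, self_mem_nhdsWithin] with s h2 hs
      refine RadialWave.ae_eq_of_eq_profile (hle s) hW (hug s hs) fun r hr => ?_
      exact sub_eq_zero.1 ((mul_eq_zero.1 (h2 r hr)).resolve_left (hne (hle s) hr))
    exact ⟨hle t, h1.self_of_nhdsWithin ht, sol.isVanishingOn hI hIn ht h1⟩
  obtain ⟨hy₀, hZ₀⟩ := hdata t₀ ht₀ R₀ hR₀.1.1 hR₀.1.2.1 hR₀.1.2.2
  have hfs : ∀ s ∈ I, ∀ r, R₀ + |s - t₀| < r → r * (g s r - RadialWave.profile W r) = 0 :=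
    fun s hs r hr => w.eq_zero_of_vanishing hI ht₀ hR₀.1.1 hy₀ hZ₀ hs hr
  -- By finite speed, R₀ + |t - t₀| is always an admissible radius. If it is not the least one, some
  -- admissible radius is strictly smaller.
  have hlow : ∀ t ∈ I, ¬ RadialWave.IsEssentialRadius RW W (u t) (V t) (R₀ + |t - t₀|) →
      ∃ R', RW ≤ R' ∧ R' < R₀ + |t - t₀| ∧ (∀ r, R' < r →
        r * (g t r - RadialWave.profile W r) = 0) ∧
        ∀ θ, RadialWave.IsTestOn R' θ → RadialWave.velocityPairing v t θ = 0 := by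
    intro t ht hnot
    by_contra hcon
    push Not at hcon
    refine hnot ⟨hmem R₀ hR₀.1.1 t ht (eventually_nhdsWithin_of_forall hfs), fun R' hR' => ?_⟩
    by_contra hlt
    obtain ⟨h1, h2⟩ := hdata t ht R' hR'.1 hR'.2.1 hR'.2.2
    obtain ⟨θ, hθ, h3⟩ := hcon R' hR'.1 (not_le.1 hlt) h1
    exact h3 (h2 θ hθ)
  by_contra hcon
  rw [not_or] at hcon
  obtain ⟨hcon₁, hcon₂⟩ := hcon
  push Not at hcon₁ hcon₂
  obtain ⟨t₁, ⟨⟨h01, -⟩, ht₁⟩, hn₁⟩ := hcon₁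
  obtain ⟨t₂, ⟨⟨-, h20⟩, ht₂⟩, hn₂⟩ := hcon₂
  -- At t₀ itself the identity is the hypothesis on R₀, so both exceptional times differ from t₀.
  have hlt₁ : t₀ < t₁ := lt_of_le_of_ne h01 fun h => hn₁ (by subst h; simpa using hR₀)
  have hlt₂ : t₂ < t₀ := lt_of_le_of_ne h20 fun h => hn₂ (by subst h; simpa using hR₀)
  obtain ⟨A₁, -, hA₁, hyA₁, hZA₁⟩ := hlow t₁ ht₁ hn₁
  obtain ⟨A₂, -, hA₂, hyA₂, hZA₂⟩ := hlow t₂ ht₂ hn₂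
  -- A single radius below R₀ that serves at both times; including R₁ keeps it above R_W, inside the
  -- domain of the equation.
  set ρ₁ := max R₁ (max (A₁ - |t₁ - t₀|) (A₂ - |t₂ - t₀|)) with hρ₁
  have hm₁ : A₁ ≤ ρ₁ + |t₁ - t₀| := by
    have := (le_max_left (A₁ - |t₁ - t₀|) (A₂ - |t₂ - t₀|)).trans (le_max_right R₁ _)
    linarith
  have hm₂ : A₂ ≤ ρ₁ + |t₂ - t₀| := by
    have := (le_max_right (A₁ - |t₁ - t₀|) (A₂ - |t₂ - t₀|)).trans (le_max_right R₁ _)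
    linarith
  have hsub : Set.Icc t₂ t₁ ⊆ I := hI.out ht₂ ht₁
  obtain ⟨ρ, hρ₁ρ, hρR, hvan⟩ := w.exists_vanishing_of_two_times hsub h01 h20
    (hR₁.trans_le (le_max_left _ _)) (max_lt hR₁₀ (max_lt (by linarith) (by linarith)))
    (fun s hs => hfs s (hsub hs)) (fun r hr => hyA₁ r (hm₁.trans_lt hr))
    (fun θ hθ => hZA₁ θ (hθ.mono hm₁)) (fun r hr => hyA₂ r (hm₂.trans_lt hr))
    (fun θ hθ => hZA₂ θ (hθ.mono hm₂))
  -- That ∂ₜu vanishes at t₀ is obtained by differentiating in time, so vanishing is needed on a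
  -- neighbourhood of t₀; this is where t₂ < t₀ < t₁ must be strict.
  have hρ0 := hmem ρ (hR₁.le.trans ((le_max_left _ _).trans hρ₁ρ)) t₀ ht₀ (by
    filter_upwards [nhdsWithin_le_nhds (Icc_mem_nhds hlt₂ hlt₁)] with s hs using hvan s hs)
  rw [sub_self, abs_zero, add_zero] at hρ0
  exact absurd (hR₀.2 hρ0) (not_le.2 hρR)
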